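/- **Setting.** Let $1\to G=U(1)^k\to D=U(1)^n\to F=U(1)^d\to 1$ be an exact sequence of tori, given by the exact sequence of character lattices $0\leftarrow\mathbb Z^k\xleftarrow{Q^T}\mathbb Z^n\xleftarrow{P}\mathbb Z^d\leftarrow 0$ with integer matrices $Q$ ($n\times k$) and $P$ ($n\times d$). Let $\mathscr W$ be the Weyl algebra with generators $x_j,\partial_j$, $[\partial_i,x_j]=\delta_{ij}$; let $D$ act by $x_j\mapsto t_jx_j$, $\partial_j\mapsto t_j^{-1}\partial_j$, and put $h_j=x_j\partial_j+\frac12$. Write $\beta\in\mathfrak d_{\mathbb C}$ in coordinates $h_j^\vee(\beta)=b_j\in\mathbb C$ (real on $i\mathfrak d$), so $\mathfrak g_{\mathbb C}$ is the column space of $Q$. Fix a mass $\mathbf m\in i\mathfrak d$ with coordinates $m\in\mathbb R^n$, and an FI character $\boldsymbol\zeta(\beta)=i\sum_j\zeta_jb_j$, $\zeta\in\mathbb R^n$. Put $\hat\mu_{\boldsymbol\zeta}(\beta)=\sum_jb_jh_j+\boldsymbol\zeta(\beta)$ and $A_{\mathrm{Higgs}}=\big(\mathscr W/\sum_{X\in\mathfrak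 g}\mathscr W\hat\mu_{\boldsymbol\zeta}(X)\big)^G$, a ring as a quotient of $\mathscr W^G$. For $w\in\mathscr W$ let $\operatorname{Tr}_\beta(w)$ be the analytic function on $\{\beta:\cosh(\pi b_j)\ne0\ \forall j\}$ which for $\operatorname{Re}b_j<0$ (all $j$) is the trace of $(-1)^F\exp(2\pi\hat\mu_{\boldsymbol\zeta}(\beta))\,w$ on $\mathbb C[x_1,\dots,x_n]$, where $(-1)^F$ acts on $x^u$ by $(-1)^{|u|}$. Let $\{1,\dots,n\}=I\sqcup J$ with $|I|=d$, $|J|=k$, such that the minor $P_I$ of $P$ with rows $I$ has determinant $\pm1$; then so does the minor $Q^!_J:=Q_J$ of $Q$ with rows $J$ (rows in increasing order). Put $R_I=PP_I^{-1}$ and $R^!_J=QQ_J^{-1}$. Let $z_j$ ($j\in I$) and $z_j^!$ ($j\in J$) be the real numbers with $\mathbf m\equiv\sum_{j\in I}z_jh_j$ modulo $\mathfrak g_{\mathbb C}$ (here $h_j$ also denotes the $j$th basis vector of $\mathfrak d_{\mathbb C}$) and $\boldsymbol\zeta|_{\mathfrak g_{\mathbb C}}=\sum_{j\in J}iz_j^!h_j^\vee$.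 **Assume all $z_j$ and all $z^!_j$ are nonzero**, and put $\sigma_I(j)=\operatorname{sign}z_j$, $\sigma^!_J(j)=\operatorname{sign}z^!_j$, $$\mathsf r_j(I)=-\sigma_I(j)\sum_{s=1}^n(R_I)_{sj},\qquad \mathsf s_j(J)=\sigma_J^!(j)\sum_{s=1}^n(R_J^!)_{sj},\qquad \tilde{\mathsf r}_j(J)=1+\sum_{a\in J}(R_J^!)_{ja}\,\sigma_J^!(a).$$ Let $\operatorname{CS}_r(x)=\operatorname{sech}x$ for $r$ odd and $\operatorname{csch}x$ for $r$ even, and let $\wp(j)=i,1,-i,-1$ for $j\equiv0,1,2,3\pmod4$, so that $\operatorname{sech}(x+\frac{\pi i(j-1)}2)=\wp(j)\operatorname{CS}_j(x)$. The Verma module $\Delta_I$ is the $A_{\mathrm{Higgs}}$-module with a basis $v_c$, $c\in\mathbb Z_{\ge0}^I$, such that $h_jv_c=-\sigma_I(j)(c_j+\frac12)v_c$ for $j\in I$, and generated by $v_0$. Its twisted trace $\operatorname{Tr}_{\Delta_I}(w)$ is the trace of $(-1)^F\exp(2\pi\hat\mu_{\boldsymbol\zeta}(\mathbf m))\,w$,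 where $(-1)^Fv_c=(-1)^{\sum_j\mathsf r_j(I)c_j}v_c$. For $\epsilon>0$ let $U_J=\{\beta\in\mathbf m+\mathfrak g_{\mathbb C}:\operatorname{Im}(\sigma_J^!(j)h_j^\vee(\beta))\ge0,\ |\operatorname{Re}h_j^\vee(\beta)|\le\epsilon\ \ \forall j\in J\}$, a product of half-strips in the coordinates $h_j^\vee$, $j\in J$, and let $\partial U_J$ be the $k$-chain which is the product of the boundaries of these half-strips, each counterclockwise. With coordinates $z\in\mathbb C^k$ on $\mathbf m+\mathfrak g_{\mathbb C}=\{m+Qz\}$ put $$\operatorname{Tr}_J(w)=\int_{\partial U_J}\operatorname{Tr}_\beta(w)\,dz_1\wedge\cdots\wedge dz_k .$$ **Theorem.** The Verma module $\Delta_I$ exists, and there is $\epsilon_0>0$ such that for all $0<\epsilon<\epsilon_0$ and all $w\in\mathscr W^G$ the integral $\operatorname{Tr}_J(w)$ and the trace $\operatorname{Tr}_{\Delta_I}(w)$ converge absolutely, and $$\operatorname{Tr}_J(w)=\Bigg(\det(Q^!_J)\prod_{j\in I}\wp(\tilde{\mathsf r}_j(J))\,\sigma_I(j)^{\mathsf r_j(I)+1}\prod_{j\in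 J}\sigma^!_J(j)^{\mathsf s_j(J)}\,\tfrac12\operatorname{CS}_{\mathsf s_j(J)}(\pi z_j^!)\Bigg)\operatorname{Tr}_{\Delta_I}(w).$$ In particular $\operatorname{Tr}_J$ depends only on the image of $w$ in $A_{\mathrm{Higgs}}$. If $\partial U_J$ is instead given the orientation inherited from deforming the contour $i\mathfrak g+\mathbf m$ (oriented by $dz_1\wedge\cdots\wedge dz_k$), i.e. the one that agrees with this contour on the bottom face of $U_J$, then the same formula holds with the right-hand side multiplied by $\det(Q_J^!)\prod_{j\in J}\sigma_J^!(j)$. -/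

import Mathlib

open scoped Matrix

noncomputable section

/-! ## The Weyl algebra -/

/-- The canonical commutation relations for generators `x i = inl i`, `∂ i = inr i`. -/
inductive WeylRel (n : ℕ) : FreeAlgebra ℂ (Fin n ⊕ Fin n) → FreeAlgebra ℂ (Fin n ⊕ Fin n) → Prop
  | xx (i j : Fin n) : WeylRel n
      (FreeAlgebra.ι ℂ (Sum.inl i) * FreeAlgebra.ι ℂ (Sum.inl j))
      (FreeAlgebra.ι ℂ (Sum.inl j) * FreeAlgebra.ι ℂ (Sum.inl i))
  | dd (i j : Fin n) : WeylRel n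
      (FreeAlgebra.ι ℂ (Sum.inr i) * FreeAlgebra.ι ℂ (Sum.inr j))
      (FreeAlgebra.ι ℂ (Sum.inr j) * FreeAlgebra.ι ℂ (Sum.inr i))
  | dx (i j : Fin n) : WeylRel n
      (FreeAlgebra.ι ℂ (Sum.inr i) * FreeAlgebra.ι ℂ (Sum.inl j))
      (FreeAlgebra.ι ℂ (Sum.inl j) * FreeAlgebra.ι ℂ (Sum.inr i) + if i = j then 1 else 0)

/-- The Weyl algebra on `x₁, …, xₙ, ∂₁, …, ∂ₙ` with `[∂ᵢ, xⱼ] = δᵢⱼ`. -/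
abbrev WeylAlgebra (n : ℕ) : Type := RingQuot (WeylRel n)

namespace WeylAlgebra

variable {n : ℕ}

/-- The generator `xᵢ`. -/
def x (i : Fin n) : WeylAlgebra n :=
  RingQuot.mkAlgHom ℂ (WeylRel n) (FreeAlgebra.ι ℂ (Sum.inl i))

/-- The generator `∂ᵢ`. -/
def del (i : Fin n) : WeylAlgebra n :=
  RingQuot.mkAlgHom ℂ (WeylRel n) (FreeAlgebra.ι ℂ (Sum.inr i))

/-- Universal property: elements satisfying the canonical commutation relations define an
algebra homomorphism. -/
def lift {B : Type*} [Ring B] [Algebra ℂ B] (X D : Fin n → B)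
    (hxx : ∀ i j, X i * X j = X j * X i) (hdd : ∀ i j, D i * D j = D j * D i)
    (hdx : ∀ i j, D i * X j = X j * D i + if i = j then 1 else 0) : WeylAlgebra n →ₐ[ℂ] B :=
  RingQuot.liftAlgHom ℂ ⟨FreeAlgebra.lift ℂ (Sum.elim X D), by
    intro a b h
    cases h with
    | xx i j => simpa using hxx i j
    | dd i j => simpa using hdd i j
    | dx i j =>
      have h1 := hdx i j
      split_ifs with hij
      · subst hij; simpa using h1
      · rw [if_neg hij] at h1; simpa using h1⟩

@[simp] theorem lift_x {B : Type*} [Ring B] [Algebra ℂ B] (X D : Fin n → B) (hxx hdd hdx)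
    (i : Fin n) : lift X D hxx hdd hdx (x i) = X i := by
  simp [lift, x]

@[simp] theorem lift_del {B : Type*} [Ring B] [Algebra ℂ B] (X D : Fin n → B) (hxx hdd hdx)
    (i : Fin n) : lift X D hxx hdd hdx (del i) = D i := by
  simp [lift, del]

theorem x_comm (i j : Fin n) : x i * x j = x j * x i := by
  simpa [x] using RingQuot.mkAlgHom_rel ℂ (WeylRel.xx i j)

theorem del_comm (i j : Fin n) : del i * del j = del j * del i := by
  simpa [del] using RingQuot.mkAlgHom_rel ℂ (WeylRel.dd i j)

theorem del_x (i j : Fin n) :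
    (del i * x j : WeylAlgebra n) = x j * del i + if i = j then 1 else 0 := by
  have h := RingQuot.mkAlgHom_rel ℂ (WeylRel.dx i j)
  split_ifs at h ⊢ with hij
  · simpa [del, x] using h
  · simpa [del, x] using h

/-- The action of the diagonal torus on the Weyl algebra: `xᵢ ↦ tᵢ xᵢ`, `∂ᵢ ↦ tᵢ⁻¹ ∂ᵢ`. -/
def torusAct (t : Fin n → Circle) : WeylAlgebra n →ₐ[ℂ] WeylAlgebra n :=
  lift (fun i => ((t i : ℂ)) • x i) (fun i => ((t i : ℂ))⁻¹ • del i)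
    (by intro i j; simp only [smul_mul_smul_comm, x_comm i j, mul_comm])
    (by intro i j; simp only [smul_mul_smul_comm, del_comm i j, mul_comm])
    (by
      intro i j
      simp only [smul_mul_smul_comm, del_x i j]
      split_ifs with h
      · subst h
        simp [smul_add]
      · simp [mul_comm])

/-- `hᵢ = xᵢ ∂ᵢ + 1/2`. -/
def h (i : Fin n) : WeylAlgebra n := x i * del i + algebraMap ℂ _ (1 / 2)

/-- The quantum moment map `μ̂(β) = ∑ⱼ bⱼ hⱼ` of the diagonal torus, where `bⱼ` are the
coordinates of the element `β` of its complexified Lie algebra, so that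
`[μ̂(β), xⱼ] = bⱼ xⱼ` and `[μ̂(β), ∂ⱼ] = -bⱼ ∂ⱼ`. -/
def moment (b : Fin n → ℂ) : WeylAlgebra n := ∑ j, b j • h j

/-- The Fock module `ℂ[x₁, …, xₙ]`: `xᵢ` acts by multiplication and `∂ᵢ` by differentiation. -/
def fock : WeylAlgebra n →ₐ[ℂ] Module.End ℂ (MvPolynomial (Fin n) ℂ) :=
  lift (fun i => LinearMap.mulLeft ℂ (MvPolynomial.X i))
    (fun i => (MvPolynomial.pderiv i).toLinearMap)
    (by
      intro i j
      refine LinearMap.ext fun p => ?_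
      simp [mul_left_comm])
    (by
      intro i j
      have hc : ⁅(MvPolynomial.pderiv i : Derivation ℂ (MvPolynomial (Fin n) ℂ) (MvPolynomial (Fin n) ℂ)),
          (MvPolynomial.pderiv j : Derivation ℂ (MvPolynomial (Fin n) ℂ) (MvPolynomial (Fin n) ℂ))⁆ = 0 := by
        apply MvPolynomial.derivation_ext
        intro l
        rw [Derivation.commutator_apply, MvPolynomial.pderiv_X, MvPolynomial.pderiv_X]
        simp only [Pi.single_apply]
        split_ifs <;> simp
      refine LinearMap.ext fun p => ?_
      have := congrArg (fun D : Derivation ℂ (MvPolynomial (Fin n) ℂ)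
        (MvPolynomial (Fin n) ℂ) => D p) hc
      simpa [Derivation.commutator_apply, sub_eq_zero] using this)
    (by
      intro i j
      refine LinearMap.ext fun p => ?_
      by_cases hij : i = j
      · subst hij
        simp [Derivation.leibniz, add_comm]
      · simp [Derivation.leibniz, hij, MvPolynomial.pderiv_X, Ne.symm hij])

end WeylAlgebra

/-! ## The twisted trace on the Weyl algebra -/

/-- The FI character `ζ` evaluated at the element of the complexified Lie algebra of the diagonal
torus with coordinates `b`: `ζ(b) = i ∑ⱼ ζⱼ bⱼ` with real `ζⱼ`, which is real on the compact form, where the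
`bⱼ` are imaginary. -/
def fiChar {n : ℕ} (ζ : Fin n → ℝ) (b : Fin n → ℂ) : ℂ := Complex.I * ∑ j, (ζ j : ℂ) * b j

/-- The diagonal entry, at the monomial `x^u` of the Fock module, of the operator
`(-1)^F exp(2π μ̂_ζ(β)) w`, where `μ̂_ζ(β) = μ̂(β) + ζ(β)` and `β` has coordinates `b`. -/
def fockDiag {n : ℕ} (ζ : Fin n → ℝ) (w : WeylAlgebra n) (b : Fin n → ℂ) (u : Fin n →₀ ℕ) : ℂ :=
  (-1) ^ (∑ j, u j)
    * Complex.exp (2 * Real.pi * (fiChar ζ b + ∑ j, b j * ((u j : ℂ) + 1 / 2)))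
    * MvPolynomial.coeff u (WeylAlgebra.fock w (MvPolynomial.monomial u 1))

/-- The domain to which the twisted trace is continued: no `cosh (π bⱼ)` vanishes. -/
def traceDomain (n : ℕ) : Set (Fin n → ℂ) :=
  {b | ∀ j, Complex.cosh (Real.pi * b j) ≠ 0}

/-- `T` is the function `β ↦ Tr_β(w)`: where the `xⱼ` are creation operators (`Re bⱼ < 0`) it is
the trace of `(-1)^F exp(2π μ̂_ζ(β)) w` on the Fock module, and elsewhere it is the analytic
continuation to `traceDomain n` (a connected open set). -/
def IsWeylTrace {n : ℕ} (ζ : Fin n → ℝ) (w : WeylAlgebra n) (T : (Fin n → ℂ) → ℂ) : Prop :=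
  AnalyticOnNhd ℂ T (traceDomain n) ∧
    ∀ b : Fin n → ℂ, (∀ j, (b j).re < 0) → HasSum (fockDiag ζ w b) (T b)

open Classical in
/-- The twisted trace `Tr_β(w)` on the Weyl algebra. -/
def weylTrace {n : ℕ} (ζ : Fin n → ℝ) (w : WeylAlgebra n) : (Fin n → ℂ) → ℂ :=
  if h : ∃ T, IsWeylTrace ζ w T then h.choose else 0

/-! ## Abelian gauge theories and their quantum Higgs branches -/

/-- An exact sequence of tori `1 → G = U(1)^k → D = U(1)^n → F = U(1)^d → 1`, given through the
exact sequence of character lattices `0 ← ℤ^k ← ℤ^n ← ℤ^d ← 0`; the maps are the transpose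
of the `n × k` charge matrix `Q` and the `n × d` matrix `P`. -/
structure AbelianGaugeTheory (n k d : ℕ) where
  /-- The charge matrix of the gauge group. -/
  Q : Matrix (Fin n) (Fin k) ℤ
  /-- The inclusion of the character lattice of the flavor torus. -/
  P : Matrix (Fin n) (Fin d) ℤ
  surjective : Function.Surjective fun v : Fin n → ℤ => Qᵀ *ᵥ v
  injective : Function.Injective fun v : Fin d → ℤ => P *ᵥ v
  exact : ∀ v : Fin n → ℤ, Qᵀ *ᵥ v = 0 ↔ ∃ u : Fin d → ℤ, P *ᵥ u = v

namespace AbelianGaugeTheory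

open WeylAlgebra

variable {n k d : ℕ} (T : AbelianGaugeTheory n k d)

/-- The inclusion `G → D` of the gauge torus in the diagonal torus. -/
def gaugeIncl (t : Fin k → Circle) (j : Fin n) : Circle := ∏ a, t a ^ T.Q j a

/-- The invariants of the gauge group in the Weyl algebra. -/
def invariants : Subalgebra ℂ (WeylAlgebra n) :=
  ⨅ t : Fin k → Circle, AlgHom.equalizer (torusAct (T.gaugeIncl t)) (AlgHom.id ℂ _)

theorem h_mem_invariants (j : Fin n) : h j ∈ T.invariants := by
  simp [invariants, Algebra.mem_iInf, AlgHom.mem_equalizer, h, torusAct]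

/-- The shifted quantum moment map `μ̂_ζ(β) = μ̂(β) + ζ(β)`. -/
def shiftedMoment (ζ : Fin n → ℝ) (b : Fin n → ℂ) : WeylAlgebra n :=
  moment b + algebraMap ℂ _ (fiChar ζ b)

theorem shiftedMoment_mem_invariants (ζ : Fin n → ℝ) (b : Fin n → ℂ) :
    shiftedMoment ζ b ∈ T.invariants :=
  add_mem (sum_mem fun j _ => T.invariants.smul_mem (T.h_mem_invariants j) _)
    (T.invariants.algebraMap_mem _)

/-- The left ideal of the Weyl algebra generated by the elements `μ̂_ζ(X)` for `X` in the
complexified Lie algebra of the gauge group, which is spanned by the columns of `Q`. -/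
def momentIdeal (ζ : Fin n → ℝ) : Submodule (WeylAlgebra n) (WeylAlgebra n) :=
  Submodule.span (WeylAlgebra n)
    (Set.range fun X : Fin k → ℂ => shiftedMoment ζ (T.Q.map (fun q : ℤ => (q : ℂ)) *ᵥ X))

/-- Two invariants are identified if their difference lies in the left ideal. -/
def higgsRel (ζ : Fin n → ℝ) (a b : T.invariants) : Prop :=
  (a : WeylAlgebra n) - (b : WeylAlgebra n) ∈ T.momentIdeal ζ

/-- The quantum Higgs branch: the Hamiltonian reduction `(W / ∑ W μ̂_ζ(X))^G`, with its ring
structure as the quotient of the ring of invariants `W^G` by its intersection with the left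
ideal. -/
abbrev Higgs (ζ : Fin n → ℝ) : Type := RingQuot (T.higgsRel ζ)

/-- The image of an invariant in the quantum Higgs branch. -/
def toHiggs (ζ : Fin n → ℝ) : T.invariants →ₐ[ℂ] T.Higgs ζ :=
  RingQuot.mkAlgHom ℂ (T.higgsRel ζ)

/-- The image of `hⱼ` in the quantum Higgs branch. -/
def hHiggs (ζ : Fin n → ℝ) (j : Fin n) : T.Higgs ζ := T.toHiggs ζ ⟨h j, T.h_mem_invariants j⟩

/-! ## Bases: minors, coordinates and signs

A pair of complementary subsets is given by the increasing enumerations `I : Fin d ↪o Fin n` and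
`J : Fin k ↪o Fin n` of its members. -/

/-- The minor of `P` with rows `I`. -/
def minorP (I : Fin d ↪o Fin n) : Matrix (Fin d) (Fin d) ℤ := T.P.submatrix I id

/-- The minor of the (dual) charge matrix `Q` with rows `J`. -/
def minorQ (J : Fin k ↪o Fin n) : Matrix (Fin k) (Fin k) ℤ := T.Q.submatrix J id

/-- The matrix `R_I = P P_I⁻¹`. -/
def R (I : Fin d ↪o Fin n) : Matrix (Fin n) (Fin d) ℤ := T.P * (T.minorP I)⁻¹

/-- The dual matrix `R^!_J = Q Q_J⁻¹`. -/
def dualR (J : Fin k ↪o Fin n) : Matrix (Fin n) (Fin k) ℤ := T.Q * (T.minorQ J)⁻¹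

/-- The coordinates `z` of the mass: in the Lie algebra of the flavor torus, the image of
`∑ⱼ mⱼ hⱼ` is `∑ₜ zₜ h_{I t}`, that is, `Pᵀ m = P_Iᵀ z`. -/
def massCoord (m : Fin n → ℝ) (I : Fin d ↪o Fin n) : Fin d → ℝ :=
  ((T.minorP I)⁻¹.map (fun q : ℤ => (q : ℝ)))ᵀ *ᵥ ((T.P.map (fun q : ℤ => (q : ℝ)))ᵀ *ᵥ m)

/-- The coordinates `z^!` of the FI parameter: on the Lie algebra of the gauge torus, `ζ` is
`∑ₐ i z^!ₐ h^∨_{J a}`, that is, `Qᵀ ζ = Q_Jᵀ z^!`. -/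
def fiCoord (ζ : Fin n → ℝ) (J : Fin k ↪o Fin n) : Fin k → ℝ :=
  ((T.minorQ J)⁻¹.map (fun q : ℤ => (q : ℝ)))ᵀ *ᵥ ((T.Q.map (fun q : ℤ => (q : ℝ)))ᵀ *ᵥ ζ)

/-- `σ_I(t) = sign z_t`. -/
def massSign (m : Fin n → ℝ) (I : Fin d ↪o Fin n) (t : Fin d) : ℤ :=
  (SignType.sign (T.massCoord m I t) : ℤ)

/-- `σ^!_J(a) = sign z^!_a`. -/
def fiSign (ζ : Fin n → ℝ) (J : Fin k ↪o Fin n) (a : Fin k) : ℤ :=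
  (SignType.sign (T.fiCoord ζ J a) : ℤ)

/-- `r_t(I)`: the sum of the entries of the `t`-th column of `-R_I · diag(σ_I)`. -/
def r (m : Fin n → ℝ) (I : Fin d ↪o Fin n) (t : Fin d) : ℤ :=
  ∑ s, -(T.R I s t * T.massSign m I t)

/-- `s_a(J)`: the dual of `r`, the sum of the entries of the `a`-th column of
`R^!_J · diag(σ^!_J)`. -/
def s (ζ : Fin n → ℝ) (J : Fin k ↪o Fin n) (a : Fin k) : ℤ :=
  ∑ i, T.dualR J i a * T.fiSign ζ J a

/-- The integer `r̃_i(J) = 1 + ∑ₐ (R^!_J)_{i a} σ^!_J(a)`. -/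
def rTilde (ζ : Fin n → ℝ) (J : Fin k ↪o Fin n) (i : Fin n) : ℤ :=
  1 + ∑ a, T.dualR J i a * T.fiSign ζ J a

/-! ## Verma modules and their twisted traces -/

/-- `v` is a weight basis exhibiting `M` as the Verma module `Δ_I`: `v c` is a simultaneous
eigenvector of the `h_{I t}` with eigenvalues `-σ_I(t) (c_t + 1/2)`, and `v 0` generates. -/
structure IsVermaBasis (m ζ : Fin n → ℝ) (I : Fin d ↪o Fin n) {M : Type*} [AddCommGroup M]
    [Module ℂ M] [Module (T.Higgs ζ) M]
    (v : Module.Basis (Fin d → ℕ) ℂ M) : Prop where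
  eigen : ∀ (c : Fin d → ℕ) (t : Fin d),
    T.hHiggs ζ (I t) • v c = (-(T.massSign m I t : ℂ) * ((c t : ℂ) + 1 / 2)) • v c
  cyclic : Submodule.span (T.Higgs ζ) {v 0} = ⊤

/-- The diagonal entry at `v c` of `(-1)^F exp(2π μ̂_ζ) w`, where `μ̂_ζ = μ̂_ζ(m)` is diagonal in the
weight basis and `(-1)^F` acts on `v c` by `(-1)^(∑ₜ r_t(I) c_t)`. -/
def vermaDiag (m ζ : Fin n → ℝ) (I : Fin d ↪o Fin n) {M : Type*} [AddCommGroup M]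
    [Module ℂ M] [Module (T.Higgs ζ) M] (v : Module.Basis (Fin d → ℕ) ℂ M)
    (w : T.Higgs ζ) (c : Fin d → ℕ) : ℂ :=
  (-1) ^ (∑ t, T.r m I t * (c t : ℤ))
    * Complex.exp (2 * Real.pi * v.repr (T.toHiggs ζ
        ⟨shiftedMoment ζ (fun j => (m j : ℂ)), T.shiftedMoment_mem_invariants ζ _⟩ • v c) c)
    * v.repr (w • v c) c

/-- The twisted trace `Tr_{Δ_I}(w)` of the Verma module. -/
def vermaTrace (m ζ : Fin n → ℝ) (I : Fin d ↪o Fin n) {M : Type*} [AddCommGroup M]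
    [Module ℂ M] [Module (T.Higgs ζ) M] (v : Module.Basis (Fin d → ℕ) ℂ M)
    (w : T.Higgs ζ) : ℂ :=
  ∑' c, T.vermaDiag m ζ I v w c

end AbelianGaugeTheory

/-! ## The boundary integrals -/

/-- Parametrization over the real line of the counterclockwise boundary of the half-strip
`{|Re h| ≤ ε, Im h ≥ 0}`: down the left side, along `[-ε, ε]`, up the right side. -/
def stripPath (ε t : ℝ) : ℂ :=
  ((max (-ε) (min ε t) : ℝ) : ℂ) + Complex.I * ((max 0 (|t| - ε) : ℝ) : ℂ)

/-- The derivative of `stripPath` away from the two corners. -/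
def stripPathDeriv (ε t : ℝ) : ℂ :=
  if |t| ≤ ε then 1 else if 0 < t then Complex.I else -Complex.I

namespace AbelianGaugeTheory

variable {n k d : ℕ} (T : AbelianGaugeTheory n k d)

/-- The point of the affine space `m + 𝔤_ℂ` at which the coordinate functions `h^∨_{J a}` take the
prescribed values `y a`. -/
def pointOf (m : Fin n → ℝ) (J : Fin k ↪o Fin n) (y : Fin k → ℂ) : Fin n → ℂ :=
  (fun i => (m i : ℂ)) +
    (T.dualR J).map (fun q : ℤ => (q : ℂ)) *ᵥ (fun a => y a - (m (J a) : ℂ))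

/-- The parametrization of the boundary of the region
`U_J = {Im (σ^!_J(a) h^∨_{J a}) ≥ 0, |Re h^∨_{J a}| ≤ ε}` in `m + 𝔤_ℂ`: the product of the boundaries
of the half-strips for the coordinates `h^∨_{J a}`, each positively oriented (for `σ^! = -1` the
half-strip is the image of the upper one under `h ↦ -h`, which preserves orientation). -/
def boundaryPoint (m ζ : Fin n → ℝ) (J : Fin k ↪o Fin n) (ε : ℝ) (t : Fin k → ℝ) : Fin n → ℂ :=
  T.pointOf m J fun a => (T.fiSign ζ J a : ℂ) * stripPath ε (t a)

/-- The pullback of the form `Tr_β(w) dz₁ ∧ ⋯ ∧ dz_k` along `boundaryPoint`; here `z` are the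
coordinates `β = m + Q z` on `m + 𝔤_ℂ`, so that `z = Q_J⁻¹ (h_J^∨ - m_J)`, and the form is the
Jacobian determinant of `t ↦ z` times `Tr_β(w)`. -/
def boundaryIntegrand (m ζ : Fin n → ℝ) (J : Fin k ↪o Fin n) (ε : ℝ) (w : WeylAlgebra n)
    (t : Fin k → ℝ) : ℂ :=
  ((T.minorQ J)⁻¹.map (fun q : ℤ => (q : ℂ)) *
      Matrix.diagonal fun a => (T.fiSign ζ J a : ℂ) * stripPathDeriv ε (t a)).det
    * weylTrace ζ w (T.boundaryPoint m ζ J ε t)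

/-- `Tr_J(w)`, the integral of `Tr_β(w) dz₁ ∧ ⋯ ∧ dz_k` over the boundary of `U_J`. -/
def boundaryTrace (m ζ : Fin n → ℝ) (J : Fin k ↪o Fin n) (ε : ℝ) (w : WeylAlgebra n) : ℂ :=
  ∫ t : Fin k → ℝ, T.boundaryIntegrand m ζ J ε w t

/-- The integral of `Tr_β(w) dz₁ ∧ ⋯ ∧ dz_k` over the boundary of `U_J` with the orientation
inherited from the undeformed contour: on the bottom face `[-ε, ε]^k`, where all `h^∨_{J a}` are
real, it agrees with that of the real slice of `m + 𝔤_ℂ` given by `dz₁ ∧ ⋯ ∧ dz_k`. -/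
def inheritedTrace (m ζ : Fin n → ℝ) (J : Fin k ↪o Fin n) (ε : ℝ) (w : WeylAlgebra n) : ℂ :=
  ∫ t : Fin k → ℝ, (∏ a, stripPathDeriv ε (t a)) * weylTrace ζ w (T.boundaryPoint m ζ J ε t)

/-- The fourth root of unity `℘(j)` for which `sech (x + π i (j - 1) / 2) = ℘(j) CS_j(x)`. -/
def wp (j : ℤ) : ℂ :=
  if j % 4 = 0 then Complex.I else if j % 4 = 1 then 1 else if j % 4 = 2 then -Complex.I else -1

/-- `CS_r(x)` is `sech x` for odd `r` and `csch x` for even `r`. -/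
def CS (r : ℤ) (x : ℝ) : ℝ := if Odd r then (Real.cosh x)⁻¹ else (Real.sinh x)⁻¹

/-- The scalar relating `Tr_J` and the trace of the Verma module. -/
def coefficient (m ζ : Fin n → ℝ) (I : Fin d ↪o Fin n) (J : Fin k ↪o Fin n) : ℂ :=
  ((T.minorQ J).det : ℂ)
    * (∏ t, wp (T.rTilde ζ J (I t)) * (T.massSign m I t : ℂ) ^ (T.r m I t + 1))
    * ∏ a, (T.fiSign ζ J a : ℂ) ^ (T.s ζ J a)
        * ((1 / 2 * CS (T.s ζ J a) (Real.pi * T.fiCoord ζ J a) : ℝ) : ℂ)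

end AbelianGaugeTheory

end

noncomputable section

/-! ## The derivatives of the hyperbolic secant -/

/-! Both traces are computed from one polynomial. The Weyl algebra is the sum of its weight spaces
under the $h_j$, and a diagonal matrix coefficient in an eigenbasis of the $h_j$ vanishes on
commutators with the $h_j$. It therefore sees only the weight-zero part of $w$, a polynomial $f$ in
$h_1,\dots,h_n$. The diagonal entry of $w$ at $x^u$ is $f(u+\frac12)$, and at $v_c$ it is $f$ at the
weights of $v_c$ (`exists_polynomial_diag`).

Since $\frac1{2\cosh\pi b}=\sum_c(-1)^ce^{2\pi b(c+1/2)}$ for $\operatorname{Re}b<0$, and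
$\frac1{2\pi}\frac{d}{db}$ brings down $c+\frac12$, the continued trace is
$e^{2\pi\boldsymbol\zeta(\beta)}\sum_pf_p\prod_jS_{p_j}(b_j)$, where $S_p$ is `sechDeriv p`
(`isWeylTrace_of_polynomial`).

On $\mathbf m+\mathfrak g_{\mathbb C}$, with $y_a$ the coordinates in $J$, one has
$b_{I(t)}=z_t+\sum_aR_{ta}y_a$ for integers $R_{ta}$. For small $\epsilon$ the sign of
$\operatorname{Re}b_{I(t)}$ on the contour is that of $z_t$. Hence the factors with index in $I$
expand in a geometric series over $c\in\mathbb Z_{\ge0}^I$, uniformly on the contour, and each term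
of the integral splits into integrals of $S_q(y)e^{2\pi ly}$ around one half-strip, with
$l_a=iz^!_a-\sum_t\sigma_tR_{ta}(c_t+\frac12)$ (`expand_boundary_integral`).

Integration by parts turns $S_q$ into $(-l)^q$. For $q=0$ the integrand is multiplied by $-e^{2\pi
il}$ under $y\mapsto y+i$, so the one residue at $i/2$ determines the value $\frac1{2\cosh\pi il}$
(`integral_sechDeriv`).

The moment map relations force $h_{J(a)}$ to act on $v_c$ by $-l_a$. The powers $(-l_a)^{q_a}$ and
$(-\sigma_t(c_t+\frac12))^{p_t}$ thus reassemble $f$ at the weights of $v_c$, and the exponentials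
give $\exp(2\pi\hat\mu_{\boldsymbol\zeta}(\mathbf m))$. What is left are signs: the part of
$\cosh\pi il_a$ that depends on $c$ is a power of $-1$, which with $(-1)^{|c|}$ makes up $(-1)^F$,
and the rest is the constant of the theorem (`coefficient_identity`).

The Verma module lies in a product of one-variable weight modules: highest or lowest weight modules
for $I$, and modules with weights in a coset of $\mathbb Z$ for $J$, simple because $z^!_a\ne0$
makes the weights non-real. It is spanned by the indices in $\ker Q^T=\operatorname{im}P$, which
their coordinates in $I$ parametrize because $P_I$ is invertible over $\mathbb Z$
(`exists_isVermaBasis`). -/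

open Complex in
theorem cosh_pi_eq_zero_iff {z : ℂ} :
    cosh (Real.pi * z) = 0 ↔ ∃ l : ℤ, z = -((2 * l + 1) / 2 * I) := by
  have hpi : (Real.pi : ℂ) ≠ 0 := by exact_mod_cast Real.pi_ne_zero
  rw [← cos_mul_I, cos_eq_zero_iff]
  refine exists_congr fun l => ⟨fun h => ?_, fun h => ?_⟩
  · apply mul_left_cancel₀ hpi
    linear_combination (-I) * h + (Real.pi * z) * I_sq
  · rw [h]
    linear_combination (-(Real.pi : ℂ) * (2 * l + 1) / 2) * I_sq

theorem cosh_pi_ne_zero_of_re_ne_zero {z : ℂ} (hz : z.re ≠ 0) :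
    Complex.cosh (Real.pi * z) ≠ 0 := by
  intro h
  obtain ⟨l, rfl⟩ := cosh_pi_eq_zero_iff.1 h
  apply hz
  have : ((2 * l + 1) / 2 : ℂ) = ((2 * l + 1) / 2 : ℝ) := by push_cast; ring
  rw [this, Complex.neg_re, Complex.re_ofReal_mul]
  simp

theorem cosh_pi_ne_zero_of_real (x : ℝ) : Complex.cosh (Real.pi * (x : ℂ)) ≠ 0 := by
  rw [← Complex.ofReal_mul, ← Complex.ofReal_cosh]
  exact_mod_cast (Real.cosh_pos _).ne'

theorem HasSum.of_eq {ι α : Type*} [AddCommMonoid α] [TopologicalSpace α] {f g : ι → α} {a b : α}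
    (h : HasSum f a) (hfg : ∀ i, g i = f i) (hab : b = a) : HasSum g b := by
  rw [hab, funext hfg]; exact h

/-- The complement of the poles of `sech (π z)`. -/
def sechDomain : Set ℂ := {z | Complex.cosh (Real.pi * z) ≠ 0}

theorem isOpen_sechDomain : IsOpen sechDomain :=
  isOpen_ne_fun (by fun_prop) continuous_const

/-- `(1 / (2 π) d / dz) ^ p` applied to `1 / (2 cosh (π z))`. -/
def sechDeriv : ℕ → ℂ → ℂ
  | 0 => fun z => (2 * Complex.cosh (Real.pi * z))⁻¹
  | p + 1 => fun z => deriv (sechDeriv p) z / (2 * Real.pi)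

theorem analyticOnNhd_sechDeriv (p : ℕ) : AnalyticOnNhd ℂ (sechDeriv p) sechDomain := by
  induction p with
  | zero =>
    refine DifferentiableOn.analyticOnNhd (fun z hz => ?_) isOpen_sechDomain
    have hz : Complex.cosh (Real.pi * z) ≠ 0 := hz
    have : DifferentiableAt ℂ (fun z : ℂ => Complex.cosh (Real.pi * z)) z := by fun_prop
    exact ((this.const_mul 2).inv (mul_ne_zero two_ne_zero hz)).differentiableWithinAt
  | succ p ih =>
    simp only [sechDeriv, div_eq_mul_inv]
    exact ih.deriv.mul analyticOnNhd_const

/-- This parity carries expansions and integrals from one half-plane, or one half-strip, to its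
mirror image. -/
theorem sechDeriv_neg (p : ℕ) : ∀ z, sechDeriv p (-z) = (-1) ^ p * sechDeriv p z := by
  induction p with
  | zero => intro z; simp [sechDeriv]
  | succ p ih =>
    intro z
    have h := deriv_comp_neg (sechDeriv p) z
    rw [show (fun x => sechDeriv p (-x)) = fun x => (-1) ^ p * sechDeriv p x from funext ih,
      deriv_const_mul_field] at h
    simp only [sechDeriv]
    rw [eq_comm, neg_eq_iff_eq_neg] at h
    rw [h, pow_succ]; ring

theorem summable_pow_mul_exp_half (p : ℕ) {a : ℝ} (ha : 0 < a) :
    Summable fun c : ℕ => ((c : ℝ) + 1 / 2) ^ p * Real.exp (-a * (c + 1 / 2)) := by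
  have h := (summable_nat_add_iff 1).2 (Real.summable_pow_mul_exp_neg_nat_mul p ha)
  refine Summable.of_nonneg_of_le (fun c => by positivity) (fun c => ?_)
    (h.mul_right (Real.exp (a / 2)))
  rw [mul_assoc, ← Real.exp_add]
  refine mul_le_mul (pow_le_pow_left₀ (by positivity) (by push_cast; linarith) p)
    (Real.exp_le_exp.2 (le_of_eq (by push_cast; ring))) (Real.exp_pos _).le (by positivity)

theorem norm_term_sechDeriv (p c : ℕ) (z : ℂ) :
    ‖(-1) ^ c * ((c : ℂ) + 1 / 2) ^ p * Complex.exp (2 * Real.pi * z * (c + 1 / 2))‖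
      = ((c : ℝ) + 1 / 2) ^ p * Real.exp (2 * Real.pi * z.re * (c + 1 / 2)) := by
  have h1 : ((c : ℂ) + 1 / 2) = ((c + 1 / 2 : ℝ) : ℂ) := by push_cast; ring
  have h2 : ((2 : ℂ) * Real.pi) = ((2 * Real.pi : ℝ) : ℂ) := by push_cast; ring
  rw [norm_mul, norm_mul, Complex.norm_exp, h1, h2, norm_pow, norm_pow, norm_neg, norm_one,
    one_pow, one_mul, Complex.norm_real, Real.norm_of_nonneg (by positivity),
    Complex.re_mul_ofReal, Complex.re_ofReal_mul]

/-- The case $p=0$ is the geometric series of $e^{\pi z}/(1+e^{2\pi z})$. Termwise differentiation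
does the rest: the normalization by $2\pi$ makes each step bring down exactly $c+\frac12$, the
eigenvalue of $x\partial+\frac12$ on $x^c$. -/
theorem hasSum_sechDeriv_of_re_neg (p : ℕ) : ∀ z : ℂ, z.re < 0 →
    HasSum (fun c : ℕ => (-1) ^ c * ((c : ℂ) + 1 / 2) ^ p
      * Complex.exp (2 * Real.pi * z * (c + 1 / 2))) (sechDeriv p z) := by
  induction p with
  | zero =>
    intro z hz
    have hlt : ‖-Complex.exp (2 * Real.pi * z)‖ < 1 := by
      rw [norm_neg, Complex.norm_exp, Real.exp_lt_one_iff,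
        show ((2 : ℂ) * Real.pi) = ((2 * Real.pi : ℝ) : ℂ) by push_cast; ring,
        Complex.re_ofReal_mul]
      have := Real.pi_pos
      nlinarith
    have h := (hasSum_geometric_of_norm_lt_one hlt).mul_left (Complex.exp (Real.pi * z))
    refine h.of_eq (fun c => ?_) ?_
    · rw [neg_pow (Complex.exp _), ← Complex.exp_nat_mul, pow_zero, mul_one, mul_left_comm, ← Complex.exp_add]
      congr 2; ring
    · have hne : 1 - -Complex.exp (2 * Real.pi * z) ≠ 0 := by
        intro h0
        rw [sub_eq_zero] at h0
        rw [← h0] at hlt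
        simp at hlt
      have hE : Complex.exp (2 * Real.pi * z) = Complex.exp (Real.pi * z) ^ 2 := by
        rw [← Complex.exp_nat_mul]; congr 1; push_cast; ring
      have hx := Complex.exp_ne_zero (Real.pi * z)
      simp only [sechDeriv]
      rw [Complex.cosh, Complex.exp_neg]
      rw [hE] at hne ⊢
      rw [← div_eq_mul_inv, eq_div_iff hne, inv_mul_eq_iff_eq_mul₀]
      · field_simp; ring
      · intro h0
        apply hne
        field_simp at h0
        linear_combination h0
  | succ p ih =>
    intro z hz
    have hpi := Real.pi_pos
    -- A neighbourhood of $z$ that stays away from the imaginary axis, so that one summable majorant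
    -- serves all of it.
    set U : Set ℂ := {w | w.re < z.re / 2}
    have hU : IsOpen U := isOpen_lt Complex.continuous_re continuous_const
    have hzU : z ∈ U := by change z.re < z.re / 2; linarith
    have hsum := summable_pow_mul_exp_half p (a := -(2 * Real.pi * (z.re / 2))) (by nlinarith)
    have h := Complex.hasSum_deriv_of_summable_norm hsum
      (F := fun (c : ℕ) (w : ℂ) => (-1) ^ c * ((c : ℂ) + 1 / 2) ^ p
        * Complex.exp (2 * Real.pi * w * (c + 1 / 2)))
      (fun c => by fun_prop) hU (fun c w hw => by
        rw [norm_term_sechDeriv]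
        have hw : w.re < z.re / 2 := hw
        gcongr
        rw [neg_neg]
        gcongr) hzU
    have hd : deriv (fun w => ∑' c : ℕ, (-1) ^ c * ((c : ℂ) + 1 / 2) ^ p
        * Complex.exp (2 * Real.pi * w * (c + 1 / 2))) z = deriv (sechDeriv p) z := by
      apply Filter.EventuallyEq.deriv_eq
      filter_upwards [hU.mem_nhds hzU] with w hw
      exact (ih w (by have hw : w.re < z.re / 2 := hw; linarith)).tsum_eq
    rw [hd] at h
    refine (h.div_const (2 * (Real.pi : ℂ))).of_eq (fun c => ?_) rfl
    have h1 : HasDerivAt (fun w : ℂ => 2 * Real.pi * w * ((c : ℂ) + 1 / 2))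
        (2 * Real.pi * 1 * ((c : ℂ) + 1 / 2)) z :=
      ((hasDerivAt_id z).const_mul (2 * (Real.pi : ℂ))).mul_const _
    rw [(h1.cexp.const_mul _).deriv, pow_succ]
    have : (Real.pi : ℂ) ≠ 0 := by exact_mod_cast hpi.ne'
    field_simp

/-- The expansion of `sechDeriv p` in the half-plane `σ Re z > 0`. -/
theorem hasSum_sechDeriv (p : ℕ) {σ : ℤ} (hσ : σ = 1 ∨ σ = -1) {z : ℂ} (hz : 0 < σ * z.re) :
    HasSum (fun c : ℕ => (-1) ^ c * (-(σ : ℂ) * ((c : ℂ) + 1 / 2)) ^ p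
      * Complex.exp (-(2 * Real.pi * σ * z * (c + 1 / 2)))) (sechDeriv p z) := by
  rcases hσ with rfl | rfl
  · have h := (hasSum_sechDeriv_of_re_neg p (-z) (by simpa using hz)).mul_left ((-1) ^ p)
    rw [sechDeriv_neg, ← mul_assoc, ← mul_pow, neg_one_mul, neg_neg, one_pow, one_mul] at h
    refine h.of_eq (fun c => ?_) rfl
    rw [show -((1 : ℤ) : ℂ) * ((c : ℂ) + 1 / 2) = -1 * (c + 1 / 2) by push_cast; ring, mul_pow]
    rw [show 2 * Real.pi * -z * ((c : ℂ) + 1 / 2)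
      = -(2 * Real.pi * ((1 : ℤ) : ℂ) * z * (c + 1 / 2)) by push_cast; ring]
    ring
  · refine (hasSum_sechDeriv_of_re_neg p z (by simpa using hz)).of_eq (fun c => ?_) rfl
    congr 2
    · push_cast; ring
    · push_cast; ring

theorem norm_term_sechDeriv' (p c : ℕ) {σ : ℤ} (hσ : σ = 1 ∨ σ = -1) (z : ℂ) :
    ‖(-1) ^ c * (-(σ : ℂ) * ((c : ℂ) + 1 / 2)) ^ p
      * Complex.exp (-(2 * Real.pi * σ * z * (c + 1 / 2)))‖
      = ((c : ℝ) + 1 / 2) ^ p * Real.exp (-(2 * Real.pi * (σ * z.re)) * (c + 1 / 2)) := by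
  have h := norm_term_sechDeriv p c (-(σ * z))
  have h3 : ‖(σ : ℂ)‖ = 1 := by rcases hσ with rfl | rfl <;> simp
  rw [norm_mul, norm_mul] at h ⊢
  rw [mul_pow, norm_mul, norm_pow (-(σ : ℂ)), norm_neg, h3, one_pow, one_mul]
  rw [show -(2 * Real.pi * σ * z * ((c : ℂ) + 1 / 2)) = 2 * Real.pi * -(σ * z) * (c + 1 / 2) by
    ring, h, Complex.neg_re, ← Complex.ofReal_intCast, Complex.re_ofReal_mul]
  congr 2; ring

/-- `sechDeriv p` is bounded away from the imaginary axis. -/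
theorem norm_sechDeriv_le (p : ℕ) {δ : ℝ} (hδ : 0 < δ) {σ : ℤ} (hσ : σ = 1 ∨ σ = -1) {z : ℂ}
    (hz : δ ≤ σ * z.re) :
    ‖sechDeriv p z‖ ≤ ∑' c : ℕ, ((c : ℝ) + 1 / 2) ^ p * Real.exp (-(2 * Real.pi * δ) * (c + 1 / 2)) := by
  have hpi := Real.pi_pos
  rw [← (hasSum_sechDeriv p hσ (hδ.trans_le hz)).tsum_eq]
  refine tsum_of_norm_bounded
    (summable_pow_mul_exp_half p (a := 2 * Real.pi * δ) (by positivity)).hasSum fun c => ?_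
  rw [norm_term_sechDeriv' p c hσ]
  gcongr

end

noncomputable section

/-! ## Integrals along the boundary of a half-strip -/

open MeasureTheory Set

theorem continuous_stripPath (ε : ℝ) : Continuous (stripPath ε) := by
  unfold stripPath; fun_prop

theorem stripPath_re (ε t : ℝ) : (stripPath ε t).re = max (-ε) (min ε t) := by
  simp [stripPath]

theorem stripPath_im (ε t : ℝ) : (stripPath ε t).im = max 0 (|t| - ε) := by
  simp [stripPath]

theorem abs_stripPath_re_le {ε : ℝ} (hε : 0 < ε) (t : ℝ) : |(stripPath ε t).re| ≤ ε := by
  rw [stripPath_re, abs_le]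
  exact ⟨le_max_left _ _, max_le (by linarith) (min_le_left _ _)⟩

theorem stripPath_of_abs_le {ε t : ℝ} (h : |t| ≤ ε) : stripPath ε t = t := by
  have h' := abs_le.1 h
  rw [stripPath, min_eq_right h'.2, max_eq_right h'.1, max_eq_left (by linarith)]
  simp

theorem stripPath_right {ε y : ℝ} (hε : 0 < ε) (hy : 0 ≤ y) :
    stripPath ε (y + ε) = ε + y * Complex.I := by
  rw [stripPath, min_eq_left (by linarith), max_eq_right (by linarith),
    abs_of_pos (by linarith), max_eq_right (by linarith)]
  push_cast; ring

theorem stripPath_left {ε y : ℝ} (hε : 0 < ε) (hy : 0 ≤ y) :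
    stripPath ε (-(y + ε)) = -ε + y * Complex.I := by
  rw [stripPath, min_eq_right (by linarith), max_eq_left (by linarith), abs_neg,
    abs_of_pos (by linarith), max_eq_right (by linarith)]
  push_cast; ring

/-- The poles are the odd multiples of $i/2$, while the path is real on its bottom and has real part
$\pm\varepsilon$ on its sides. -/
theorem stripPath_mem_sechDomain {ε : ℝ} (hε : 0 < ε) (t : ℝ) : stripPath ε t ∈ sechDomain := by
  rcases le_or_gt |t| ε with h | h
  · rw [stripPath_of_abs_le h]
    exact cosh_pi_ne_zero_of_real t
  · apply cosh_pi_ne_zero_of_re_ne_zero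
    rw [stripPath_re]
    rcases lt_abs.1 h with h | h
    · rw [min_eq_left h.le, max_eq_right (by linarith)]
      exact hε.ne'
    · rw [min_eq_right (by linarith), max_eq_left (by linarith)]
      linarith

theorem measurable_stripPathDeriv (ε : ℝ) : Measurable (stripPathDeriv ε) := by
  unfold stripPathDeriv
  refine Measurable.ite (measurableSet_le measurable_norm measurable_const) measurable_const ?_
  exact Measurable.ite measurableSet_Ioi measurable_const measurable_const

theorem norm_stripPathDeriv (ε t : ℝ) : ‖stripPathDeriv ε t‖ = 1 := by
  unfold stripPathDeriv
  split_ifs <;> simp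

theorem stripPathDeriv_of_abs_le {ε t : ℝ} (h : |t| ≤ ε) : stripPathDeriv ε t = 1 := if_pos h

theorem stripPathDeriv_right {ε y : ℝ} (hε : 0 < ε) (hy : 0 < y) :
    stripPathDeriv ε (y + ε) = Complex.I := by
  rw [stripPathDeriv, if_neg, if_pos (by linarith)]
  rw [abs_of_pos (by linarith)]; linarith

theorem stripPathDeriv_left {ε y : ℝ} (hε : 0 < ε) (hy : 0 < y) :
    stripPathDeriv ε (-(y + ε)) = -Complex.I := by
  rw [stripPathDeriv, if_neg, if_neg (by linarith)]
  rw [abs_neg, abs_of_pos (by linarith)]; linarith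

theorem integrable_exp_neg_mul_abs {a : ℝ} (ha : 0 < a) :
    Integrable fun t : ℝ => Real.exp (-a * |t|) := by
  have h : IntegrableOn (fun t : ℝ => Real.exp (-a * |t|)) (Ioi 0) := by
    refine (exp_neg_integrableOn_Ioi 0 ha).congr_fun (fun t ht => ?_) measurableSet_Ioi
    simp only [abs_of_pos (show (0 : ℝ) < t from ht)]
  have h' : IntegrableOn (fun t : ℝ => Real.exp (-a * |t|)) (Iic 0) := by
    rw [integrableOn_Iic_iff_integrableOn_Iio]
    rw [← neg_zero] at h
    simpa using h.comp_neg_Iio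
  rw [← integrableOn_univ, ← Iic_union_Ioi (a := (0 : ℝ))]
  exact h'.union h

/-- A function which is continuous and decays exponentially along the boundary of the
half-strip. -/
structure StripDecay (ε : ℝ) (φ : ℂ → ℂ) : Prop where
  cont : Continuous fun t => φ (stripPath ε t)
  decay : ∃ C a : ℝ, 0 < a ∧ ∀ t, ‖φ (stripPath ε t)‖ ≤ C * Real.exp (-a * max 0 (|t| - ε))

namespace StripDecay

variable {ε : ℝ} {φ : ℂ → ℂ}

theorem integrable (h : StripDecay ε φ) :
    Integrable fun t => φ (stripPath ε t) * stripPathDeriv ε t := by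
  obtain ⟨C, a, ha, hb⟩ := h.decay
  have hC : 0 ≤ C := by
    have := (norm_nonneg _).trans (hb 0)
    by_contra hC
    nlinarith [Real.exp_pos (-a * max 0 (|(0 : ℝ)| - ε))]
  refine ((integrable_exp_neg_mul_abs ha).const_mul (C * Real.exp (a * ε))).mono'
    (h.cont.aestronglyMeasurable.mul (measurable_stripPathDeriv ε).aestronglyMeasurable)
    (Filter.Eventually.of_forall fun t => ?_)
  rw [norm_mul, norm_stripPathDeriv, mul_one, mul_assoc, ← Real.exp_add]
  refine (hb t).trans ?_
  gcongr
  nlinarith [le_max_right 0 (|t| - ε)]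

theorem continuousOn_right (h : StripDecay ε φ) (hε : 0 < ε) :
    ContinuousOn (fun y : ℝ => φ (ε + y * Complex.I)) (Ici 0) := by
  have : Continuous fun y : ℝ => φ (stripPath ε (y + ε)) := h.cont.comp (by fun_prop)
  exact this.continuousOn.congr fun y hy => by simp only [stripPath_right hε hy]

theorem continuousOn_left (h : StripDecay ε φ) (hε : 0 < ε) :
    ContinuousOn (fun y : ℝ => φ (-ε + y * Complex.I)) (Ici 0) := by
  have : Continuous fun y : ℝ => φ (stripPath ε (-(y + ε))) := h.cont.comp (by fun_prop)
  exact this.continuousOn.congr fun y hy => by simp only [stripPath_left hε hy]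

theorem decay_sides (h : StripDecay ε φ) (hε : 0 < ε) : ∃ C a : ℝ, 0 < a ∧ ∀ y : ℝ, 0 ≤ y →
    ‖φ (ε + y * Complex.I)‖ ≤ C * Real.exp (-a * y) ∧
    ‖φ (-ε + y * Complex.I)‖ ≤ C * Real.exp (-a * y) := by
  obtain ⟨C, a, ha, hb⟩ := h.decay
  refine ⟨C, a, ha, fun y hy => ⟨?_, ?_⟩⟩
  · have := hb (y + ε)
    rwa [stripPath_right hε hy, abs_of_pos (by linarith), add_sub_cancel_right,
      max_eq_right hy] at this
  · have := hb (-(y + ε))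
    rwa [stripPath_left hε hy, abs_neg, abs_of_pos (by linarith), add_sub_cancel_right,
      max_eq_right hy] at this

theorem integrableOn_right (h : StripDecay ε φ) (hε : 0 < ε) :
    IntegrableOn (fun y : ℝ => φ (ε + y * Complex.I)) (Ioi 0) := by
  obtain ⟨C, a, ha, hb⟩ := h.decay_sides hε
  refine ((exp_neg_integrableOn_Ioi 0 ha).const_mul C).mono'
    (((h.continuousOn_right hε).mono Ioi_subset_Ici_self).aestronglyMeasurable measurableSet_Ioi) ?_
  exact (ae_restrict_mem measurableSet_Ioi).mono fun y hy => (hb y (le_of_lt hy)).1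

theorem integrableOn_left (h : StripDecay ε φ) (hε : 0 < ε) :
    IntegrableOn (fun y : ℝ => φ (-ε + y * Complex.I)) (Ioi 0) := by
  obtain ⟨C, a, ha, hb⟩ := h.decay_sides hε
  refine ((exp_neg_integrableOn_Ioi 0 ha).const_mul C).mono'
    (((h.continuousOn_left hε).mono Ioi_subset_Ici_self).aestronglyMeasurable measurableSet_Ioi) ?_
  exact (ae_restrict_mem measurableSet_Ioi).mono fun y hy => (hb y (le_of_lt hy)).2

theorem tendsto_sides (h : StripDecay ε φ) (hε : 0 < ε) :
    Filter.Tendsto (fun y : ℝ => φ (ε + y * Complex.I)) Filter.atTop (nhds 0) ∧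
    Filter.Tendsto (fun y : ℝ => φ (-ε + y * Complex.I)) Filter.atTop (nhds 0) := by
  obtain ⟨C, a, ha, hb⟩ := h.decay_sides hε
  have hlim : Filter.Tendsto (fun y : ℝ => C * Real.exp (-a * y)) Filter.atTop (nhds 0) := by
    rw [← mul_zero C]
    refine (Real.tendsto_exp_atBot.comp ?_).const_mul C
    exact Filter.tendsto_id.const_mul_atTop_of_neg (by linarith)
  exact ⟨squeeze_zero_norm' ((Filter.eventually_ge_atTop 0).mono fun y hy => (hb y hy).1) hlim,
    squeeze_zero_norm' ((Filter.eventually_ge_atTop 0).mono fun y hy => (hb y hy).2) hlim⟩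

end StripDecay

theorem integral_Ioi_add_right (f : ℝ → ℂ) (a b : ℝ) :
    ∫ y in Ioi b, f (y + a) = ∫ y in Ioi (b + a), f y := by
  have := (measurePreserving_add_right volume a).setIntegral_preimage_emb
    (measurableEmbedding_addRight a) f (Ioi (b + a))
  simpa using this

/-- The left side is run downwards, which accounts for the minus sign of its contribution. -/
theorem StripDecay.integral_eq {ε : ℝ} {φ : ℂ → ℂ} (h : StripDecay ε φ) (hε : 0 < ε) :
    ∫ t, φ (stripPath ε t) * stripPathDeriv ε t
      = (∫ x in (-ε)..ε, φ x) + Complex.I * (∫ y in Ioi (0 : ℝ), φ (ε + y * Complex.I))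
        - Complex.I * ∫ y in Ioi (0 : ℝ), φ (-ε + y * Complex.I) := by
  have hint := h.integrable
  set f := fun t => φ (stripPath ε t) * stripPathDeriv ε t with hf
  rw [← intervalIntegral.integral_Iic_add_Ioi (b := -ε) hint.integrableOn hint.integrableOn,
    ← intervalIntegral.integral_interval_add_Ioi (b := ε) hint.integrableOn hint.integrableOn]
  have h1 : ∫ t in (-ε)..ε, f t = ∫ x in (-ε)..ε, φ x := by
    refine intervalIntegral.integral_congr fun t ht => ?_
    rw [uIcc_of_le (by linarith)] at ht
    have ht' : |t| ≤ ε := abs_le.2 ht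
    simp only [hf, stripPath_of_abs_le ht', stripPathDeriv_of_abs_le ht', mul_one]
  have h2 : ∫ t in Ioi ε, f t = Complex.I * ∫ y in Ioi (0 : ℝ), φ (ε + y * Complex.I) := by
    rw [← zero_add ε, ← integral_Ioi_add_right, ← integral_const_mul, zero_add]
    refine setIntegral_congr_fun measurableSet_Ioi fun y hy => ?_
    simp only [hf, stripPath_right hε (le_of_lt hy), stripPathDeriv_right hε hy]
    ring
  have h3 : ∫ t in Iic (-ε), f t = -(Complex.I * ∫ y in Ioi (0 : ℝ), φ (-ε + y * Complex.I)) := by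
    rw [← integral_comp_neg_Ioi, ← zero_add ε, ← integral_Ioi_add_right (fun y => f (-y)),
      ← integral_const_mul, ← integral_neg, zero_add]
    refine setIntegral_congr_fun measurableSet_Ioi fun y hy => ?_
    simp only [hf, stripPath_left hε (le_of_lt hy), stripPathDeriv_left hε hy]
    ring
  rw [h1, h2, h3]
  ring

/-- The integral of a derivative along the boundary of the half-strip vanishes. -/
theorem StripDecay.integral_deriv_eq_zero {ε : ℝ} {F φ : ℂ → ℂ} (hF : StripDecay ε F)
    (hφ : StripDecay ε φ) (hε : 0 < ε) (hd : ∀ t, HasDerivAt F (φ (stripPath ε t)) (stripPath ε t)) :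
    ∫ t, φ (stripPath ε t) * stripPathDeriv ε t = 0 := by
  rw [hφ.integral_eq hε]
  have h1 : ∫ x in (-ε)..ε, φ x = F ε - F (-ε) := by
    rw [intervalIntegral.integral_eq_sub_of_hasDerivAt (f := fun x : ℝ => F x)]
    · push_cast; rfl
    · intro x hx
      rw [uIcc_of_le (by linarith)] at hx
      have := hd x
      rw [stripPath_of_abs_le (abs_le.2 hx)] at this
      exact this.comp_ofReal
    · refine ContinuousOn.intervalIntegrable (hφ.cont.continuousOn.congr fun x hx => ?_)
      rw [uIcc_of_le (by linarith)] at hx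
      simp only [stripPath_of_abs_le (abs_le.2 hx)]
  have hside : ∀ (c : ℂ) (y : ℝ), HasDerivAt (fun y : ℝ => c + y * Complex.I) Complex.I y := by
    intro c y
    simpa using ((Complex.ofRealCLM.hasDerivAt (x := y)).mul_const Complex.I).const_add c
  have h2 : Complex.I * ∫ y in Ioi (0 : ℝ), φ (ε + y * Complex.I) = 0 - F ε := by
    rw [← integral_const_mul]
    have := integral_Ioi_of_hasDerivAt_of_tendsto' (a := 0) (m := 0)
      (f := fun y : ℝ => F (ε + y * Complex.I)) (f' := fun y : ℝ => Complex.I * φ (ε + y * Complex.I))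
      (fun y hy => by
        have := hd (y + ε)
        rw [stripPath_right hε hy] at this
        rw [mul_comm]
        exact HasDerivAt.comp y this (hside ε y))
      ((hφ.integrableOn_right hε).const_mul _) (hF.tendsto_sides hε).1
    simpa using this
  have h3 : Complex.I * ∫ y in Ioi (0 : ℝ), φ (-ε + y * Complex.I) = 0 - F (-ε) := by
    rw [← integral_const_mul]
    have := integral_Ioi_of_hasDerivAt_of_tendsto' (a := 0) (m := 0)
      (f := fun y : ℝ => F (-ε + y * Complex.I)) (f' := fun y : ℝ => Complex.I * φ (-ε + y * Complex.I))
      (fun y hy => by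
        have := hd (-(y + ε))
        rw [stripPath_left hε hy] at this
        rw [mul_comm]
        exact HasDerivAt.comp y this (hside (-ε) y))
      ((hφ.integrableOn_left hε).const_mul _) (hF.tendsto_sides hε).2
    simpa using this
  rw [h1, h2, h3]
  ring

end

/-! ### Integration by parts for `sechDeriv` along the half-strip -/

noncomputable section

open MeasureTheory Set

theorem hasDerivAt_sechDeriv (p : ℕ) {z : ℂ} (hz : z ∈ sechDomain) :
    HasDerivAt (sechDeriv p) (2 * Real.pi * sechDeriv (p + 1) z) z := by
  have : (2 * Real.pi : ℂ) ≠ 0 := by exact_mod_cast Real.two_pi_pos.ne'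
  rw [sechDeriv, mul_div_cancel₀ _ this]
  exact (analyticOnNhd_sechDeriv p z hz).differentiableAt.hasDerivAt

theorem continuous_sechDeriv_stripPath (p : ℕ) {ε : ℝ} (hε : 0 < ε) :
    Continuous fun t => sechDeriv p (stripPath ε t) :=
  (analyticOnNhd_sechDeriv p).continuousOn.comp_continuous (continuous_stripPath ε)
    (stripPath_mem_sechDomain hε)

theorem exists_norm_sechDeriv_stripPath_le (p : ℕ) {ε : ℝ} (hε : 0 < ε) :
    ∃ C, ∀ t, ‖sechDeriv p (stripPath ε t)‖ ≤ C := by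
  obtain ⟨C, hC⟩ := (isCompact_Icc (a := -ε) (b := ε)).exists_bound_of_continuousOn
    (continuous_sechDeriv_stripPath p hε).continuousOn
  refine ⟨max C (∑' c : ℕ, ((c : ℝ) + 1 / 2) ^ p * Real.exp (-(2 * Real.pi * ε) * (c + 1 / 2))),
    fun t => ?_⟩
  rcases le_or_gt |t| ε with h | h
  · exact le_max_of_le_left (hC t (abs_le.1 h))
  · apply le_max_of_le_right
    rcases lt_abs.1 h with h | h
    · refine norm_sechDeriv_le p hε (Or.inl rfl) ?_
      rw [stripPath_re, min_eq_left h.le, max_eq_right (by linarith)]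
      simp
    · refine norm_sechDeriv_le p hε (Or.inr rfl) ?_
      rw [stripPath_re, min_eq_right (by linarith), max_eq_left (by linarith)]
      simp

/-- The real part of the path is bounded by $\varepsilon$ and its imaginary part is `max 0 (|t| -
ε)`. The imaginary part of $l$ is thus the rate of decay, and its real part costs only a constant.
-/
theorem norm_exp_stripPath_le {ε : ℝ} (hε : 0 < ε) (l : ℂ) (t : ℝ) :
    ‖Complex.exp (2 * Real.pi * l * stripPath ε t)‖
      ≤ Real.exp (2 * Real.pi * |l.re| * ε) * Real.exp (-(2 * Real.pi * l.im) * max 0 (|t| - ε)) := by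
  rw [Complex.norm_exp, ← Real.exp_add, ← stripPath_im]
  apply Real.exp_le_exp.2
  rw [show 2 * Real.pi * l * stripPath ε t = ((2 * Real.pi : ℝ) : ℂ) * (l * stripPath ε t) by
    push_cast; ring, Complex.re_ofReal_mul, Complex.mul_re]
  have h1 : l.re * (stripPath ε t).re ≤ |l.re| * ε :=
    (le_abs_self _).trans (by rw [abs_mul]; gcongr; exact abs_stripPath_re_le hε t)
  nlinarith [mul_le_mul_of_nonneg_left h1 Real.two_pi_pos.le]

theorem stripDecay_sechDeriv (p : ℕ) {ε : ℝ} (hε : 0 < ε) {l : ℂ} (hl : 0 < l.im) :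
    StripDecay ε fun y => sechDeriv p y * Complex.exp (2 * Real.pi * l * y) where
  cont := (continuous_sechDeriv_stripPath p hε).mul
    (Complex.continuous_exp.comp (continuous_const.mul (continuous_stripPath ε)))
  decay := by
    obtain ⟨C, hC⟩ := exists_norm_sechDeriv_stripPath_le p hε
    refine ⟨C * Real.exp (2 * Real.pi * |l.re| * ε), 2 * Real.pi * l.im,
      mul_pos Real.two_pi_pos hl, fun t => ?_⟩
    rw [norm_mul, mul_assoc C]
    exact mul_le_mul (hC t) (norm_exp_stripPath_le hε l t) (norm_nonneg _)
      ((norm_nonneg _).trans (hC t))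

theorem StripDecay.const_mul {ε : ℝ} {φ : ℂ → ℂ} (h : StripDecay ε φ) (c : ℂ) :
    StripDecay ε fun y => c * φ y where
  cont := continuous_const.mul h.cont
  decay := by
    obtain ⟨C, a, ha, hb⟩ := h.decay
    refine ⟨‖c‖ * C, a, ha, fun t => ?_⟩
    rw [norm_mul, mul_assoc]
    gcongr
    exact hb t

theorem StripDecay.add {ε : ℝ} {φ ψ : ℂ → ℂ} (h : StripDecay ε φ) (h' : StripDecay ε ψ) :
    StripDecay ε fun y => φ y + ψ y where
  cont := h.cont.add h'.cont
  decay := by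
    obtain ⟨C, a, ha, hb⟩ := h.decay
    obtain ⟨C', a', ha', hb'⟩ := h'.decay
    refine ⟨|C| + |C'|, min a a', lt_min ha ha', fun t => (norm_add_le _ _).trans ?_⟩
    have hm : 0 ≤ max 0 (|t| - ε) := le_max_left _ _
    rw [add_mul]
    refine add_le_add ((hb t).trans ?_) ((hb' t).trans ?_)
    · gcongr
      · exact le_abs_self C
      · exact min_le_left _ _
    · gcongr
      · exact le_abs_self C'
      · exact min_le_right _ _

/-- Integration by parts: the derivative of $\frac1{2\pi}S_p(y)e^{2\pi ly}$ is
$(S_{p+1}(y)+l\,S_p(y))e^{2\pi ly}$, with $S_p$ for `sechDeriv p`. Nothing comes from the two ends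
at infinity because $\operatorname{Im}l>0$. -/
theorem integral_sechDeriv_succ (p : ℕ) {ε : ℝ} (hε : 0 < ε) {l : ℂ} (hl : 0 < l.im) :
    ∫ t, sechDeriv (p + 1) (stripPath ε t) * Complex.exp (2 * Real.pi * l * stripPath ε t)
        * stripPathDeriv ε t
      = -l * ∫ t, sechDeriv p (stripPath ε t) * Complex.exp (2 * Real.pi * l * stripPath ε t)
        * stripPathDeriv ε t := by
  have h0 := stripDecay_sechDeriv p hε hl
  have h1 := stripDecay_sechDeriv (p + 1) hε hl
  have hpi : (Real.pi : ℂ) ≠ 0 := by exact_mod_cast Real.pi_ne_zero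
  have h := (h0.const_mul (2 * Real.pi)⁻¹).integral_deriv_eq_zero (h1.add (h0.const_mul l)) hε
    (fun t => by
      have e1 : HasDerivAt (fun y : ℂ => 2 * Real.pi * l * y) (2 * Real.pi * l)
          (stripPath ε t) := by
        simpa using (hasDerivAt_id (stripPath ε t)).const_mul (2 * Real.pi * l)
      refine (((hasDerivAt_sechDeriv p (stripPath_mem_sechDomain hε t)).mul e1.cexp).const_mul
        (2 * (Real.pi : ℂ))⁻¹).congr_deriv ?_
      field_simp)
  simp only [add_mul, mul_assoc l] at h
  rw [integral_add h1.integrable (h0.integrable.const_mul l), integral_const_mul] at h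
  linear_combination h

theorem integral_sechDeriv_eq_pow_mul (p : ℕ) {ε : ℝ} (hε : 0 < ε) {l : ℂ} (hl : 0 < l.im) :
    ∫ t, sechDeriv p (stripPath ε t) * Complex.exp (2 * Real.pi * l * stripPath ε t)
        * stripPathDeriv ε t
      = (-l) ^ p * ∫ t, sechDeriv 0 (stripPath ε t)
        * Complex.exp (2 * Real.pi * l * stripPath ε t) * stripPathDeriv ε t := by
  induction p with
  | zero => simp
  | succ p ih => rw [integral_sechDeriv_succ p hε hl, ih]; ring

/-! ### The residue at `i / 2` -/

/-- The integral of `f` over the boundary of the rectangle `[-ε, ε] × [0, 1]`. -/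
def rectIntegral (ε : ℝ) (f : ℂ → ℂ) : ℂ :=
  (∫ x in (-ε)..ε, f x) - (∫ x in (-ε)..ε, f (x + Complex.I))
    + Complex.I * (∫ y in (0 : ℝ)..1, f (ε + y * Complex.I))
    - Complex.I * ∫ y in (0 : ℝ)..1, f (-ε + y * Complex.I)

theorem rectIntegral_eq_zero {ε : ℝ} (f : ℂ → ℂ)
    (hf : DifferentiableOn ℂ f (uIcc (-ε) ε ×ℂ uIcc 0 1)) : rectIntegral ε f = 0 := by
  have h := Complex.integral_boundary_rect_eq_zero_of_differentiableOn f (-ε : ℝ)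
    ((ε : ℂ) + Complex.I) (by simpa using hf)
  simpa [rectIntegral] using h

/-- Computed edge by edge: the horizontal edges together give $4i\arctan(2\varepsilon)$ and the
vertical ones $4i\arctan(1/(2\varepsilon))$, and the two arctangents add up to $\pi/2$. -/
theorem rectIntegral_inv_sub {ε : ℝ} (hε : 0 < ε) :
    rectIntegral ε (fun y => (y - Complex.I / 2)⁻¹) = 2 * Real.pi * Complex.I := by
  have hne : ∀ a b : ℝ, (a ≠ 0 ∨ b ≠ 0) → (a + b * Complex.I : ℂ) ≠ 0 := by
    intro a b h h0
    have h1 := congrArg Complex.re h0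
    have h2 := congrArg Complex.im h0
    simp at h1 h2
    rcases h with h | h <;> contradiction
  have hc : ∀ u v : ℝ → ℝ, Continuous u → Continuous v → (∀ x, u x ≠ 0 ∨ v x ≠ 0) →
      Continuous fun x => (u x + v x * Complex.I : ℂ)⁻¹ := by
    intro u v hu hv h
    exact Continuous.inv₀ (by fun_prop) fun x => hne _ _ (h x)
  have hsq : ∀ a b : ℝ, (a ≠ 0 ∨ b ≠ 0) →
      (a + b * Complex.I : ℂ)⁻¹ = (a - b * Complex.I) / (a ^ 2 + b ^ 2 : ℝ) := by
    intro a b h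
    have hp : (a ^ 2 + b ^ 2 : ℝ) ≠ 0 := by
      rcases h with h | h <;> positivity
    rw [inv_eq_iff_eq_inv, inv_div, eq_div_iff]
    · push_cast
      linear_combination (-(b : ℂ) ^ 2) * Complex.I_sq
    · have := hne a (-b) (by simpa using h)
      simpa [sub_eq_add_neg] using this
  have e1 : (∫ x in (-ε)..ε, ((x : ℂ) - Complex.I / 2)⁻¹)
      - (∫ x in (-ε)..ε, ((x : ℂ) + Complex.I - Complex.I / 2)⁻¹)
      = Complex.I * (4 * Real.arctan (2 * ε) : ℝ) := by
    rw [← intervalIntegral.integral_sub]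
    · have : ∀ x : ℝ, ((x : ℂ) - Complex.I / 2)⁻¹ - ((x : ℂ) + Complex.I - Complex.I / 2)⁻¹
          = Complex.I * ((4 / (1 + (2 * x) ^ 2) : ℝ) : ℂ) := by
        intro x
        have hp : (x ^ 2 + (1 / 2) ^ 2 : ℝ) ≠ 0 := by positivity
        have hp' : (1 + (2 * x) ^ 2 : ℝ) ≠ 0 := by positivity
        have h1 := hsq x (-(1 / 2)) (Or.inr (by norm_num))
        have h2 := hsq x (1 / 2) (Or.inr (by norm_num))
        rw [show (x : ℂ) - Complex.I / 2 = x + (-(1 / 2) : ℝ) * Complex.I by push_cast; ring, h1,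
          show (x : ℂ) + Complex.I - Complex.I / 2 = x + (1 / 2 : ℝ) * Complex.I by
            push_cast; ring, h2, neg_sq, ← sub_div, div_eq_iff (by exact_mod_cast hp)]
        rw [show (4 / (1 + (2 * x) ^ 2) : ℝ) = 1 / (x ^ 2 + (1 / 2) ^ 2) by
          field_simp; ring, mul_assoc, ← Complex.ofReal_mul, one_div_mul_cancel hp]
        push_cast; ring
      simp only [this]
      rw [intervalIntegral.integral_const_mul, intervalIntegral.integral_ofReal,
        intervalIntegral.integral_eq_sub_of_hasDerivAt (f := fun x => 2 * Real.arctan (2 * x))]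
      · congr 2
        rw [show 2 * -ε = -(2 * ε) by ring, Real.arctan_neg]; ring
      · intro x _
        refine ((((hasDerivAt_id' x).const_mul 2).arctan).const_mul 2).congr_deriv ?_
        ring
      · refine Continuous.intervalIntegrable ?_ _ _
        exact continuous_const.div (by fun_prop) fun x => by positivity
    · refine Continuous.intervalIntegrable ?_ _ _
      refine (hc (fun x => x) (fun _ => -(1 / 2)) (by fun_prop) (by fun_prop)
        (fun x => Or.inr (by norm_num))).congr fun x => ?_
      congr 1; push_cast; ring
    · refine Continuous.intervalIntegrable ?_ _ _
      refine (hc (fun x => x) (fun _ => 1 / 2) (by fun_prop) (by fun_prop)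
        (fun x => Or.inr (by norm_num))).congr fun x => ?_
      congr 1; push_cast; ring
  have e2 : (∫ y in (0 : ℝ)..1, ((ε : ℂ) + y * Complex.I - Complex.I / 2)⁻¹)
      - (∫ y in (0 : ℝ)..1, (-(ε : ℂ) + y * Complex.I - Complex.I / 2)⁻¹)
      = (4 * Real.arctan (2 * ε)⁻¹ : ℝ) := by
    rw [← intervalIntegral.integral_sub]
    · have : ∀ y : ℝ, ((ε : ℂ) + y * Complex.I - Complex.I / 2)⁻¹
          - (-(ε : ℂ) + y * Complex.I - Complex.I / 2)⁻¹
          = ((2 / ε / (1 + ((y - 1 / 2) / ε) ^ 2) : ℝ) : ℂ) := by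
        intro y
        have hp : (ε ^ 2 + (y - 1 / 2) ^ 2 : ℝ) ≠ 0 := by positivity
        have hp' : (1 + ((y - 1 / 2) / ε) ^ 2 : ℝ) ≠ 0 := by positivity
        have h1 := hsq ε (y - 1 / 2) (Or.inl hε.ne')
        have h2 := hsq (-ε) (y - 1 / 2) (Or.inl (neg_ne_zero.2 hε.ne'))
        rw [show (ε : ℂ) + y * Complex.I - Complex.I / 2 = ε + (y - 1 / 2 : ℝ) * Complex.I by
            push_cast; ring, h1,
          show -(ε : ℂ) + y * Complex.I - Complex.I / 2
            = (-ε : ℝ) + (y - 1 / 2 : ℝ) * Complex.I by push_cast; ring, h2, neg_sq, ← sub_div,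
          div_eq_iff (by exact_mod_cast hp)]
        rw [show (2 / ε / (1 + ((y - 1 / 2) / ε) ^ 2) : ℝ) = 2 * ε / (ε ^ 2 + (y - 1 / 2) ^ 2) by
          field_simp, ← Complex.ofReal_mul, div_mul_cancel₀ _ hp]
        push_cast; ring
      simp only [this]
      rw [intervalIntegral.integral_ofReal,
        intervalIntegral.integral_eq_sub_of_hasDerivAt
          (f := fun y => 2 * Real.arctan ((y - 1 / 2) / ε))]
      · congr 1
        rw [show (1 - 1 / 2) / ε = (2 * ε)⁻¹ by field_simp; norm_num,
          show (0 - 1 / 2) / ε = -(2 * ε)⁻¹ by field_simp; norm_num, Real.arctan_neg]; ring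
      · intro y _
        refine (((((hasDerivAt_id' y).sub_const (1 / 2)).div_const ε).arctan).const_mul
          2).congr_deriv ?_
        ring
      · refine Continuous.intervalIntegrable ?_ _ _
        exact continuous_const.div (by fun_prop) fun x => by positivity
    · refine Continuous.intervalIntegrable ?_ _ _
      refine (hc (fun _ => ε) (fun y => y - 1 / 2) (by fun_prop) (by fun_prop)
        (fun x => Or.inl hε.ne')).congr fun x => ?_
      congr 1; push_cast; ring
    · refine Continuous.intervalIntegrable ?_ _ _
      refine (hc (fun _ => -ε) (fun y => y - 1 / 2) (by fun_prop) (by fun_prop)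
        (fun x => Or.inl (neg_ne_zero.2 hε.ne'))).congr fun x => ?_
      congr 1; push_cast; ring
  rw [rectIntegral, e1, add_sub_assoc, ← mul_sub, e2, Real.arctan_inv_of_pos (by positivity)]
  push_cast; ring

end

/-! ### The hyperbolic secant over the rectangle and over the half-strip -/

noncomputable section

open MeasureTheory Set

/-- The point $i/2$ is interior to the rectangle, so continuity away from it already gives
integrability along the edges. -/
theorem rectIntegral_sub {ε : ℝ} (hε : 0 < ε) (f g : ℂ → ℂ)
    (hf : ∀ y : ℂ, y ∈ uIcc (-ε) ε ×ℂ uIcc 0 1 → y ≠ Complex.I / 2 → ContinuousAt f y)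
    (hg : ∀ y : ℂ, y ∈ uIcc (-ε) ε ×ℂ uIcc 0 1 → y ≠ Complex.I / 2 → ContinuousAt g y) :
    rectIntegral ε (fun y => f y - g y) = rectIntegral ε f - rectIntegral ε g := by
  have hε' : -ε ≤ ε := by linarith
  have key : ∀ f : ℂ → ℂ,
      (∀ y : ℂ, y ∈ uIcc (-ε) ε ×ℂ uIcc 0 1 → y ≠ Complex.I / 2 → ContinuousAt f y) →
      IntervalIntegrable (fun x : ℝ => f x) volume (-ε) ε ∧
      IntervalIntegrable (fun x : ℝ => f (x + Complex.I)) volume (-ε) ε ∧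
      IntervalIntegrable (fun y : ℝ => f (ε + y * Complex.I)) volume 0 1 ∧
      IntervalIntegrable (fun y : ℝ => f (-ε + y * Complex.I)) volume 0 1 := by
    intro f hf
    have aux : ∀ (u : ℝ → ℂ) (a b : ℝ), Continuous u →
        (∀ x ∈ uIcc a b, u x ∈ uIcc (-ε) ε ×ℂ uIcc 0 1 ∧ u x ≠ Complex.I / 2) →
        IntervalIntegrable (fun x => f (u x)) volume a b := by
      intro u a b hu h
      refine ContinuousOn.intervalIntegrable fun x hx => ?_
      have := hf (u x) (h x hx).1 (h x hx).2
      exact (this.comp hu.continuousAt).continuousWithinAt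
    refine ⟨aux (fun x => x) _ _ (by fun_prop) fun x hx => ⟨?_, fun h => ?_⟩,
      aux (fun x => x + Complex.I) _ _ (by fun_prop) fun x hx => ⟨?_, fun h => ?_⟩,
      aux (fun y => ε + y * Complex.I) _ _ (by fun_prop) fun x hx => ⟨?_, fun h => ?_⟩,
      aux (fun y => -ε + y * Complex.I) _ _ (by fun_prop) fun x hx => ⟨?_, fun h => ?_⟩⟩
    · simpa [Complex.mem_reProdIm] using hx
    · simpa using congrArg Complex.im h
    · simpa [Complex.mem_reProdIm] using hx
    · have := congrArg Complex.im h
      norm_num at this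
    · simpa [Complex.mem_reProdIm] using hx
    · have := congrArg Complex.re h
      simp at this
      exact hε.ne' this
    · simpa [Complex.mem_reProdIm] using hx
    · have := congrArg Complex.re h
      simp at this
      exact hε.ne' this
  obtain ⟨f1, f2, f3, f4⟩ := key f hf
  obtain ⟨g1, g2, g3, g4⟩ := key g hg
  simp only [rectIntegral]
  rw [intervalIntegral.integral_sub f1 g1, intervalIntegral.integral_sub f2 g2,
    intervalIntegral.integral_sub f3 g3, intervalIntegral.integral_sub f4 g4]
  ring

theorem cosh_pi_ne_zero_of_mem_rect {y : ℂ} (h0 : 0 ≤ y.im) (h1 : y.im ≤ 1)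
    (hy : y ≠ Complex.I / 2) : Complex.cosh (Real.pi * y) ≠ 0 := by
  intro h
  obtain ⟨l, rfl⟩ := cosh_pi_eq_zero_iff.1 h
  have e : (-((2 * l + 1) / 2 * Complex.I) : ℂ).im = -((2 * l + 1) / 2 : ℝ) := by
    have : ((2 * l + 1) / 2 : ℂ) = ((2 * l + 1) / 2 : ℝ) := by push_cast; ring
    rw [this, Complex.neg_im, Complex.im_ofReal_mul]
    simp
  rw [e] at h0 h1
  have hl : (l : ℝ) < 0 := by linarith
  have hl' : (-2 : ℝ) < l := by linarith
  have : l = -1 := by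
    have a : l < 0 := by exact_mod_cast hl
    have b : -2 < l := by exact_mod_cast hl'
    omega
  apply hy
  rw [this]; push_cast; ring

theorem cosh_pi_I_half : Complex.cosh (Real.pi * (Complex.I / 2)) = 0 :=
  cosh_pi_eq_zero_iff.2 ⟨-1, by push_cast; ring⟩

/-- A residue computation. With $y_0=i/2$ one has $\cosh\pi y=C(y)(y-y_0)$, where $C$ is entire,
without zeros for $0\le\operatorname{Im}y\le1$, and $C(y_0)=\pi i$. The integrand is then
$\psi(y)/(y-y_0)$ with $\psi=e^{2\pi ly}/(2C)$. Subtracting $\psi(y_0)/(y-y_0)$ leaves the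
holomorphic `dslope ψ y₀`, whose integral is zero, and $2\pi i\,\psi(y_0)=e^{\pi il}$. -/
theorem rectIntegral_sech {ε : ℝ} (hε : 0 < ε) (l : ℂ) :
    rectIntegral ε (fun y => sechDeriv 0 y * Complex.exp (2 * Real.pi * l * y))
      = Complex.exp (Real.pi * Complex.I * l) := by
  set y₀ : ℂ := Complex.I / 2 with hy₀
  have hpi : (Real.pi : ℂ) ≠ 0 := by exact_mod_cast Real.pi_ne_zero
  set C : ℂ → ℂ := dslope (fun y => Complex.cosh (Real.pi * y)) y₀ with hC
  have hCd : Differentiable ℂ C := by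
    rw [← differentiableOn_univ, hC, Complex.differentiableOn_dslope Filter.univ_mem]
    fun_prop
  have hC₀ : C y₀ = Real.pi * Complex.I := by
    rw [hC, dslope_same]
    have : HasDerivAt (fun y : ℂ => Complex.cosh (Real.pi * y))
        (Complex.sinh (Real.pi * y₀) * (Real.pi * 1)) y₀ :=
      ((hasDerivAt_id y₀).const_mul (Real.pi : ℂ)).ccosh
    rw [this.deriv, hy₀, show (Real.pi : ℂ) * (Complex.I / 2) = (Real.pi / 2) * Complex.I by ring,
      Complex.sinh_mul_I, Complex.sin_pi_div_two]
    ring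
  have hC' : ∀ y, y ≠ y₀ → C y * (y - y₀) = Complex.cosh (Real.pi * y) := by
    intro y hy
    rw [hC, dslope_of_ne _ hy, slope_def_field, hy₀, cosh_pi_I_half, sub_zero,
      div_mul_cancel₀ _ (sub_ne_zero.2 hy)]
  have hCne : ∀ y : ℂ, 0 ≤ y.im → y.im ≤ 1 → C y ≠ 0 := by
    intro y h0 h1
    by_cases hy : y = y₀
    · rw [hy, hC₀]
      exact mul_ne_zero hpi Complex.I_ne_zero
    · intro h
      apply cosh_pi_ne_zero_of_mem_rect h0 h1 hy
      rw [← hC' y hy, h, zero_mul]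
  set ψ : ℂ → ℂ := fun y => Complex.exp (2 * Real.pi * l * y) / (2 * C y) with hψ
  set S : Set ℂ := uIcc (-ε) ε ×ℂ uIcc 0 1 with hS
  have hmem : ∀ y ∈ S, 0 ≤ y.im ∧ y.im ≤ 1 := by
    intro y hy
    have := hy.2
    simpa using this
  have hψd : DifferentiableOn ℂ ψ S := by
    intro y hy
    refine DifferentiableAt.differentiableWithinAt (DifferentiableAt.div (by fun_prop)
      (by fun_prop) (mul_ne_zero two_ne_zero (hCne y (hmem y hy).1 (hmem y hy).2)))
  have hSn : S ∈ nhds y₀ := by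
    have h1 : Ioo (-ε) ε ×ℂ Ioo 0 1 ⊆ S := by
      intro y hy
      refine ⟨?_, ?_⟩
      · have := hy.1
        rw [uIcc_of_le (by linarith)]
        exact Ioo_subset_Icc_self this
      · have := hy.2
        rw [uIcc_of_le zero_le_one]
        exact Ioo_subset_Icc_self this
    refine Filter.mem_of_superset ((isOpen_Ioo.reProdIm isOpen_Ioo).mem_nhds ?_) h1
    rw [Complex.mem_reProdIm, hy₀]
    norm_num [hε]
  have hz := rectIntegral_eq_zero (dslope ψ y₀) ((Complex.differentiableOn_dslope hSn).2 hψd)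
  have hne : ∀ y : ℂ, y ∈ S → y ≠ y₀ → dslope ψ y₀ y
      = sechDeriv 0 y * Complex.exp (2 * Real.pi * l * y) - ψ y₀ * (y - y₀)⁻¹ := by
    intro y hy hyy
    have h1 := hCne y (hmem y hy).1 (hmem y hy).2
    have h2 := sub_ne_zero.2 hyy
    have hs : sechDeriv 0 y = (2 * Complex.cosh (Real.pi * y))⁻¹ := rfl
    rw [dslope_of_ne _ hyy, slope_def_field, hs, ← hC' y hyy, sub_div, div_eq_mul_inv (ψ y₀)]
    congr 1
    rw [hψ]
    field_simp
  have hcongr : ∀ f g : ℂ → ℂ, (∀ y ∈ S, y ≠ y₀ → f y = g y) →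
      rectIntegral ε f = rectIntegral ε g := by
    intro f g h
    simp only [rectIntegral]
    congr 1; congr 1; congr 1
    · refine intervalIntegral.integral_congr fun x hx => h _ ?_ fun h => ?_
      · simpa [hS, Complex.mem_reProdIm] using hx
      · simpa [hy₀] using congrArg Complex.im h
    · refine intervalIntegral.integral_congr fun x hx => h _ ?_ fun h => ?_
      · simpa [hS, Complex.mem_reProdIm] using hx
      · have := congrArg Complex.im h
        norm_num [hy₀] at this
    · congr 1
      refine intervalIntegral.integral_congr fun x hx => h _ ?_ fun h => ?_
      · simpa [hS, Complex.mem_reProdIm] using hx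
      · have := congrArg Complex.re h
        simp [hy₀] at this
        exact hε.ne' this
    · congr 1
      refine intervalIntegral.integral_congr fun x hx => h _ ?_ fun h => ?_
      · simpa [hS, Complex.mem_reProdIm] using hx
      · have := congrArg Complex.re h
        simp [hy₀] at this
        exact hε.ne' this
  rw [hcongr _ _ hne, rectIntegral_sub hε] at hz
  · have hs : rectIntegral ε (fun y => ψ y₀ * (y - y₀)⁻¹)
        = ψ y₀ * (2 * Real.pi * Complex.I) := by
      rw [← rectIntegral_inv_sub hε]
      simp only [rectIntegral, intervalIntegral.integral_const_mul, hy₀]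
      ring
    rw [sub_eq_zero.1 hz, hs, hψ]
    simp only [hC₀]
    have hI := Complex.I_ne_zero
    rw [show 2 * Real.pi * l * y₀ = Real.pi * Complex.I * l by rw [hy₀]; ring]
    field_simp
  · intro y hy hyy
    have hc : Complex.cosh (Real.pi * y) ≠ 0 :=
      cosh_pi_ne_zero_of_mem_rect (hmem y hy).1 (hmem y hy).2 hyy
    exact ((analyticOnNhd_sechDeriv 0 y hc).continuousAt).mul (by fun_prop)
  · intro y hy hyy
    exact continuousAt_const.mul (ContinuousAt.inv₀ (by fun_prop) (sub_ne_zero.2 hyy))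

/-- The shift $y\mapsto y+i$ multiplies the integrand by $-q$, $q=e^{2\pi il}$. Each side over
$[0,1]$ is therefore $1+q$ times the whole half-line, and bottom minus top of the rectangle is $1+q$
times the bottom. The rectangle integral is thus $1+q$ times the integral over the half-strip, and
the quotient $e^{\pi il}/(1+e^{2\pi il})$ is $1/(2\cosh\pi il)$. -/
theorem integral_sechDeriv_zero {ε : ℝ} (hε : 0 < ε) {l : ℂ} (hl : 0 < l.im) :
    ∫ t, sechDeriv 0 (stripPath ε t) * Complex.exp (2 * Real.pi * l * stripPath ε t)
        * stripPathDeriv ε t = (2 * Complex.cosh (Real.pi * Complex.I * l))⁻¹ := by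
  have h0 := stripDecay_sechDeriv 0 hε hl
  have hrect := rectIntegral_sech hε l
  rw [h0.integral_eq hε]
  set φ : ℂ → ℂ := fun y => sechDeriv 0 y * Complex.exp (2 * Real.pi * l * y) with hφ
  set q := Complex.exp (2 * Real.pi * Complex.I * l) with hq
  have hshift : ∀ y, φ (y + Complex.I) = -q * φ y := by
    intro y
    simp only [hφ, sechDeriv, hq]
    rw [show (Real.pi : ℂ) * (y + Complex.I) = Real.pi * y + Real.pi * Complex.I by ring,
      Complex.cosh_add, Complex.cosh_mul_I, Complex.sinh_mul_I, Complex.cos_pi, Complex.sin_pi,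
      show 2 * Real.pi * l * (y + Complex.I)
        = 2 * Real.pi * l * y + 2 * Real.pi * Complex.I * l by ring, Complex.exp_add]
    rw [zero_mul, mul_zero, add_zero, mul_neg_one, mul_neg, inv_neg]
    ring
  have hside : ∀ c : ℂ, IntegrableOn (fun y : ℝ => φ (c + y * Complex.I)) (Ioi 0) →
      ∫ y in (0 : ℝ)..1, φ (c + y * Complex.I)
        = (1 + q) * ∫ y in Ioi (0 : ℝ), φ (c + y * Complex.I) := by
    intro c hc
    have h1 := intervalIntegral.integral_interval_add_Ioi (b := (1 : ℝ)) hc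
      (hc.mono_set (Ioi_subset_Ioi zero_le_one))
    have h2 := integral_Ioi_add_right (fun y : ℝ => φ (c + y * Complex.I)) 1 0
    rw [zero_add] at h2
    rw [← h2] at h1
    have h3 : ∀ y : ℝ, φ (c + ((y + 1 : ℝ) : ℂ) * Complex.I) = -q * φ (c + y * Complex.I) := by
      intro y
      rw [← hshift]
      congr 1; push_cast; ring
    simp only [h3, integral_const_mul] at h1
    linear_combination h1
  have hbot : ∫ x in (-ε)..ε, φ (x + Complex.I) = -q * ∫ x in (-ε)..ε, φ x := by
    simp only [hshift, intervalIntegral.integral_const_mul]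
  rw [rectIntegral, hbot, hside _ (h0.integrableOn_right hε), hside _ (h0.integrableOn_left hε)]
    at hrect
  set E := Complex.exp (Real.pi * Complex.I * l) with hE
  have hEne : E ≠ 0 := Complex.exp_ne_zero _
  have hqE : q = E ^ 2 := by
    rw [hq, hE, ← Complex.exp_nat_mul]; congr 1; push_cast; ring
  have hcosh : 2 * Complex.cosh (Real.pi * Complex.I * l) = (1 + q) / E := by
    rw [Complex.cosh, Complex.exp_neg, ← hE, hqE]
    field_simp
    ring
  -- For $q=-1$ the rectangle integral would vanish, but it equals an exponential.
  have hne : 1 + q ≠ 0 := by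
    intro h
    rw [h] at hrect
    apply hEne
    rw [← hrect]
    have : q = -1 := by linear_combination h
    rw [this]; ring
  rw [hcosh, inv_div, eq_div_iff hne, ← hrect]
  ring

/-- The integral of `sechDeriv p y * exp (2 π l y)` along the boundary of the half-strip
`{|Re y| ≤ ε, 0 ≤ τ Im y}`. -/
theorem integral_sechDeriv {τ : ℤ} (hτ : τ = 1 ∨ τ = -1) (p : ℕ) {ε : ℝ} (hε : 0 < ε) {l : ℂ}
    (hl : 0 < τ * l.im) :
    Integrable (fun t => sechDeriv p (τ * stripPath ε t)
      * Complex.exp (2 * Real.pi * l * (τ * stripPath ε t)) * (τ * stripPathDeriv ε t)) ∧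
    ∫ t, sechDeriv p (τ * stripPath ε t) * Complex.exp (2 * Real.pi * l * (τ * stripPath ε t))
        * (τ * stripPathDeriv ε t)
      = (-l) ^ p * (τ * (2 * Complex.cosh (Real.pi * Complex.I * l))⁻¹) := by
  rcases hτ with rfl | rfl
  · simp only [Int.cast_one, one_mul] at hl ⊢
    exact ⟨(stripDecay_sechDeriv p hε hl).integrable,
      by rw [integral_sechDeriv_eq_pow_mul p hε hl, integral_sechDeriv_zero hε hl]⟩
  · have hl' : 0 < (-l).im := by simpa using hl
    -- The reflection $y\mapsto-y$ replaces $l$ by $-l$; the parity of `sechDeriv p` contributes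
    -- $(-1)^p$, and $dy$ the remaining sign.
    have e : ∀ t, sechDeriv p (((-1 : ℤ) : ℂ) * stripPath ε t)
        * Complex.exp (2 * Real.pi * l * (((-1 : ℤ) : ℂ) * stripPath ε t))
        * (((-1 : ℤ) : ℂ) * stripPathDeriv ε t)
        = (-(-1) ^ p) * (sechDeriv p (stripPath ε t)
          * Complex.exp (2 * Real.pi * (-l) * stripPath ε t) * stripPathDeriv ε t) := by
      intro t
      rw [Int.cast_neg, Int.cast_one, neg_one_mul, sechDeriv_neg, mul_neg (2 * Real.pi * l),
        ← neg_mul, ← mul_neg (2 * (Real.pi : ℂ)) l]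
      ring
    simp only [e]
    refine ⟨(stripDecay_sechDeriv p hε hl').integrable.const_mul _, ?_⟩
    rw [integral_const_mul, integral_sechDeriv_eq_pow_mul p hε hl', integral_sechDeriv_zero hε hl',
      mul_neg, Complex.cosh_neg, neg_pow l]
    push_cast
    rw [neg_neg]
    ring

end

noncomputable section

open MeasureTheory

/-! ## Expansion of multiple boundary integrals -/

/-- Absolute summability is carried through the induction because the product of two families needs
it. -/
theorem hasSum_pi_prod {𝕜 : Type*} [NormedField 𝕜] [CompleteSpace 𝕜] {N : ℕ}
    (f : Fin N → ℕ → 𝕜) (a : Fin N → 𝕜) (hf : ∀ i, HasSum (f i) (a i))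
    (hn : ∀ i, Summable fun c => ‖f i c‖) :
    HasSum (fun c : Fin N → ℕ => ∏ i, f i (c i)) (∏ i, a i) ∧
      Summable fun c : Fin N → ℕ => ‖∏ i, f i (c i)‖ := by
  induction N with
  | zero =>
    have h := hasSum_unique (fun c : Fin 0 → ℕ => ∏ i, f i (c i))
    have h' := hasSum_unique (fun c : Fin 0 → ℕ => ‖∏ i, f i (c i)‖)
    exact ⟨h.of_eq (fun _ => rfl) (by simp), h'.summable⟩
  | succ N ih =>
    obtain ⟨h1, h2⟩ := ih (fun i => f i.succ) (fun i => a i.succ) (fun i => hf i.succ)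
      (fun i => hn i.succ)
    have hs := (hn 0).mul_norm h2
    let E : ℕ × (Fin N → ℕ) ≃ (Fin (N + 1) → ℕ) := Fin.consEquiv fun _ => ℕ
    have e : ∀ x : ℕ × (Fin N → ℕ), ∏ i, f i (E x i) = f 0 x.1 * ∏ i, f i.succ (x.2 i) :=
      fun x => Fin.prod_univ_succ _
    constructor
    · rw [← E.hasSum_iff, Fin.prod_univ_succ]
      exact ((hf 0).mul h1 hs.of_norm).of_eq e rfl
    · rw [← E.summable_iff]
      exact hs.congr fun x => by rw [Function.comp_apply, e x]

theorem prod_exp_add_sum {ι κ : Type*} [Fintype ι] [Fintype κ] (A : ι → ℂ) (B : ι → κ → ℂ) :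
    ∏ t, Complex.exp (A t + ∑ a, B t a)
      = (∏ t, Complex.exp (A t)) * ∏ a, Complex.exp (∑ t, B t a) := by
  rw [← Complex.exp_sum, ← Complex.exp_sum, ← Complex.exp_sum, ← Complex.exp_add,
    Finset.sum_add_distrib, Finset.sum_comm]

/-- By `hR` the arguments of the first product stay in the half-planes
$\sigma_t\operatorname{Re}\ge\delta$ along the whole contour. There they have exponential series
with a majorant independent of the point, so sum and integral may be interchanged. Each term is an
exponential in the contour variables and merely changes the exponents of the second product, after
which the integral factors into one-variable integrals. -/
theorem expand_boundary_integral {d k : ℕ} (R : Fin d → Fin k → ℤ) (z : Fin d → ℝ)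
    (z' : Fin k → ℝ) (σ : Fin d → ℤ) (hσ : ∀ t, σ t = 1 ∨ σ t = -1) (τ : Fin k → ℤ)
    (hτ : ∀ a, τ a = 1 ∨ τ a = -1) (hz' : ∀ a, 0 < τ a * z' a) {ε δ : ℝ} (hε : 0 < ε) (hδ : 0 < δ)
    (hR : ∀ x : Fin k → ℝ, (∀ a, |x a| ≤ ε) → ∀ t, δ ≤ σ t * (z t + ∑ a, R t a * x a))
    (p : Fin d → ℕ) (q : Fin k → ℕ) :
    Integrable (fun s : Fin k → ℝ =>
      (∏ t, sechDeriv (p t) (z t + ∑ a, R t a * (τ a * stripPath ε (s a))))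
        * ∏ a, (sechDeriv (q a) (τ a * stripPath ε (s a))
          * Complex.exp (2 * Real.pi * (Complex.I * z' a) * (τ a * stripPath ε (s a)))
          * (τ a * stripPathDeriv ε (s a)))) ∧
    HasSum (fun c : Fin d → ℕ =>
      (∏ t, ((-1) ^ c t * (-(σ t : ℂ) * ((c t : ℂ) + 1 / 2)) ^ p t
        * Complex.exp (-(2 * Real.pi * σ t * z t * (c t + 1 / 2)))))
        * ∏ a, ((-(Complex.I * z' a - ∑ t, σ t * R t a * ((c t : ℂ) + 1 / 2))) ^ q a
          * (τ a * (2 * Complex.cosh (Real.pi * Complex.I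
            * (Complex.I * z' a - ∑ t, σ t * R t a * ((c t : ℂ) + 1 / 2))))⁻¹)))
      (∫ s : Fin k → ℝ,
        (∏ t, sechDeriv (p t) (z t + ∑ a, R t a * (τ a * stripPath ε (s a))))
          * ∏ a, (sechDeriv (q a) (τ a * stripPath ε (s a))
            * Complex.exp (2 * Real.pi * (Complex.I * z' a) * (τ a * stripPath ε (s a)))
            * (τ a * stripPathDeriv ε (s a)))) := by
  have hpi := Real.two_pi_pos
  set G : (Fin k → ℝ) → ℂ := fun s => ∏ a, (sechDeriv (q a) (τ a * stripPath ε (s a))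
    * Complex.exp (2 * Real.pi * (Complex.I * z' a) * (τ a * stripPath ε (s a)))
    * (τ a * stripPathDeriv ε (s a))) with hG
  have hGint : Integrable G := Integrable.fintype_prod
    (f := fun a (r : ℝ) => sechDeriv (q a) (τ a * stripPath ε r)
      * Complex.exp (2 * Real.pi * (Complex.I * z' a) * (τ a * stripPath ε r))
      * (τ a * stripPathDeriv ε r))
    fun a => (integral_sechDeriv (hτ a) (q a) hε (by simpa using hz' a)).1
  set W : Fin d → (Fin k → ℝ) → ℂ := fun t s => z t + ∑ a, R t a * (τ a * stripPath ε (s a))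
    with hW
  have hWcont : ∀ t, Continuous (W t) := fun t => by
    refine continuous_const.add (continuous_finsetSum _ fun a _ => ?_)
    exact continuous_const.mul (continuous_const.mul
      ((continuous_stripPath ε).comp (continuous_apply a)))
  have hWre : ∀ t s, δ ≤ σ t * (W t s).re := by
    intro t s
    have h1 : (W t s).re = z t + ∑ a, R t a * ((τ a : ℝ) * (stripPath ε (s a)).re) := by
      simp only [hW, Complex.add_re, Complex.ofReal_re, Complex.re_sum]
      congr 1
      refine Finset.sum_congr rfl fun a _ => ?_
      rw [← Complex.ofReal_intCast, ← Complex.ofReal_intCast, Complex.re_ofReal_mul,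
        Complex.re_ofReal_mul]
    rw [h1]
    refine hR _ (fun a => ?_) t
    rcases hτ a with h | h <;> rw [h] <;> simpa using abs_stripPath_re_le hε (s a)
  set K : (Fin d → ℕ) → ℝ := fun c => ∏ t, (((c t : ℝ) + 1 / 2) ^ p t
    * Real.exp (-(2 * Real.pi * δ) * (c t + 1 / 2))) with hK
  have hKsum : Summable K :=
    (hasSum_pi_prod (fun t (c : ℕ) => ((c : ℝ) + 1 / 2) ^ p t
      * Real.exp (-(2 * Real.pi * δ) * (c + 1 / 2))) _
      (fun t => (summable_pow_mul_exp_half (p t) (by positivity)).hasSum)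
      (fun t => (summable_pow_mul_exp_half (p t) (by positivity)).norm)).1.summable
  set Tm : (Fin d → ℕ) → (Fin k → ℝ) → ℂ := fun c s => ∏ t, ((-1) ^ c t
    * (-(σ t : ℂ) * ((c t : ℂ) + 1 / 2)) ^ p t
    * Complex.exp (-(2 * Real.pi * σ t * W t s * (c t + 1 / 2)))) with hTm
  have hTmK : ∀ c s, ‖Tm c s‖ ≤ K c := by
    intro c s
    rw [hTm, hK, norm_prod]
    refine Finset.prod_le_prod (fun t _ => norm_nonneg _) fun t _ => ?_
    rw [norm_term_sechDeriv' (p t) (c t) (hσ t)]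
    have := hWre t s
    gcongr
  have hTmsum : ∀ s, HasSum (fun c => Tm c s) (∏ t, sechDeriv (p t) (W t s)) := by
    intro s
    refine (hasSum_pi_prod (fun t (c : ℕ) => (-1) ^ c * (-(σ t : ℂ) * ((c : ℂ) + 1 / 2)) ^ p t
      * Complex.exp (-(2 * Real.pi * σ t * W t s * (c + 1 / 2)))) _
      (fun t => hasSum_sechDeriv (p t) (hσ t) (hδ.trans_le (hWre t s))) fun t => ?_).1
    simp only [norm_term_sechDeriv' (p t) _ (hσ t)]
    have := hδ.trans_le (hWre t s)
    exact summable_pow_mul_exp_half (p t) (by positivity)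
  have hTmcont : ∀ c, Continuous (Tm c) := fun c => by
    refine continuous_finsetProd _ fun t _ => ?_
    have := hWcont t
    fun_prop
  have hbound : ∀ s, ‖∏ t, sechDeriv (p t) (W t s)‖ ≤ ∑' c, K c := fun s => by
    rw [← (hTmsum s).tsum_eq]
    exact tsum_of_norm_bounded hKsum.hasSum fun c => hTmK c s
  have hcont : Continuous fun s => ∏ t, sechDeriv (p t) (W t s) := by
    refine continuous_finsetProd _ fun t _ => ?_
    refine (analyticOnNhd_sechDeriv (p t)).continuousOn.comp_continuous (hWcont t) fun s => ?_
    refine cosh_pi_ne_zero_of_re_ne_zero fun h => ?_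
    have := hWre t s
    rw [h, mul_zero] at this
    linarith
  refine ⟨hGint.bdd_mul hcont.aestronglyMeasurable (Filter.Eventually.of_forall hbound), ?_⟩
  have hFint : ∀ c, Integrable (fun s => Tm c s * G s) := fun c =>
    hGint.bdd_mul (hTmcont c).aestronglyMeasurable (Filter.Eventually.of_forall (hTmK c))
  have hFsum : Summable fun c => ∫ s, ‖Tm c s * G s‖ := by
    refine Summable.of_nonneg_of_le (fun c => integral_nonneg fun s => norm_nonneg _) (fun c => ?_)
      (hKsum.mul_right (∫ s, ‖G s‖))
    rw [← integral_const_mul]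
    refine integral_mono (hFint c).norm (hGint.norm.const_mul _) fun s => ?_
    simp only [norm_mul]
    exact mul_le_mul_of_nonneg_right (hTmK c s) (norm_nonneg _)
  have hmain := hasSum_integral_of_summable_integral_norm hFint hFsum
  refine hmain.of_eq (fun c => ?_) (integral_congr_ae (Filter.Eventually.of_forall fun s => ?_))
  -- The total exponent of the $a$-th variable in the term of index $c$. The series contributes only
  -- a real number to it, so its imaginary part is `z' a` for every $c$, and the one-variable
  -- integrals converge.
  · set L : Fin k → ℂ := fun a => Complex.I * z' a - ∑ t, σ t * R t a * ((c t : ℂ) + 1 / 2)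
      with hL
    have hLim : ∀ a, 0 < τ a * (L a).im := by
      intro a
      have : (∑ t, (σ t : ℂ) * R t a * ((c t : ℂ) + 1 / 2)).im = 0 := by
        have e : (∑ t, (σ t : ℂ) * R t a * ((c t : ℂ) + 1 / 2))
            = ((∑ t, (σ t : ℝ) * R t a * ((c t : ℝ) + 1 / 2) : ℝ) : ℂ) := by push_cast; rfl
        rw [e, Complex.ofReal_im]
      simpa [hL, this] using hz' a
    have hfac : ∀ s, Tm c s * G s
        = (∏ t, ((-1) ^ c t * (-(σ t : ℂ) * ((c t : ℂ) + 1 / 2)) ^ p t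
          * Complex.exp (-(2 * Real.pi * σ t * z t * (c t + 1 / 2)))))
          * ∏ a, (sechDeriv (q a) (τ a * stripPath ε (s a))
            * Complex.exp (2 * Real.pi * L a * (τ a * stripPath ε (s a)))
            * (τ a * stripPathDeriv ε (s a))) := by
      intro s
      have e1 : ∀ t, Complex.exp (-(2 * Real.pi * σ t * W t s * (c t + 1 / 2)))
          = Complex.exp (-(2 * Real.pi * σ t * z t * (c t + 1 / 2))
            + ∑ a, -(2 * Real.pi * (σ t * R t a * (c t + 1 / 2)) * (τ a * stripPath ε (s a)))) := by
        intro t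
        congr 1
        rw [Finset.sum_neg_distrib, ← neg_add]
        congr 1
        change 2 * Real.pi * σ t * (z t + ∑ a, R t a * (τ a * stripPath ε (s a)))
          * ((c t : ℂ) + 1 / 2) = _
        rw [mul_add (2 * Real.pi * (σ t : ℂ)), add_mul _ _ ((c t : ℂ) + 1 / 2), Finset.mul_sum,
          Finset.sum_mul]
        congr 1
        exact Finset.sum_congr rfl fun a _ => by ring
      have e2 : ∀ a, Complex.exp (2 * Real.pi * L a * (τ a * stripPath ε (s a)))
          = Complex.exp (2 * Real.pi * (Complex.I * z' a) * (τ a * stripPath ε (s a)))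
            * Complex.exp (∑ t, -(2 * Real.pi * (σ t * R t a * (c t + 1 / 2))
              * (τ a * stripPath ε (s a)))) := by
        intro a
        rw [← Complex.exp_add]
        congr 1
        rw [Finset.sum_neg_distrib, ← Finset.sum_mul, ← Finset.mul_sum, hL]
        ring
      simp only [hTm, hG, e2, Finset.prod_mul_distrib]
      rw [Finset.prod_congr rfl fun t _ => e1 t, prod_exp_add_sum]
      ring
    simp only [hfac]
    rw [integral_const_mul]
    congr 1
    rw [integral_fintype_prod_volume_eq_prod (fun a (r : ℝ) => sechDeriv (q a) (τ a * stripPath ε r)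
      * Complex.exp (2 * Real.pi * L a * (τ a * stripPath ε r)) * (τ a * stripPathDeriv ε r))]
    exact Finset.prod_congr rfl fun a _ =>
      ((integral_sechDeriv (hτ a) (q a) hε (hLim a)).2).symm
  · simp only []
    rw [tsum_mul_right, (hTmsum s).tsum_eq]

end

noncomputable section

/-! ## The weight decomposition of the Weyl algebra -/

theorem mul_eq_shift_mul {B : Type*} [Ring B] [Algebra ℂ B] {a y : B} {c : ℂ}
    (e : a * y = y * a + c • y) : y * a = (a + algebraMap ℂ B (-c)) * y := by
  rw [add_mul, e, map_neg, neg_mul, ← Algebra.smul_def, add_neg_cancel_right]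

theorem add_smul_smul_eq {V : Type*} [AddCommGroup V] [Module ℂ V] (y : V) (c e : ℂ) :
    y + c • e • y = (1 + c * e) • y := by
  rw [add_smul, one_smul, mul_smul]

theorem add_add_neg_one_smul {V : Type*} [AddCommGroup V] [Module ℂ V] (y z : V) :
    y + z + (-1 : ℂ) • y = z := by
  rw [neg_one_smul]; abel

theorem sub_one_smul_eq {V : Type*} [AddCommGroup V] [Module ℂ V] (a y : V) :
    a - (1 : ℂ) • y = a + (-1 : ℂ) • y := by
  rw [neg_one_smul, one_smul, sub_eq_add_neg]

namespace WeylAlgebra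

variable {n : ℕ}

theorem adjoin_generators :
    Algebra.adjoin ℂ (Set.range (x (n := n)) ∪ Set.range (del (n := n))) = ⊤ := by
  have h1 := FreeAlgebra.adjoin_range_ι ℂ (Fin n ⊕ Fin n)
  have h2 := congrArg (Subalgebra.map (RingQuot.mkAlgHom ℂ (WeylRel n))) h1
  rw [AlgHom.map_adjoin, Algebra.map_top,
    (AlgHom.range_eq_top _).2 (RingQuot.mkAlgHom_surjective ℂ (WeylRel n))] at h2
  rw [← h2, ← Set.range_comp]
  congr 1
  ext y
  simp [x, del]

theorem h_mul_x (i j : Fin n) :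
    (h i * x j : WeylAlgebra n) = x j * h i + (if i = j then (1 : ℂ) else 0) • x j := by
  have h1 : (x i * del i * x j : WeylAlgebra n)
      = x j * (x i * del i) + (if i = j then (1 : ℂ) else 0) • x j := by
    rw [mul_assoc, del_x, mul_add, ← mul_assoc, x_comm i j, mul_assoc]
    split_ifs with hij
    · subst hij; simp
    · simp
  rw [h, add_mul, h1, mul_add, Algebra.commutes]
  abel

theorem h_mul_del (i j : Fin n) :
    (h i * del j : WeylAlgebra n) = del j * h i - (if i = j then (1 : ℂ) else 0) • del j := by
  have h1 : (x i * del i * del j : WeylAlgebra n)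
      = del j * (x i * del i) - (if i = j then (1 : ℂ) else 0) • del j := by
    have h2 := del_x j i
    rw [mul_assoc, del_comm i j, ← mul_assoc, ← mul_assoc, h2, add_mul]
    by_cases hij : i = j
    · subst hij; simp
    · simp [hij, Ne.symm hij]
  rw [h, add_mul, h1, mul_add, Algebra.commutes]
  abel

theorem h_mul_del' (i j : Fin n) :
    (h i * del j : WeylAlgebra n) = del j * h i + (if i = j then (-1 : ℂ) else 0) • del j := by
  rw [h_mul_del]
  split_ifs
  · exact sub_one_smul_eq _ _
  · simp

theorem h_comm (i j : Fin n) : (h i * h j : WeylAlgebra n) = h j * h i := by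
  have h1 : (h i * (x j * del j) : WeylAlgebra n) = x j * del j * h i := by
    rw [← mul_assoc, h_mul_x, add_mul, mul_assoc, h_mul_del, mul_sub, mul_smul_comm, smul_mul_assoc,
      sub_add_cancel, mul_assoc]
  conv_lhs => rw [h.eq_def j]
  conv_rhs => rw [h.eq_def j]
  rw [mul_add, add_mul, h1, Algebra.commutes]

theorem x_mul_del (j : Fin n) : (x j * del j : WeylAlgebra n) = h j - algebraMap ℂ _ (1 / 2) := by
  rw [h, add_sub_cancel_right]

theorem del_mul_x_self (j : Fin n) :
    (del j * x j : WeylAlgebra n) = h j + algebraMap ℂ _ (1 / 2) := by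
  rw [del_x, if_pos rfl, h, add_assoc, ← map_add]
  norm_num

variable (n) in
/-- The algebra generated by the `hⱼ`. -/
def cartan : Subalgebra ℂ (WeylAlgebra n) := Algebra.adjoin ℂ (Set.range h)

theorem h_mem_cartan (j : Fin n) : h j ∈ cartan n := Algebra.subset_adjoin ⟨j, rfl⟩

theorem commute_h_of_mem_cartan {a : WeylAlgebra n} (ha : a ∈ cartan n) (j : Fin n) :
    h j * a = a * h j := by
  induction ha using Algebra.adjoin_induction with
  | mem y hy => obtain ⟨i, rfl⟩ := hy; exact h_comm j i
  | algebraMap c => exact (Algebra.commutes c _).symm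
  | add a b _ _ ha hb => rw [mul_add, add_mul, ha, hb]
  | mul a b _ _ ha hb => rw [← mul_assoc, ha, mul_assoc, hb, mul_assoc]

/-- Used for the generators: moving $x_j$ or $\partial_j$ past a polynomial in the $h_i$ only
translates its variables. -/
theorem exists_mul_eq_of_shift (y : WeylAlgebra n)
    (hy : ∀ i, ∃ c : ℂ, y * h i = (h i + algebraMap ℂ _ c) * y)
    {a : WeylAlgebra n} (ha : a ∈ cartan n) : ∃ a' ∈ cartan n, y * a = a' * y := by
  induction ha using Algebra.adjoin_induction with
  | mem z hz =>
    obtain ⟨i, rfl⟩ := hz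
    obtain ⟨c, hc⟩ := hy i
    exact ⟨_, add_mem (h_mem_cartan i) ((cartan n).algebraMap_mem c), hc⟩
  | algebraMap c => exact ⟨_, (cartan n).algebraMap_mem c, (Algebra.commutes c _).symm⟩
  | add a b _ _ ha hb =>
    obtain ⟨a', ha', ea⟩ := ha
    obtain ⟨b', hb', eb⟩ := hb
    exact ⟨a' + b', add_mem ha' hb', by rw [mul_add, add_mul, ea, eb]⟩
  | mul a b _ _ ha hb =>
    obtain ⟨a', ha', ea⟩ := ha
    obtain ⟨b', hb', eb⟩ := hb
    exact ⟨a' * b', mul_mem ha' hb', by rw [← mul_assoc, ea, mul_assoc, eb, mul_assoc]⟩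

theorem exists_x_mul_eq (j : Fin n) {a : WeylAlgebra n} (ha : a ∈ cartan n) :
    ∃ a' ∈ cartan n, x j * a = a' * x j := by
  exact exists_mul_eq_of_shift _ (fun i => ⟨_, mul_eq_shift_mul (h_mul_x i j)⟩) ha

theorem exists_del_mul_eq (j : Fin n) {a : WeylAlgebra n} (ha : a ∈ cartan n) :
    ∃ a' ∈ cartan n, del j * a = a' * del j := by
  exact exists_mul_eq_of_shift _ (fun i => ⟨_, mul_eq_shift_mul (h_mul_del' i j)⟩) ha

/-- The power `xⱼ ^ z` for `z ≥ 0` and `∂ⱼ ^ (-z)` for `z < 0`. -/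
def shift (j : Fin n) : ℤ → WeylAlgebra n
  | Int.ofNat p => x j ^ p
  | Int.negSucc p => del j ^ (p + 1)

theorem shift_neg (j : Fin n) (p : ℕ) : shift j (-(p : ℤ)) = del j ^ p := by
  cases p with
  | zero => simp [shift]
  | succ p => rfl

theorem shift_natCast (j : Fin n) (p : ℕ) : shift j (p : ℤ) = x j ^ p := rfl

theorem exists_x_mul_shift (j : Fin n) (z : ℤ) :
    ∃ a ∈ cartan n, x j * shift j z = a * shift j (z + 1) := by
  rcases z with p | p
  · exact ⟨1, one_mem _, by rw [one_mul]; exact (pow_succ' (x j) p).symm⟩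
  · refine ⟨h j - algebraMap ℂ _ (1 / 2),
      sub_mem (h_mem_cartan j) ((cartan n).algebraMap_mem _), ?_⟩
    rw [show Int.negSucc p + 1 = -(p : ℤ) by omega, shift_neg, ← x_mul_del, mul_assoc, ← pow_succ']
    rfl

theorem exists_del_mul_shift (j : Fin n) (z : ℤ) :
    ∃ a ∈ cartan n, del j * shift j z = a * shift j (z - 1) := by
  rcases z with p | p
  · cases p with
    | zero =>
      refine ⟨1, one_mem _, ?_⟩
      have e : shift j (Int.ofNat 0 - 1) = del j := pow_one (del j)
      rw [e, one_mul]
      exact (congrArg (del j * ·) (pow_zero (x j))).trans (mul_one (del j))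
    | succ p =>
      refine ⟨h j + algebraMap ℂ _ (1 / 2),
        add_mem (h_mem_cartan j) ((cartan n).algebraMap_mem _), ?_⟩
      rw [show Int.ofNat (p + 1) - 1 = (p : ℤ) by simp, shift_natCast, ← del_mul_x_self, mul_assoc,
        ← pow_succ']
      rfl
  · refine ⟨1, one_mem _, ?_⟩
    rw [one_mul]
    exact (pow_succ' (del j) (p + 1)).symm

theorem shift_commute {i j : Fin n} (hij : i ≠ j) (z z' : ℤ) : Commute (shift i z) (shift j z') := by
  have hxx : Commute (x i) (x j) := x_comm i j
  have hdd : Commute (del i) (del j) := del_comm i j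
  have hdx : Commute (del i) (x j) := by
    have := del_x i j
    rwa [if_neg hij, add_zero] at this
  have hxd : Commute (x i) (del j) := by
    have := del_x j i
    rw [if_neg hij.symm, add_zero] at this
    exact this.symm
  rcases z with p | p <;> rcases z' with p' | p'
  · exact hxx.pow_pow _ _
  · exact hxd.pow_pow _ _
  · exact hdx.pow_pow _ _
  · exact hdd.pow_pow _ _

theorem h_mul_shift (i j : Fin n) (z : ℤ) :
    h i * shift j z = shift j z * h i + (if i = j then (z : ℂ) else 0) • shift j z := by
  have hx : ∀ p : ℕ, h i * x j ^ p
      = x j ^ p * h i + (if i = j then (p : ℂ) else 0) • x j ^ p := by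
    intro p
    induction p with
    | zero => simp
    | succ p ih =>
      rw [pow_succ, ← mul_assoc, ih, add_mul, mul_assoc, h_mul_x, mul_add, ← mul_assoc,
        mul_smul_comm, smul_mul_assoc, add_assoc, ← add_smul]
      congr 2
      split_ifs <;> push_cast <;> ring
  have hd : ∀ p : ℕ, h i * del j ^ p
      = del j ^ p * h i + (if i = j then (-p : ℂ) else 0) • del j ^ p := by
    intro p
    induction p with
    | zero => simp
    | succ p ih =>
      rw [pow_succ, ← mul_assoc, ih, add_mul, mul_assoc, h_mul_del', mul_add, ← mul_assoc,
        mul_smul_comm, smul_mul_assoc, add_assoc, ← add_smul]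
      congr 2
      split_ifs <;> push_cast <;> ring
  rcases z with p | p
  · exact hx p
  · have := hd (p + 1)
    rw [shift, this]
    congr 3
    push_cast; ring

/-- The monomial `∏ⱼ xⱼ ^ uⱼ`, where negative powers of `xⱼ` stand for powers of `∂ⱼ`. -/
def shiftMonomial (u : Fin n → ℤ) : WeylAlgebra n :=
  Finset.univ.noncommProd (fun j => shift j (u j)) fun _ _ _ _ hij => shift_commute hij _ _

theorem shiftMonomial_zero : shiftMonomial (0 : Fin n → ℤ) = 1 := by
  exact (Finset.noncommProd_eq_pow_card Finset.univ (fun j : Fin n => shift j ((0 : Fin n → ℤ) j))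
    (fun _ _ _ _ hij => shift_commute hij _ _) 1
    fun j _ => pow_zero (x j)).trans (one_pow _)

/-- The monomial without its factor at `j`. -/
def shiftMonomialErase (j : Fin n) (u : Fin n → ℤ) : WeylAlgebra n :=
  (Finset.univ.erase j).noncommProd (fun j => shift j (u j))
    fun _ _ _ _ hij => shift_commute hij _ _

theorem shift_mul_erase (j : Fin n) (u : Fin n → ℤ) :
    shift j (u j) * shiftMonomialErase j u = shiftMonomial u :=
  Finset.mul_noncommProd_erase Finset.univ (Finset.mem_univ j) (fun j => shift j (u j))
    fun _ _ _ _ hij => shift_commute hij _ _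

theorem shiftMonomialErase_congr (j : Fin n) {u v : Fin n → ℤ} (huv : ∀ i, i ≠ j → u i = v i) :
    shiftMonomialErase j u = shiftMonomialErase j v :=
  Finset.noncommProd_congr rfl (fun i hi => by rw [huv i (Finset.ne_of_mem_erase hi)]) _

theorem h_mul_shiftMonomial (j : Fin n) (u : Fin n → ℤ) :
    h j * shiftMonomial u = shiftMonomial u * h j + (u j : ℂ) • shiftMonomial u := by
  have hc : Commute (h j) (shiftMonomialErase j u) := by
    refine Finset.noncommProd_commute _ _ _ _ fun i hi => ?_
    have := h_mul_shift j i (u i)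
    rw [if_neg (Finset.ne_of_mem_erase hi).symm, zero_smul, add_zero] at this
    exact this
  rw [← shift_mul_erase j u, ← mul_assoc, h_mul_shift, if_pos rfl, add_mul, mul_assoc, hc.eq,
    mul_assoc, smul_mul_assoc]

theorem exists_x_mul_shiftMonomial (j : Fin n) (u : Fin n → ℤ) :
    ∃ a ∈ cartan n, x j * shiftMonomial u = a * shiftMonomial (u + Pi.single j 1) := by
  obtain ⟨a, ha, e⟩ := exists_x_mul_shift j (u j)
  refine ⟨a, ha, ?_⟩
  rw [← shift_mul_erase j u, ← shift_mul_erase j (u + Pi.single j 1), ← mul_assoc, e, mul_assoc,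
    shiftMonomialErase_congr j (v := u + Pi.single j 1) fun i hi => by simp [hi]]
  simp

theorem exists_del_mul_shiftMonomial (j : Fin n) (u : Fin n → ℤ) :
    ∃ a ∈ cartan n, del j * shiftMonomial u = a * shiftMonomial (u - Pi.single j 1) := by
  obtain ⟨a, ha, e⟩ := exists_del_mul_shift j (u j)
  refine ⟨a, ha, ?_⟩
  rw [← shift_mul_erase j u, ← shift_mul_erase j (u - Pi.single j 1), ← mul_assoc, e, mul_assoc,
    shiftMonomialErase_congr j (v := u - Pi.single j 1) fun i hi => by simp [hi]]
  simp

/-- The weight space of the Weyl algebra of weight `u`. -/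
def weightSpace (u : Fin n → ℤ) : Submodule ℂ (WeylAlgebra n) :=
  (Subalgebra.toSubmodule (cartan n)).map (LinearMap.mulRight ℂ (shiftMonomial u))

theorem mem_weightSpace {u : Fin n → ℤ} {w : WeylAlgebra n} :
    w ∈ weightSpace u ↔ ∃ a ∈ cartan n, a * shiftMonomial u = w := by
  simp [weightSpace, Submodule.mem_map]

theorem mem_weightSpace_zero {w : WeylAlgebra n} : w ∈ weightSpace 0 ↔ w ∈ cartan n := by
  simp [mem_weightSpace, shiftMonomial_zero]

theorem h_mul_of_mem_weightSpace {u : Fin n → ℤ} {w : WeylAlgebra n} (hw : w ∈ weightSpace u)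
    (j : Fin n) : h j * w = w * h j + (u j : ℂ) • w := by
  obtain ⟨a, ha, rfl⟩ := mem_weightSpace.1 hw
  rw [← mul_assoc, commute_h_of_mem_cartan ha, mul_assoc, h_mul_shiftMonomial, mul_add, mul_assoc,
    mul_smul_comm]

/-- The sum of the weight spaces contains $1$ and is stable under left multiplication by each $x_j$
and $\partial_j$, hence by the algebra that they generate. -/
theorem iSup_weightSpace : ⨆ u : Fin n → ℤ, weightSpace u = (⊤ : Submodule ℂ (WeylAlgebra n)) := by
  have key : ∀ w : WeylAlgebra n, ∀ y ∈ ⨆ u : Fin n → ℤ, weightSpace u,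
      w * y ∈ ⨆ u : Fin n → ℤ, weightSpace u := by
    intro w
    have hw : w ∈ Algebra.adjoin ℂ (Set.range (x (n := n)) ∪ Set.range (del (n := n))) := by
      rw [adjoin_generators]; trivial
    induction hw using Algebra.adjoin_induction with
    | mem w hw =>
      intro y hy
      induction hy using Submodule.iSup_induction' with
      | mem u y hy =>
        obtain ⟨a, ha, rfl⟩ := mem_weightSpace.1 hy
        rcases hw with ⟨j, rfl⟩ | ⟨j, rfl⟩
        · obtain ⟨a', ha', e⟩ := exists_x_mul_eq j ha
          obtain ⟨b, hb, e'⟩ := exists_x_mul_shiftMonomial j u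
          rw [← mul_assoc, e, mul_assoc, e', ← mul_assoc]
          exact Submodule.mem_iSup_of_mem _ (mem_weightSpace.2 ⟨_, mul_mem ha' hb, rfl⟩)
        · obtain ⟨a', ha', e⟩ := exists_del_mul_eq j ha
          obtain ⟨b, hb, e'⟩ := exists_del_mul_shiftMonomial j u
          rw [← mul_assoc, e, mul_assoc, e', ← mul_assoc]
          exact Submodule.mem_iSup_of_mem _ (mem_weightSpace.2 ⟨_, mul_mem ha' hb, rfl⟩)
      | zero => rw [mul_zero]; exact zero_mem _
      | add y z _ _ hy hz => rw [mul_add]; exact add_mem hy hz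
    | algebraMap c =>
      intro y hy
      rw [← Algebra.smul_def]
      exact Submodule.smul_mem _ _ hy
    | add a b _ _ ha hb =>
      intro y hy
      rw [add_mul]
      exact add_mem (ha y hy) (hb y hy)
    | mul a b _ _ ha hb =>
      intro y hy
      rw [mul_assoc]
      exact ha _ (hb y hy)
  refine eq_top_iff.2 fun w _ => ?_
  have := key w 1 (Submodule.mem_iSup_of_mem 0 (mem_weightSpace_zero.2 (one_mem _)))
  rwa [mul_one] at this

/-- A linear functional on a subalgebra containing the `hⱼ` which vanishes on commutators with
the `hⱼ` is determined by its values on the polynomials in the `hⱼ`. -/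
theorem exists_cartan_apply_eq (A : Subalgebra ℂ (WeylAlgebra n)) (hA : ∀ j, h j ∈ A) (w : A) :
    ∃ a ∈ Algebra.adjoin ℂ (Set.range fun j => (⟨h j, hA j⟩ : A)),
      ∀ L : A →ₗ[ℂ] ℂ, (∀ (j : Fin n) (y : A), L (⟨h j, hA j⟩ * y) = L (y * ⟨h j, hA j⟩)) →
        L w = L a := by
  -- Induction on the set of weights that occur. The element `a` is chosen before the functional
  -- `L`, so that the same polynomial in the $h_j$ serves the Fock module and the Verma module.
  have key : ∀ (S : Finset (Fin n → ℤ)) (f : (Fin n → ℤ) → WeylAlgebra n)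
      (_ : ∀ u, f u ∈ weightSpace u) (w : A) (_ : (w : WeylAlgebra n) = ∑ u ∈ S, f u),
      ∃ a ∈ Algebra.adjoin ℂ (Set.range fun j => (⟨h j, hA j⟩ : A)),
        ∀ L : A →ₗ[ℂ] ℂ, (∀ (j : Fin n) (y : A), L (⟨h j, hA j⟩ * y) = L (y * ⟨h j, hA j⟩)) →
          L w = L a := by
    intro S
    induction S using Finset.induction_on with
    | empty =>
      intro f _ w hw
      refine ⟨0, zero_mem _, fun L _ => ?_⟩
      have : w = 0 := Subtype.ext hw
      rw [this]
    | insert u S hu ih =>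
      intro f hf w hw
      rw [Finset.sum_insert hu] at hw
      by_cases hu0 : u = 0
      · subst hu0
        -- The weight-zero component is a polynomial in the $h_j$ and so lies in `A`; it can be
        -- split off without leaving the subalgebra.
        have hmap : (Algebra.adjoin ℂ (Set.range fun j => (⟨h j, hA j⟩ : A))).map A.val
            = cartan n := by
          rw [AlgHom.map_adjoin, ← Set.range_comp]
          rfl
        have h0 : f 0 ∈ (Algebra.adjoin ℂ (Set.range fun j => (⟨h j, hA j⟩ : A))).map A.val := by
          rw [hmap]
          exact mem_weightSpace_zero.1 (hf 0)
        obtain ⟨a₀, ha₀, e₀⟩ := h0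
        obtain ⟨a, ha, hs⟩ := ih f hf (w + (-1 : ℂ) • a₀) (by
          have e₀ : (a₀ : WeylAlgebra n) = f 0 := e₀
          have e : ((w + (-1 : ℂ) • a₀ : A) : WeylAlgebra n)
            = (w : WeylAlgebra n) + (-1 : ℂ) • (a₀ : WeylAlgebra n) := rfl
          rw [e, hw, e₀]
          exact add_add_neg_one_smul _ _)
        refine ⟨a₀ + a, add_mem ha₀ ha, fun L hL => ?_⟩
        have := hs L hL
        rw [map_add, map_smul, smul_eq_mul] at this
        rw [map_add]
        linear_combination this
      -- For a weight $u$ with $u_j\ne0$, the element $w-u_j^{-1}[h_j,w]$ has no component of weight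
      -- $u$, and its component of weight $v$ is $1-v_j/u_j$ times the old one. It remains in `A`,
      -- and `L` has the same value on it as on $w$.
      · obtain ⟨j, hj⟩ : ∃ j, u j ≠ 0 := by
          by_contra hc
          push Not at hc
          exact hu0 (funext hc)
        have hj' : (u j : ℂ) ≠ 0 := by exact_mod_cast hj
        set b : A := ⟨h j, hA j⟩ * w + (-1 : ℂ) • (w * ⟨h j, hA j⟩) with hb
        have hbv : (b : WeylAlgebra n) = (u j : ℂ) • f u + ∑ v ∈ S, (v j : ℂ) • f v := by
          have e : (b : WeylAlgebra n) = h j * w + (-1 : ℂ) • (w * h j) := rfl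
          have e' : h j * (w : WeylAlgebra n)
              = w * h j + ((u j : ℂ) • f u + ∑ v ∈ S, (v j : ℂ) • f v) := by
            rw [hw, mul_add, add_mul, Finset.mul_sum, Finset.sum_mul,
              h_mul_of_mem_weightSpace (hf u),
              Finset.sum_congr rfl fun v _ => h_mul_of_mem_weightSpace (hf v) j,
              Finset.sum_add_distrib, add_add_add_comm]
          rw [e, e']
          exact add_add_neg_one_smul _ _
        obtain ⟨a, ha, hs⟩ := ih (fun v => (1 + -(u j : ℂ)⁻¹ * (v j : ℂ)) • f v)
          (fun v => Submodule.smul_mem _ _ (hf v)) (w + (-(u j : ℂ)⁻¹) • b) (by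
            have e : ((w + (-(u j : ℂ)⁻¹) • b : A) : WeylAlgebra n)
              = (w : WeylAlgebra n) + (-(u j : ℂ)⁻¹) • (b : WeylAlgebra n) := rfl
            have e0 : f u + (-(u j : ℂ)⁻¹) • (u j : ℂ) • f u = 0 := by
              have := add_smul_smul_eq (f u) (-(u j : ℂ)⁻¹) (u j : ℂ)
              rw [this, neg_mul, inv_mul_cancel₀ hj', add_neg_cancel, zero_smul]
            rw [e, hbv, hw, smul_add, add_add_add_comm, e0, zero_add, Finset.smul_sum,
              ← Finset.sum_add_distrib]
            exact Finset.sum_congr rfl fun v _ => add_smul_smul_eq _ _ _)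
        refine ⟨a, ha, fun L hL => ?_⟩
        rw [← hs L hL, map_add, map_smul, hb, map_add, map_smul, hL, smul_eq_mul, smul_eq_mul]
        ring
  have hw : (w : WeylAlgebra n) ∈ ⨆ u : Fin n → ℤ, weightSpace u := by
    rw [iSup_weightSpace]; trivial
  obtain ⟨f, hf, e⟩ := (Submodule.mem_iSup_iff_exists_finsupp _ _).1 hw
  exact key f.support f hf w e.symm

end WeylAlgebra

end

noncomputable section

/-! ## Diagonal matrix coefficients -/

/-- Two representations are treated at once because the polynomial must be common to both: monomials
in the $y_j$ need not be independent, so separate choices could differ. -/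
theorem exists_polynomial_of_mem_adjoin {n : ℕ} {A : Type*} [Semiring A] [Algebra ℂ A]
    (y : Fin n → A) {a : A} (ha : a ∈ Algebra.adjoin ℂ (Set.range y)) {M N : Type*}
    [AddCommGroup M] [Module ℂ M] [AddCommGroup N] [Module ℂ N]
    (ρ : A →ₐ[ℂ] Module.End ℂ M) (ρ' : A →ₐ[ℂ] Module.End ℂ N) :
    ∃ f : MvPolynomial (Fin n) ℂ,
      (∀ (e : M) (η : Fin n → ℂ), (∀ j, ρ (y j) e = η j • e) → ρ a e = MvPolynomial.eval η f • e) ∧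
      (∀ (e : N) (η : Fin n → ℂ), (∀ j, ρ' (y j) e = η j • e) →
        ρ' a e = MvPolynomial.eval η f • e) := by
  induction ha using Algebra.adjoin_induction with
  | mem z hz =>
    obtain ⟨i, rfl⟩ := hz
    exact ⟨MvPolynomial.X i, fun e η h => by rw [h, MvPolynomial.eval_X],
      fun e η h => by rw [h, MvPolynomial.eval_X]⟩
  | algebraMap c =>
    exact ⟨MvPolynomial.C c,
      fun e η _ => by rw [AlgHom.commutes, MvPolynomial.eval_C]; rfl,
      fun e η _ => by rw [AlgHom.commutes, MvPolynomial.eval_C]; rfl⟩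
  | add a b _ _ ha hb =>
    obtain ⟨f, f1, f2⟩ := ha
    obtain ⟨g, g1, g2⟩ := hb
    refine ⟨f + g, fun e η h => ?_, fun e η h => ?_⟩
    · rw [map_add, LinearMap.add_apply, f1 e η h, g1 e η h, map_add, add_smul]
    · rw [map_add, LinearMap.add_apply, f2 e η h, g2 e η h, map_add, add_smul]
  | mul a b _ _ ha hb =>
    obtain ⟨f, f1, f2⟩ := ha
    obtain ⟨g, g1, g2⟩ := hb
    refine ⟨f * g, fun e η h => ?_, fun e η h => ?_⟩
    · rw [map_mul, Module.End.mul_apply, g1 e η h, map_smul, f1 e η h, map_mul, smul_smul, mul_comm]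
    · rw [map_mul, Module.End.mul_apply, g2 e η h, map_smul, f2 e η h, map_mul, smul_smul, mul_comm]

theorem repr_apply_of_eigenbasis {M κ : Type*} [AddCommGroup M] [Module ℂ M]
    (v : Module.Basis κ ℂ M) (H : Module.End ℂ M) (η : κ → ℂ) (hH : ∀ c, H (v c) = η c • v c)
    (y : M) (c : κ) : v.repr (H y) c = η c * v.repr y c := by
  classical
  have : (v.coord c) ∘ₗ H = η c • v.coord c := by
    refine v.ext fun c' => ?_
    simp only [LinearMap.comp_apply, hH, map_smul, LinearMap.smul_apply, Module.Basis.coord_apply,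
      Module.Basis.repr_self, smul_eq_mul]
    by_cases h : c' = c
    · rw [h]
    · rw [Finsupp.single_eq_of_ne (Ne.symm h), mul_zero, mul_zero]
  exact congrArg (fun L : M →ₗ[ℂ] ℂ => L y) this

/-- A diagonal operator multiplies a diagonal entry by the same eigenvalue from either side. -/
theorem repr_commutator {A M κ ι : Type*} [Semiring A] [Algebra ℂ A]
    [AddCommGroup M] [Module ℂ M] (ρ : A →ₐ[ℂ] Module.End ℂ M) (v : Module.Basis κ ℂ M) (z : ι → A)
    (η : κ → ι → ℂ) (hη : ∀ c j, ρ (z j) (v c) = η c j • v c) (j : ι) (y : A) (c : κ) :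
    v.repr (ρ (z j * y) (v c)) c = v.repr (ρ (y * z j) (v c)) c := by
  rw [map_mul, map_mul, Module.End.mul_apply, Module.End.mul_apply, hη, map_smul, map_smul,
    Finsupp.smul_apply, smul_eq_mul,
    repr_apply_of_eigenbasis v (ρ (z j)) (fun c => η c j) (fun c => hη c j)]

namespace WeylAlgebra

variable {n : ℕ}

theorem fock_h_monomial (j : Fin n) (u : Fin n →₀ ℕ) :
    fock (h j) (MvPolynomial.monomial u (1 : ℂ))
      = ((u j : ℂ) + 1 / 2) • MvPolynomial.monomial u (1 : ℂ) := by
  have h1 : fock (x j * del j) (MvPolynomial.monomial u (1 : ℂ))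
      = (u j : ℂ) • MvPolynomial.monomial u (1 : ℂ) := by
    rw [map_mul, Module.End.mul_apply, fock, lift_x, lift_del]
    simp only [Derivation.coeFn_coe, LinearMap.mulLeft_apply, MvPolynomial.pderiv_monomial, one_mul]
    rw [MvPolynomial.X, MvPolynomial.monomial_mul, one_mul, MvPolynomial.smul_monomial, smul_eq_mul,
      mul_one]
    by_cases hu : u j = 0
    · simp [hu]
    · congr 2
      ext i
      by_cases hij : i = j
      · subst hij; simp; omega
      · simp [Finsupp.single_eq_of_ne hij]
  rw [h, map_add, LinearMap.add_apply, h1, AlgHom.commutes, add_smul]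
  rfl

/-- The bridge between the two traces: the polynomial read off from the Fock module also gives the
diagonal entries in any other module with an eigenbasis of the $h_j$. -/
theorem exists_polynomial_diag (A : Subalgebra ℂ (WeylAlgebra n)) (hA : ∀ j, h j ∈ A) (w : A)
    {M κ : Type*} [AddCommGroup M] [Module ℂ M] (ρ : A →ₐ[ℂ] Module.End ℂ M)
    (v : Module.Basis κ ℂ M) (η : κ → Fin n → ℂ) (hη : ∀ c j, ρ ⟨h j, hA j⟩ (v c) = η c j • v c) :
    ∃ f : MvPolynomial (Fin n) ℂ,
      (∀ u : Fin n →₀ ℕ, MvPolynomial.coeff u (fock (w : WeylAlgebra n)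
        (MvPolynomial.monomial u 1)) = MvPolynomial.eval (fun j => (u j : ℂ) + 1 / 2) f) ∧
      ∀ c, v.repr (ρ w (v c)) c = MvPolynomial.eval (η c) f := by
  obtain ⟨a, ha, hs⟩ := exists_cartan_apply_eq A hA w
  set ρ₀ : A →ₐ[ℂ] Module.End ℂ (MvPolynomial (Fin n) ℂ) := fock.comp A.val
  obtain ⟨f, f1, f2⟩ := exists_polynomial_of_mem_adjoin _ ha ρ₀ ρ
  have hmon : ∀ (u : Fin n →₀ ℕ) (j : Fin n), ρ₀ ⟨h j, hA j⟩
      (MvPolynomial.basisMonomials (Fin n) ℂ u)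
      = ((u j : ℂ) + 1 / 2) • MvPolynomial.basisMonomials (Fin n) ℂ u := by
    intro u j
    rw [MvPolynomial.coe_basisMonomials]
    exact fock_h_monomial j u
  refine ⟨f, fun u => ?_, fun c => ?_⟩
  · have h0 := hs (MvPolynomial.lcoeff ℂ u ∘ₗ
      LinearMap.applyₗ (MvPolynomial.monomial u (1 : ℂ)) ∘ₗ ρ₀.toLinearMap) (fun j y =>
        repr_commutator ρ₀ (MvPolynomial.basisMonomials (Fin n) ℂ) (fun j => ⟨h j, hA j⟩)
          (fun u j => (u j : ℂ) + 1 / 2) hmon j y u)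
    have h1 := f1 (MvPolynomial.basisMonomials (Fin n) ℂ u) _ (hmon u)
    rw [MvPolynomial.coe_basisMonomials] at h1
    refine Eq.trans h0 ?_
    change MvPolynomial.coeff u (ρ₀ a (MvPolynomial.monomial u (1 : ℂ))) = _
    rw [h1, MvPolynomial.coeff_smul, MvPolynomial.coeff_monomial, if_pos rfl, smul_eq_mul, mul_one]
  · have h0 := hs (v.coord c ∘ₗ LinearMap.applyₗ (v c) ∘ₗ ρ.toLinearMap) (fun j y =>
      repr_commutator ρ v (fun j => ⟨h j, hA j⟩) η hη j y c)
    have h1 := f2 (v c) _ (hη c)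
    refine Eq.trans h0 ?_
    change v.repr (ρ a (v c)) c = _
    rw [h1, map_smul, Finsupp.smul_apply, Module.Basis.repr_self, Finsupp.single_eq_same,
      smul_eq_mul, mul_one]

end WeylAlgebra

/-! ## The analytic continuation of the twisted trace -/

/-- The complement of a countable set in a real vector space of dimension greater than one is
connected. -/
theorem isPreconnected_sechDomain : IsPreconnected sechDomain := by
  have hc : sechDomainᶜ.Countable := by
    refine (Set.countable_range fun l : ℤ => (-((2 * l + 1) / 2 * Complex.I) : ℂ)).mono ?_
    intro z hz
    have hz : Complex.cosh (Real.pi * z) = 0 := not_not.1 hz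
    obtain ⟨l, rfl⟩ := cosh_pi_eq_zero_iff.1 hz
    exact ⟨l, rfl⟩
  have := (hc.isConnected_compl_of_one_lt_rank (by simp)).isPreconnected
  rwa [compl_compl] at this

theorem traceDomain_eq_pi (n : ℕ) : traceDomain n = Set.univ.pi fun _ => sechDomain := by
  ext b
  simp [traceDomain, sechDomain]

theorem isPreconnected_traceDomain (n : ℕ) : IsPreconnected (traceDomain n) := by
  rw [traceDomain_eq_pi]
  exact isPreconnected_univ_pi fun _ => isPreconnected_sechDomain

theorem mem_traceDomain_of_re_neg {n : ℕ} {b : Fin n → ℂ} (hb : ∀ j, (b j).re < 0) :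
    b ∈ traceDomain n := fun j => cosh_pi_ne_zero_of_re_ne_zero (hb j).ne

/-- The identity theorem: both functions agree with the sum on the open set where all
$\operatorname{Re}b_j<0$, and the domain is connected. Hence the choice made in `weylTrace` does not
matter there. -/
theorem IsWeylTrace.eqOn {n : ℕ} {ζ : Fin n → ℝ} {w : WeylAlgebra n} {F G : (Fin n → ℂ) → ℂ}
    (hF : IsWeylTrace ζ w F) (hG : IsWeylTrace ζ w G) : Set.EqOn F G (traceDomain n) := by
  have hneg : ∀ j : Fin n, ((-1 : Fin n → ℂ) j).re < 0 := fun j => by simp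
  refine hF.1.eqOn_of_preconnected_of_eventuallyEq hG.1 (isPreconnected_traceDomain n)
    (mem_traceDomain_of_re_neg hneg) ?_
  have hopen : IsOpen {b : Fin n → ℂ | ∀ j, (b j).re < 0} := by
    simp only [Set.ofPred_forall]
    exact isOpen_iInter_of_finite fun j =>
      isOpen_lt (Complex.continuous_re.comp (continuous_apply j)) continuous_const
  filter_upwards [hopen.mem_nhds hneg] with b hb
  exact (hF.2 b hb).unique (hG.2 b hb)

theorem IsWeylTrace.weylTrace_eq {n : ℕ} {ζ : Fin n → ℝ} {w : WeylAlgebra n} {F : (Fin n → ℂ) → ℂ}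
    (hF : IsWeylTrace ζ w F) {b : Fin n → ℂ} (hb : b ∈ traceDomain n) : weylTrace ζ w b = F b := by
  have hex : ∃ F, IsWeylTrace ζ w F := ⟨F, hF⟩
  rw [weylTrace, dif_pos hex]
  exact hex.choose_spec.eqOn hF hb

/-- A monomial of $f$ makes the sum over $u$ a product of one-variable series, each of which is a
`sechDeriv`, analytic off the poles. -/
theorem isWeylTrace_of_polynomial {n : ℕ} (ζ : Fin n → ℝ) (w : WeylAlgebra n)
    (f : MvPolynomial (Fin n) ℂ)
    (hf : ∀ u : Fin n →₀ ℕ, MvPolynomial.coeff u (WeylAlgebra.fock w (MvPolynomial.monomial u 1))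
      = MvPolynomial.eval (fun j => (u j : ℂ) + 1 / 2) f) :
    IsWeylTrace ζ w fun b => Complex.exp (2 * Real.pi * fiChar ζ b)
      * ∑ p ∈ f.support, f.coeff p * ∏ j, sechDeriv (p j) (b j) := by
  constructor
  · have hfi : AnalyticOnNhd ℂ (fun b => Complex.exp (2 * Real.pi * fiChar ζ b))
        (traceDomain n) := by
      intro b _
      have h2 : AnalyticAt ℂ (fun b : Fin n → ℂ => 2 * Real.pi * fiChar ζ b) b := by
        unfold fiChar
        refine analyticAt_const.mul (analyticAt_const.mul
          (Finset.analyticAt_fun_sum _ fun j _ => analyticAt_const.mul ?_))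
        exact (ContinuousLinearMap.proj (R := ℂ) (φ := fun _ : Fin n => ℂ) j).analyticAt b
      exact h2.cexp
    refine hfi.mul (Finset.analyticOnNhd_fun_sum _ fun p _ => analyticOnNhd_const.mul
      (Finset.analyticOnNhd_fun_prod _ fun j _ => ?_))
    intro b hb
    exact AnalyticAt.comp (f := fun b : Fin n → ℂ => b j)
      (analyticOnNhd_sechDeriv (p j) (b j) (hb j))
      ((ContinuousLinearMap.proj (R := ℂ) (φ := fun _ : Fin n => ℂ) j).analyticAt b)
  · intro b hb
    rw [← Finsupp.equivFunOnFinite.symm.hasSum_iff]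
    have h1 : ∀ p : Fin n →₀ ℕ, HasSum (fun u : Fin n → ℕ => ∏ j, ((-1) ^ u j
        * ((u j : ℂ) + 1 / 2) ^ p j * Complex.exp (2 * Real.pi * b j * (u j + 1 / 2))))
        (∏ j, sechDeriv (p j) (b j)) := fun p =>
      (hasSum_pi_prod (fun j (c : ℕ) => (-1) ^ c * ((c : ℂ) + 1 / 2) ^ p j
        * Complex.exp (2 * Real.pi * b j * (c + 1 / 2))) _
        (fun j => hasSum_sechDeriv_of_re_neg (p j) (b j) (hb j)) fun j => by
          simp only [norm_term_sechDeriv]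
          have := hb j
          have hpi := Real.two_pi_pos
          convert summable_pow_mul_exp_half (p j) (a := -(2 * Real.pi * (b j).re)) (by nlinarith)
            using 4
          ring).1
    refine ((hasSum_sum fun p (_ : p ∈ f.support) => (h1 p).mul_left (f.coeff p)).mul_left
      (Complex.exp (2 * Real.pi * fiChar ζ b))).of_eq (fun u => ?_) rfl
    simp only [Function.comp_apply, fockDiag, hf, MvPolynomial.eval_eq',
      Finsupp.equivFunOnFinite_symm_apply_apply]
    rw [mul_add, Complex.exp_add, Finset.mul_sum (s := Finset.univ), Complex.exp_sum,
      Finset.mul_sum, Finset.mul_sum]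
    refine Finset.sum_congr rfl fun p _ => ?_
    rw [Finset.prod_mul_distrib, Finset.prod_mul_distrib, Finset.prod_pow_eq_pow_sum]
    have : ∀ j, Complex.exp (2 * Real.pi * (b j * ((u j : ℂ) + 1 / 2)))
        = Complex.exp (2 * Real.pi * b j * ((u j : ℂ) + 1 / 2)) := fun j => by
      rw [mul_assoc (2 * (Real.pi : ℂ))]
    simp only [this]
    ring

end

noncomputable section

/-! ## Complementary minors -/

section Complementary

variable {n k d : ℕ} {I : Fin d ↪o Fin n} {J : Fin k ↪o Fin n}

/-- The decomposition of the index set given by two complementary subsets. -/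
def complEquiv (hIJ : IsCompl (Set.range I) (Set.range J)) : Fin d ⊕ Fin k ≃ Fin n :=
  Equiv.ofBijective (Sum.elim I J) <| by
    constructor
    · refine I.injective.sumElim J.injective fun t a h => ?_
      exact Set.disjoint_left.1 hIJ.disjoint ⟨t, rfl⟩ ⟨a, h.symm⟩
    · intro j
      have : j ∈ Set.range I ⊔ Set.range J := by
        rw [hIJ.sup_eq_top]; trivial
      rcases this with ⟨t, rfl⟩ | ⟨a, rfl⟩
      · exact ⟨Sum.inl t, rfl⟩
      · exact ⟨Sum.inr a, rfl⟩

theorem complEquiv_symm_left (hIJ : IsCompl (Set.range I) (Set.range J)) (t : Fin d) :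
    (complEquiv hIJ).symm (I t) = Sum.inl t :=
  (Equiv.symm_apply_eq _).2 rfl

theorem complEquiv_symm_right (hIJ : IsCompl (Set.range I) (Set.range J)) (a : Fin k) :
    (complEquiv hIJ).symm (J a) = Sum.inr a :=
  (Equiv.symm_apply_eq _).2 rfl

theorem forall_complEquiv (hIJ : IsCompl (Set.range I) (Set.range J)) {p : Fin n → Prop}
    (h1 : ∀ t, p (I t)) (h2 : ∀ a, p (J a)) (j : Fin n) : p j := by
  obtain ⟨s, rfl⟩ := (complEquiv hIJ).surjective j
  rcases s with t | a
  · exact h1 t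
  · exact h2 a

theorem sum_complEquiv (hIJ : IsCompl (Set.range I) (Set.range J)) {M : Type*} [AddCommMonoid M]
    (f : Fin n → M) : ∑ j, f j = ∑ t, f (I t) + ∑ a, f (J a) := by
  rw [← (complEquiv hIJ).sum_comp, Fintype.sum_sum_type]
  rfl

theorem prod_complEquiv (hIJ : IsCompl (Set.range I) (Set.range J)) {M : Type*} [CommMonoid M]
    (f : Fin n → M) : ∏ j, f j = (∏ t, f (I t)) * ∏ a, f (J a) := by
  rw [← (complEquiv hIJ).prod_comp, Fintype.prod_sum_type]
  rfl

end Complementary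

namespace AbelianGaugeTheory

open WeylAlgebra

variable {n k d : ℕ} (T : AbelianGaugeTheory n k d) {I : Fin d ↪o Fin n} {J : Fin k ↪o Fin n}

theorem transpose_Q_mul_P : T.Qᵀ * T.P = 0 := by
  refine Matrix.mulVec_injective (funext fun u => ?_)
  rw [← Matrix.mulVec_mulVec, Matrix.zero_mulVec]
  exact (T.exact _).2 ⟨u, rfl⟩

/-- It suffices that $Q_J^T$ is onto over $\mathbb Z$. A preimage $v$ of $w$ under $Q^T$ can be
corrected by an element of $\operatorname{im}P\subseteq\ker Q^T$ that agrees with $v$ on $I$, since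
$P_I$ is invertible; the corrected vector is supported on $J$. -/
theorem isUnit_det_minorQ (hIJ : IsCompl (Set.range I) (Set.range J))
    (hI : IsUnit (T.minorP I).det) : IsUnit (T.minorQ J).det := by
  rw [← Matrix.det_transpose, ← Matrix.isUnit_iff_isUnit_det, ← Matrix.mulVec_surjective_iff_isUnit]
  intro w
  obtain ⟨v, hv⟩ := T.surjective w
  obtain ⟨u, hu⟩ := Matrix.mulVec_surjective_iff_isUnit.2
    ((Matrix.isUnit_iff_isUnit_det _).2 hI) (fun t => v (I t))
  have hv' : T.Qᵀ *ᵥ (v - T.P *ᵥ u) = w := by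
    rw [Matrix.mulVec_sub, Matrix.mulVec_mulVec, T.transpose_Q_mul_P, Matrix.zero_mulVec, sub_zero]
    exact hv
  have hvI : ∀ t, (v - T.P *ᵥ u) (I t) = 0 := fun t => by
    rw [Pi.sub_apply, sub_eq_zero]
    exact (congrFun hu t).symm
  refine ⟨fun a => (v - T.P *ᵥ u) (J a), ?_⟩
  rw [← hv']
  ext b
  have h1 := sum_complEquiv hIJ fun j => T.Q j b * (v - T.P *ᵥ u) j
  simp only [hvI, mul_zero, Finset.sum_const_zero, zero_add] at h1
  exact h1.symm

theorem R_apply_self (hI : IsUnit (T.minorP I).det) (t t' : Fin d) :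
    T.R I (I t) t' = if t = t' then 1 else 0 := by
  have := congrFun (congrFun (Matrix.mul_nonsing_inv (T.minorP I) hI) t) t'
  rwa [Matrix.one_apply] at this

theorem dualR_apply_self (hJ : IsUnit (T.minorQ J).det) (a a' : Fin k) :
    T.dualR J (J a) a' = if a = a' then 1 else 0 := by
  have := congrFun (congrFun (Matrix.mul_nonsing_inv (T.minorQ J) hJ) a) a'
  rwa [Matrix.one_apply] at this

/-- From $Q^TP=0$ one gets $(R^!_J)^TR_I=0$. As $R_I$ is the identity on the rows $I$ and $R^!_J$ on
the rows $J$, only two entries survive in each coefficient. -/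
theorem R_apply_compl (hIJ : IsCompl (Set.range I) (Set.range J)) (hI : IsUnit (T.minorP I).det)
    (t : Fin d) (a : Fin k) : T.R I (J a) t = -T.dualR J (I t) a := by
  have hJ := T.isUnit_det_minorQ hIJ hI
  have h0 : (T.dualR J)ᵀ * T.R I = 0 := by
    rw [dualR, R, Matrix.transpose_mul, Matrix.mul_assoc, ← Matrix.mul_assoc T.Qᵀ,
      T.transpose_Q_mul_P, Matrix.zero_mul, Matrix.mul_zero]
  have h1 := congrFun (congrFun h0 a) t
  rw [Matrix.mul_apply, sum_complEquiv hIJ] at h1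
  simp only [Matrix.transpose_apply, T.R_apply_self hI, T.dualR_apply_self hJ] at h1
  simp at h1
  linarith

theorem massCoord_eq (hIJ : IsCompl (Set.range I) (Set.range J)) (hI : IsUnit (T.minorP I).det)
    (m : Fin n → ℝ) (t : Fin d) :
    T.massCoord m I t = m (I t) - ∑ a, (T.dualR J (I t) a : ℝ) * m (J a) := by
  have h1 : T.massCoord m I t = ∑ j, (T.R I j t : ℝ) * m j := by
    rw [massCoord, Matrix.mulVec_mulVec, ← Matrix.transpose_mul]
    simp only [Matrix.mulVec, dotProduct, Matrix.transpose_apply]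
    refine Finset.sum_congr rfl fun j _ => ?_
    congr 1
    rw [R, Matrix.mul_apply, Matrix.mul_apply]
    push_cast
    rfl
  rw [h1, sum_complEquiv hIJ]
  simp only [T.R_apply_self hI, T.R_apply_compl hIJ hI]
  simp [sub_eq_add_neg]

theorem fiCoord_eq (ζ : Fin n → ℝ) (a : Fin k) :
    T.fiCoord ζ J a = ∑ j, (T.dualR J j a : ℝ) * ζ j := by
  rw [fiCoord, Matrix.mulVec_mulVec, ← Matrix.transpose_mul]
  simp only [Matrix.mulVec, dotProduct, Matrix.transpose_apply]
  refine Finset.sum_congr rfl fun j _ => ?_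
  congr 1
  rw [dualR, Matrix.mul_apply, Matrix.mul_apply]
  push_cast
  rfl

theorem pointOf_right (hJ : IsUnit (T.minorQ J).det) (m : Fin n → ℝ) (y : Fin k → ℂ) (a : Fin k) :
    T.pointOf m J y (J a) = y a := by
  simp only [pointOf, Pi.add_apply, Matrix.mulVec, dotProduct, Matrix.map_apply,
    T.dualR_apply_self hJ]
  simp

theorem pointOf_left (hIJ : IsCompl (Set.range I) (Set.range J)) (hI : IsUnit (T.minorP I).det)
    (m : Fin n → ℝ) (y : Fin k → ℂ) (t : Fin d) :
    T.pointOf m J y (I t) = T.massCoord m I t + ∑ a, (T.dualR J (I t) a : ℂ) * y a := by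
  rw [T.massCoord_eq hIJ hI]
  simp only [pointOf, Pi.add_apply, Matrix.mulVec, dotProduct, Matrix.map_apply, mul_sub,
    Finset.sum_sub_distrib]
  push_cast
  ring

theorem fiChar_pointOf (m ζ : Fin n → ℝ) (y : Fin k → ℂ) :
    fiChar ζ (T.pointOf m J y) = fiChar ζ (fun j => (m j : ℂ))
      + Complex.I * ∑ a, (T.fiCoord ζ J a : ℂ) * (y a - m (J a)) := by
  simp only [fiChar, pointOf, Pi.add_apply, mul_add, Finset.sum_add_distrib, Matrix.mulVec,
    dotProduct, Matrix.map_apply, T.fiCoord_eq]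
  congr 2
  simp only [Finset.mul_sum]
  rw [Finset.sum_comm]
  refine Finset.sum_congr rfl fun a _ => ?_
  push_cast
  rw [Finset.sum_mul]
  exact Finset.sum_congr rfl fun j _ => by ring

/-! ## Weights of Verma modules -/

theorem toHiggs_shiftedMoment (ζ : Fin n → ℝ) (b : Fin n → ℂ) :
    T.toHiggs ζ ⟨shiftedMoment ζ b, T.shiftedMoment_mem_invariants ζ b⟩
      = ∑ j, b j • T.hHiggs ζ j + algebraMap ℂ _ (fiChar ζ b) := by
  have e : (⟨shiftedMoment ζ b, T.shiftedMoment_mem_invariants ζ b⟩ : T.invariants)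
      = ∑ j, b j • (⟨h j, T.h_mem_invariants j⟩ : T.invariants)
        + algebraMap ℂ _ (fiChar ζ b) := by
    apply Subtype.ext
    change shiftedMoment ζ b = T.invariants.val (∑ j, b j • (⟨h j, T.h_mem_invariants j⟩ :
      T.invariants) + algebraMap ℂ _ (fiChar ζ b))
    rw [map_add, map_sum, AlgHom.commutes]
    rfl
  rw [e, map_add, map_sum, AlgHom.commutes]
  simp only [map_smul]
  rfl

theorem toHiggs_shiftedMoment_gauge (ζ : Fin n → ℝ) (X : Fin k → ℂ) :
    T.toHiggs ζ ⟨shiftedMoment ζ (T.Q.map (fun q : ℤ => (q : ℂ)) *ᵥ X),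
      T.shiftedMoment_mem_invariants ζ _⟩ = 0 := by
  rw [← map_zero (T.toHiggs ζ)]
  refine RingQuot.mkAlgHom_rel ℂ ?_
  change _ - _ ∈ T.momentIdeal ζ
  rw [ZeroMemClass.coe_zero]
  have e := sub_zero (shiftedMoment ζ (T.Q.map (fun q : ℤ => (q : ℂ)) *ᵥ X))
  rw [e]
  exact Submodule.subset_span ⟨X, rfl⟩

/-- The moment map relation for the gauge direction given by column $a$ of $R^!_J$. Among the rows
in $J$ this column is nonzero only at $J(a)$, so the relation can be solved for $h_{J(a)}$ in terms
of the $h_{I(t)}$; this fixes all weights of a Verma module. -/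
theorem sum_dualR_smul_hHiggs (ζ : Fin n → ℝ) (a : Fin k) :
    ∑ j, (T.dualR J j a : ℂ) • T.hHiggs ζ j
      + algebraMap ℂ _ (Complex.I * T.fiCoord ζ J a) = 0 := by
  have h1 := T.toHiggs_shiftedMoment_gauge ζ fun b => (((T.minorQ J)⁻¹ b a : ℤ) : ℂ)
  rw [toHiggs_shiftedMoment] at h1
  have h2 : ∀ j, (T.Q.map (fun q : ℤ => (q : ℂ)) *ᵥ fun b => (((T.minorQ J)⁻¹ b a : ℤ) : ℂ)) j
      = (T.dualR J j a : ℂ) := by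
    intro j
    rw [dualR, Matrix.mul_apply]
    push_cast
    rfl
  have h3 : fiChar ζ (T.Q.map (fun q : ℤ => (q : ℂ)) *ᵥ fun b => (((T.minorQ J)⁻¹ b a : ℤ) : ℂ))
      = Complex.I * T.fiCoord ζ J a := by
    rw [fiChar, T.fiCoord_eq]
    simp only [h2]
    push_cast
    congr 1
    exact Finset.sum_congr rfl fun j _ => mul_comm _ _
  rw [h3] at h1
  simp only [h2] at h1
  exact h1

/-- The eigenvalue of `hⱼ` on the basis vector `v c` of the Verma module. -/
def vermaWeight (hIJ : IsCompl (Set.range I) (Set.range J)) (m ζ : Fin n → ℝ) (c : Fin d → ℕ)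
    (j : Fin n) : ℂ :=
  Sum.elim (fun t => -(T.massSign m I t : ℂ) * ((c t : ℂ) + 1 / 2))
    (fun a => -(Complex.I * T.fiCoord ζ J a - ∑ t, (T.massSign m I t : ℂ) * T.dualR J (I t) a
      * ((c t : ℂ) + 1 / 2))) ((complEquiv hIJ).symm j)

theorem vermaWeight_left (hIJ : IsCompl (Set.range I) (Set.range J)) (m ζ : Fin n → ℝ)
    (c : Fin d → ℕ) (t : Fin d) :
    T.vermaWeight hIJ m ζ c (I t) = -(T.massSign m I t : ℂ) * ((c t : ℂ) + 1 / 2) := by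
  rw [vermaWeight, complEquiv_symm_left]; rfl

theorem vermaWeight_right (hIJ : IsCompl (Set.range I) (Set.range J)) (m ζ : Fin n → ℝ)
    (c : Fin d → ℕ) (a : Fin k) :
    T.vermaWeight hIJ m ζ c (J a) = -(Complex.I * T.fiCoord ζ J a
      - ∑ t, (T.massSign m I t : ℂ) * T.dualR J (I t) a * ((c t : ℂ) + 1 / 2)) := by
  rw [vermaWeight, complEquiv_symm_right]; rfl

theorem IsVermaBasis.hHiggs_smul {T : AbelianGaugeTheory n k d}
    (hIJ : IsCompl (Set.range I) (Set.range J))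
    (hI : IsUnit (T.minorP I).det) {m ζ : Fin n → ℝ} {M : Type*} [AddCommGroup M] [Module ℂ M]
    [Module (T.Higgs ζ) M] [IsScalarTower ℂ (T.Higgs ζ) M] {v : Module.Basis (Fin d → ℕ) ℂ M}
    (hv : T.IsVermaBasis m ζ I v) (c : Fin d → ℕ) (j : Fin n) :
    T.hHiggs ζ j • v c = T.vermaWeight hIJ m ζ c j • v c := by
  have hJ := T.isUnit_det_minorQ hIJ hI
  revert j
  refine forall_complEquiv hIJ (fun t => ?_) fun a => ?_
  · rw [T.vermaWeight_left]; exact hv.eigen c t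
  · have h1 := congrArg (fun y => y • v c) (T.sum_dualR_smul_hHiggs (J := J) ζ a)
    simp only [add_smul, Finset.sum_smul, smul_assoc, algebraMap_smul, zero_smul] at h1
    rw [sum_complEquiv hIJ] at h1
    simp only [hv.eigen, T.dualR_apply_self hJ] at h1
    have h2 : ∑ b, (((if b = a then 1 else 0 : ℤ) : ℂ)) • T.hHiggs ζ (J b) • v c
        = T.hHiggs ζ (J a) • v c := by
      rw [Finset.sum_eq_single a (fun b _ hb => by simp [hb]) (fun h => absurd (Finset.mem_univ a) h)]
      simp
    rw [h2] at h1
    simp only [smul_smul, ← Finset.sum_smul] at h1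
    rw [add_right_comm, ← add_smul, add_comm, add_eq_zero_iff_eq_neg, ← neg_smul] at h1
    rw [h1, T.vermaWeight_right]
    congr 2
    rw [add_comm, sub_eq_add_neg, ← Finset.sum_neg_distrib]
    congr 1
    exact Finset.sum_congr rfl fun t _ => by ring

end AbelianGaugeTheory

end

noncomputable section

/-! ## Signs and fourth roots of unity -/

theorem zpow_finset_sum {ι : Type*} {a : ℂ} (ha : a ≠ 0) (s : Finset ι) (f : ι → ℤ) :
    a ^ (∑ i ∈ s, f i) = ∏ i ∈ s, a ^ f i := by
  classical
  induction s using Finset.induction_on with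
  | empty => simp
  | insert i s hi ih => rw [Finset.sum_insert hi, Finset.prod_insert hi, zpow_add₀ ha, ih]

theorem neg_I_ne_zero : -Complex.I ≠ 0 := neg_ne_zero.2 Complex.I_ne_zero

theorem neg_I_zpow_congr {x y : ℤ} (hxy : 4 ∣ x - y) : (-Complex.I) ^ x = (-Complex.I) ^ y := by
  obtain ⟨q, hq⟩ := hxy
  have h4 : (-Complex.I) ^ (4 : ℤ) = 1 := by
    have : (-Complex.I) ^ (4 : ℤ) = (-Complex.I) ^ 4 := by norm_cast
    rw [this, neg_pow, Complex.I_pow_four]; norm_num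
  rw [show x = y + 4 * q by omega, zpow_add₀ neg_I_ne_zero, zpow_mul, h4, one_zpow, mul_one]

theorem sign_eq_neg_I_zpow {τ : ℤ} (hτ : τ = 1 ∨ τ = -1) : (τ : ℂ) = (-Complex.I) ^ (1 - τ) := by
  rcases hτ with rfl | rfl
  · simp
  · have : (-Complex.I) ^ (1 - (-1) : ℤ) = (-Complex.I) ^ 2 := by norm_cast
    rw [this, neg_sq, Complex.I_sq]; simp

theorem neg_one_zpow_congr {x y : ℤ} (hxy : Even (x - y)) : (-1 : ℂ) ^ x = (-1) ^ y := by
  rw [show x = y + (x - y) by ring, zpow_add₀ (by norm_num), hxy.neg_one_zpow, mul_one]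

/-- With this, and with signs $\tau=(-i)^{1-\tau}$, every root of unity in the formula becomes a
power of $-i$, and identities among them become congruences modulo $4$. -/
theorem wp_one_add (N : ℤ) : AbelianGaugeTheory.wp (1 + N) = (-Complex.I) ^ N := by
  rw [neg_I_zpow_congr (x := N) (y := N % 4) (by omega)]
  have h : N % 4 = 0 ∨ N % 4 = 1 ∨ N % 4 = 2 ∨ N % 4 = 3 := by omega
  rcases h with h | h | h | h
  · have h' : (1 + N) % 4 = 1 := by omega
    simp [AbelianGaugeTheory.wp, h, h']
  · have h' : (1 + N) % 4 = 2 := by omega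
    simp [AbelianGaugeTheory.wp, h, h']
  · have h' : (1 + N) % 4 = 3 := by omega
    have : (-Complex.I) ^ (2 : ℤ) = (-Complex.I) ^ 2 := by norm_cast
    simp [AbelianGaugeTheory.wp, h, h', this]
  · have h' : (1 + N) % 4 = 0 := by omega
    have : (-Complex.I) ^ (3 : ℤ) = (-Complex.I) ^ 3 := by norm_cast
    simp [AbelianGaugeTheory.wp, h, h', this, pow_succ]

theorem cosh_add_int_mul_pi_mul_I (z : ℂ) (M : ℤ) :
    Complex.cosh (z + M * (Real.pi * Complex.I)) = (-1) ^ M * Complex.cosh z := by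
  have h : Complex.cos (z * Complex.I - M * Real.pi) = (-1) ^ M * Complex.cos (z * Complex.I) :=
    M.cast_negOnePow ℂ ▸ Complex.cos_antiperiodic.sub_int_mul_eq M
  rw [← Complex.cos_mul_I, ← Complex.cos_mul_I, ← h]
  congr 1
  linear_combination (M * Real.pi : ℂ) * Complex.I_mul_I

/-- For even $N$ the shift is an integer multiple of $\pi i$ and only changes the sign; for odd $N$
a further $\pi i/2$ turns $\cosh$ into $i\sinh$. This is the dichotomy in `CS`. -/
theorem inv_cosh_shift (x : ℝ) (N M : ℤ) :
    (Complex.cosh (x + Real.pi * Complex.I * (N / 2 + M)))⁻¹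
      = (-1) ^ M * (-Complex.I) ^ N * (AbelianGaugeTheory.CS (1 + N) x : ℝ) := by
  have hinv : ∀ l : ℤ, ((-1 : ℂ) ^ l)⁻¹ = (-1) ^ l := fun l => by
    rw [← inv_zpow, inv_neg, inv_one]
  have hsq : (-Complex.I) ^ (2 : ℤ) = -1 := by
    have : (-Complex.I) ^ (2 : ℤ) = (-Complex.I) ^ 2 := by norm_cast
    rw [this, neg_sq, Complex.I_sq]
  obtain ⟨q, rfl | rfl⟩ : ∃ q, N = 2 * q ∨ N = 2 * q + 1 := ⟨N / 2, by omega⟩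
  · have h1 : (x : ℂ) + Real.pi * Complex.I * (((2 * q : ℤ) : ℂ) / 2 + M)
        = x + ((M + q : ℤ) : ℂ) * (Real.pi * Complex.I) := by push_cast; ring
    have hodd : Odd (1 + 2 * q) := ⟨q, by ring⟩
    rw [h1, cosh_add_int_mul_pi_mul_I, mul_inv, hinv, zpow_add₀ (by norm_num), zpow_mul, hsq,
      AbelianGaugeTheory.CS, if_pos hodd]
    push_cast
    rfl
  · have h1 : (x : ℂ) + Real.pi * Complex.I * (((2 * q + 1 : ℤ) : ℂ) / 2 + M)
        = (x + Real.pi / 2 * Complex.I) + ((M + q : ℤ) : ℂ) * (Real.pi * Complex.I) := by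
      push_cast; ring
    have hodd : ¬ Odd (1 + (2 * q + 1)) := by
      rw [Int.not_odd_iff_even]; exact ⟨q + 1, by ring⟩
    rw [h1, cosh_add_int_mul_pi_mul_I, mul_inv, hinv, zpow_add₀ (by norm_num),
      zpow_add₀ neg_I_ne_zero, zpow_mul, hsq, zpow_one, AbelianGaugeTheory.CS, if_neg hodd,
      Complex.cosh_add, Complex.cosh_mul_I, Complex.sinh_mul_I, Complex.cos_pi_div_two,
      Complex.sin_pi_div_two, mul_zero, zero_add, one_mul, mul_inv, Complex.inv_I]
    push_cast
    ring

namespace AbelianGaugeTheory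

variable {n k d : ℕ} (T : AbelianGaugeTheory n k d) {I : Fin d ↪o Fin n} {J : Fin k ↪o Fin n}

theorem massSign_eq {m : Fin n → ℝ} (hm : ∀ t, T.massCoord m I t ≠ 0) (t : Fin d) :
    T.massSign m I t = 1 ∨ T.massSign m I t = -1 := by
  rcases lt_or_gt_of_ne (hm t) with h | h
  · right; rw [massSign, sign_neg h]; rfl
  · left; rw [massSign, sign_pos h]; rfl

theorem massSign_mul_pos {m : Fin n → ℝ} (hm : ∀ t, T.massCoord m I t ≠ 0) (t : Fin d) :
    (T.massSign m I t : ℝ) * T.massCoord m I t = |T.massCoord m I t| := by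
  rcases lt_or_gt_of_ne (hm t) with h | h
  · rw [massSign, sign_neg h, abs_of_neg h]; simp
  · rw [massSign, sign_pos h, abs_of_pos h]; simp

theorem fiSign_eq {ζ : Fin n → ℝ} (hζ : ∀ a, T.fiCoord ζ J a ≠ 0) (a : Fin k) :
    T.fiSign ζ J a = 1 ∨ T.fiSign ζ J a = -1 := by
  rcases lt_or_gt_of_ne (hζ a) with h | h
  · right; rw [fiSign, sign_neg h]; rfl
  · left; rw [fiSign, sign_pos h]; rfl

theorem fiSign_mul_pos {ζ : Fin n → ℝ} (hζ : ∀ a, T.fiCoord ζ J a ≠ 0) (a : Fin k) :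
    0 < (T.fiSign ζ J a : ℝ) * T.fiCoord ζ J a := by
  rcases lt_or_gt_of_ne (hζ a) with h | h
  · rw [fiSign, sign_neg h]; simpa using h
  · rw [fiSign, sign_pos h]; simpa using h

theorem r_eq (hIJ : IsCompl (Set.range I) (Set.range J)) (hI : IsUnit (T.minorP I).det)
    (m : Fin n → ℝ) (t : Fin d) :
    T.r m I t = -T.massSign m I t * (1 - ∑ a, T.dualR J (I t) a) := by
  rw [r, sum_complEquiv hIJ]
  simp only [T.R_apply_self hI, T.R_apply_compl hIJ hI]
  have : ∀ t', -((if t' = t then 1 else 0) * T.massSign m I t)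
      = if t' = t then -T.massSign m I t else 0 := fun t' => by split_ifs <;> simp
  simp only [this, Finset.sum_ite_eq', Finset.mem_univ, if_true, neg_mul, neg_neg]
  rw [← Finset.sum_mul]
  ring

theorem s_eq (hIJ : IsCompl (Set.range I) (Set.range J)) (hJ : IsUnit (T.minorQ J).det)
    (ζ : Fin n → ℝ) (a : Fin k) :
    T.s ζ J a = T.fiSign ζ J a * (1 + ∑ t, T.dualR J (I t) a) := by
  rw [s, sum_complEquiv hIJ, ← Finset.sum_mul, ← Finset.sum_mul]
  simp only [T.dualR_apply_self hJ, Finset.sum_ite_eq', Finset.mem_univ, if_true]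
  ring

theorem sign_identity (hIJ : IsCompl (Set.range I) (Set.range J)) (hI : IsUnit (T.minorP I).det)
    {m ζ : Fin n → ℝ} (hm : ∀ t, T.massCoord m I t ≠ 0) (hζ : ∀ a, T.fiCoord ζ J a ≠ 0) :
    ∏ a, ((T.fiSign ζ J a : ℂ)
        * (-Complex.I) ^ (∑ t, T.massSign m I t * T.dualR J (I t) a))
      = (∏ t, wp (T.rTilde ζ J (I t)) * (T.massSign m I t : ℂ) ^ (T.r m I t + 1))
        * ∏ a, (T.fiSign ζ J a : ℂ) ^ (T.s ζ J a) := by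
  have hJ := T.isUnit_det_minorQ hIJ hI
  set σ := T.massSign m I with hσd
  set τ := T.fiSign ζ J with hτd
  set D : Fin d → Fin k → ℤ := fun t a => T.dualR J (I t) a with hD
  have hσ : ∀ t, σ t = 1 ∨ σ t = -1 := T.massSign_eq hm
  have hτ : ∀ a, τ a = 1 ∨ τ a = -1 := T.fiSign_eq hζ
  have e1 : ∀ a, (τ a : ℂ) * (-Complex.I) ^ (∑ t, σ t * D t a)
      = (-Complex.I) ^ ((1 - τ a) + ∑ t, σ t * D t a) := fun a => by
    rw [zpow_add₀ neg_I_ne_zero, ← sign_eq_neg_I_zpow (hτ a)]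
  have e2 : ∀ t, wp (T.rTilde ζ J (I t)) * (σ t : ℂ) ^ (T.r m I t + 1)
      = (-Complex.I) ^ (∑ a, D t a * τ a + (1 - σ t) * (T.r m I t + 1)) := fun t => by
    rw [rTilde, wp_one_add, zpow_add₀ neg_I_ne_zero, zpow_mul, ← sign_eq_neg_I_zpow (hσ t)]
  have e3 : ∀ a, (τ a : ℂ) ^ (T.s ζ J a) = (-Complex.I) ^ ((1 - τ a) * T.s ζ J a) := fun a => by
    rw [zpow_mul, ← sign_eq_neg_I_zpow (hτ a)]
  rw [Finset.prod_congr rfl fun a _ => e1 a, Finset.prod_congr rfl fun t _ => e2 t,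
    Finset.prod_congr rfl fun a _ => e3 a, ← zpow_finset_sum neg_I_ne_zero,
    ← zpow_finset_sum neg_I_ne_zero, ← zpow_finset_sum neg_I_ne_zero, ← zpow_add₀ neg_I_ne_zero]
  apply neg_I_zpow_congr
  -- The factor $1-\sigma_t$ is $0$ or $2$. In the second case $\sigma_t=-1$ and $\mathsf
  -- r_t+1=2-\sum_aD_{ta}$, so the difference is $4(1-\sum_aD_{ta})$. The next two facts come from
  -- the same case distinction.
  have f1 : ∀ t, (4 : ℤ) ∣ (1 - σ t) * (T.r m I t + 1) - (1 - σ t) * ∑ a, D t a := fun t => by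
    rw [T.r_eq hIJ hI, ← hσd]
    rcases hσ t with h | h
    · rw [h]; simp
    · rw [h]; exact ⟨1 - ∑ a, D t a, by ring⟩
  have f2 : ∀ a, (4 : ℤ) ∣ (1 - τ a) * T.s ζ J a - (1 - τ a) * (1 + ∑ t, D t a) := fun a => by
    rw [T.s_eq hIJ hJ, ← hτd]
    rcases hτ a with h | h
    · rw [h]; simp
    · rw [h]; exact ⟨-(1 + ∑ t, D t a), by ring⟩
  have f3 : ∀ t, (4 : ℤ) ∣ (2 - 2 * σ t) * ∑ a, D t a := fun t => by
    rcases hσ t with h | h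
    · rw [h]; simp
    · rw [h]; exact ⟨∑ a, D t a, by ring⟩
  have F1 := Finset.dvd_sum fun t (_ : t ∈ Finset.univ) => f1 t
  have F2 := Finset.dvd_sum fun a (_ : a ∈ Finset.univ) => f2 a
  have F3 := Finset.dvd_sum fun t (_ : t ∈ Finset.univ) => f3 t
  have hF := (dvd_add (dvd_add F1 F2) F3).neg_right
  obtain ⟨l, hl⟩ := hF
  refine ⟨l, hl ▸ ?_⟩
  have c1 : ∑ a, ∑ t, σ t * D t a = ∑ t, σ t * ∑ a, D t a := by
    rw [Finset.sum_comm]; exact Finset.sum_congr rfl fun t _ => by rw [Finset.mul_sum]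
  have c2 : ∑ a, (1 - τ a) * ∑ t, D t a = ∑ t, ∑ a, D t a - ∑ t, ∑ a, D t a * τ a := by
    rw [Finset.sum_comm, Finset.sum_comm (f := fun t a => D t a * τ a), ← Finset.sum_sub_distrib]
    refine Finset.sum_congr rfl fun a _ => ?_
    rw [← Finset.sum_mul]; ring
  simp only [Finset.sum_sub_distrib, Finset.sum_add_distrib, sub_mul, one_mul, mul_add, mul_one]
    at c2 ⊢
  have c3 : ∑ t, 2 * σ t * ∑ a, D t a = 2 * ∑ t, σ t * ∑ a, D t a := by
    rw [Finset.mul_sum]; exact Finset.sum_congr rfl fun t _ => by ring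
  have c4 : ∑ t, 2 * ∑ a, D t a = 2 * ∑ t, ∑ a, D t a := by rw [Finset.mul_sum]
  rw [c1, c3, c4]
  linarith

/-- Up to sign the argument of $\cosh$ is $\pi z^!_a+\pi i(N_a/2+M_a)$, where only the integer $M_a$
involves $c$. The resulting signs $(-1)^{M_a}$ combine with $(-1)^{c_t}$ to the grading of the Verma
module, because $\mathsf r_t\equiv1+\sum_a\sigma_tR_{ta}$ modulo $2$, with $R_{ta}$ the entry of
$R^!_J$ at $(I(t),a)$. The remainder is independent of $c$ and is handled by `sign_identity`. -/
theorem coefficient_identity (hIJ : IsCompl (Set.range I) (Set.range J))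
    (hI : IsUnit (T.minorP I).det) {m ζ : Fin n → ℝ} (hm : ∀ t, T.massCoord m I t ≠ 0)
    (hζ : ∀ a, T.fiCoord ζ J a ≠ 0) (c : Fin d → ℕ) :
    ((T.minorQ J).det : ℂ) * ((∏ t, (-1) ^ c t)
      * ∏ a, ((T.fiSign ζ J a : ℂ) * (2 * Complex.cosh (Real.pi * Complex.I
        * (Complex.I * T.fiCoord ζ J a - ∑ t, (T.massSign m I t : ℂ) * T.dualR J (I t) a
          * ((c t : ℂ) + 1 / 2))))⁻¹))
      = T.coefficient m ζ I J * (-1) ^ (∑ t, T.r m I t * (c t : ℤ)) := by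
  have hJ := T.isUnit_det_minorQ hIJ hI
  set N : Fin k → ℤ := fun a => ∑ t, T.massSign m I t * T.dualR J (I t) a with hN
  set M : Fin k → ℤ := fun a => ∑ t, T.massSign m I t * T.dualR J (I t) a * (c t : ℤ) with hM
  -- Only the parity of the index matters for `CS`, and signs $\pm1$ do not affect parity.
  have hCS : ∀ a, CS (1 + N a) (Real.pi * T.fiCoord ζ J a)
      = CS (T.s ζ J a) (Real.pi * T.fiCoord ζ J a) := fun a => by
    have h1 : Even (∑ t, (T.massSign m I t - 1) * T.dualR J (I t) a) :=
      Finset.even_sum _ fun t _ => Even.mul_right (by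
        rcases T.massSign_eq hm t with h | h <;> rw [h] <;> decide) _
    have h2 : N a = ∑ t, (T.massSign m I t - 1) * T.dualR J (I t) a + ∑ t, T.dualR J (I t) a := by
      rw [← Finset.sum_add_distrib]
      exact Finset.sum_congr rfl fun t _ => by ring
    have h3 : Odd (1 + N a) ↔ Odd (T.s ζ J a) := by
      rw [T.s_eq hIJ hJ, h2]
      rcases T.fiSign_eq hζ a with h | h <;> rw [h] <;> simp [parity_simps, h1]
    simp only [CS, h3]
  have h1 : ∀ a, (T.fiSign ζ J a : ℂ) * (2 * Complex.cosh (Real.pi * Complex.I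
      * (Complex.I * T.fiCoord ζ J a - ∑ t, (T.massSign m I t : ℂ) * T.dualR J (I t) a
          * ((c t : ℂ) + 1 / 2))))⁻¹
      = (-1) ^ M a * ((T.fiSign ζ J a : ℂ) * (-Complex.I) ^ N a)
        * ((1 / 2 * CS (T.s ζ J a) (Real.pi * T.fiCoord ζ J a) : ℝ) : ℂ) := fun a => by
    have e : Real.pi * Complex.I * (Complex.I * T.fiCoord ζ J a
        - ∑ t, (T.massSign m I t : ℂ) * T.dualR J (I t) a * ((c t : ℂ) + 1 / 2))
        = -(((Real.pi * T.fiCoord ζ J a : ℝ) : ℂ)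
          + Real.pi * Complex.I * ((N a : ℂ) / 2 + (M a : ℂ))) := by
      have e' : ∑ t, (T.massSign m I t : ℂ) * T.dualR J (I t) a * ((c t : ℂ) + 1 / 2)
          = (N a : ℂ) / 2 + (M a : ℂ) := by
        simp only [hN, hM]
        push_cast
        rw [Finset.sum_div, ← Finset.sum_add_distrib]
        exact Finset.sum_congr rfl fun t _ => by ring
      rw [e']
      push_cast
      linear_combination (Real.pi * T.fiCoord ζ J a : ℂ) * Complex.I_mul_I
    rw [e, Complex.cosh_neg, mul_inv, inv_cosh_shift, hCS]
    push_cast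
    ring
  have h2 : (-1 : ℂ) ^ (∑ t, T.r m I t * (c t : ℤ)) = (∏ t, (-1) ^ c t) * ∏ a, (-1) ^ M a := by
    have e : ∀ t, (-1 : ℂ) ^ c t = (-1) ^ (c t : ℤ) := fun t => (zpow_natCast _ _).symm
    simp only [e]
    rw [← zpow_finset_sum (by norm_num), ← zpow_finset_sum (by norm_num),
      ← zpow_add₀ (by norm_num)]
    apply neg_one_zpow_congr
    have e2 : ∑ t, T.r m I t * (c t : ℤ) - (∑ t, (c t : ℤ) + ∑ a, M a)
        = ∑ t, (-T.massSign m I t - 1) * (c t : ℤ) := by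
      simp only [hM]
      rw [Finset.sum_comm, ← Finset.sum_add_distrib, ← Finset.sum_sub_distrib]
      refine Finset.sum_congr rfl fun t _ => ?_
      rw [T.r_eq hIJ hI, ← Finset.sum_mul, ← Finset.mul_sum]
      ring
    rw [e2]
    exact Finset.even_sum _ fun t _ => Even.mul_right (by
        rcases T.massSign_eq hm t with h | h <;> rw [h] <;> decide) _
  rw [Finset.prod_congr rfl fun a _ => h1 a, Finset.prod_mul_distrib, Finset.prod_mul_distrib,
    T.sign_identity hIJ hI hm hζ, h2, coefficient, Finset.prod_mul_distrib (s := Finset.univ)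
      (f := fun a => (T.fiSign ζ J a : ℂ) ^ (T.s ζ J a))]
  ring

/-- Allows division by the constant, so that summability of the expanded boundary integral passes to
the Verma trace. -/
theorem coefficient_ne_zero (hIJ : IsCompl (Set.range I) (Set.range J))
    (hI : IsUnit (T.minorP I).det) {m ζ : Fin n → ℝ} (hm : ∀ t, T.massCoord m I t ≠ 0)
    (hζ : ∀ a, T.fiCoord ζ J a ≠ 0) : T.coefficient m ζ I J ≠ 0 := by
  have hJ := T.isUnit_det_minorQ hIJ hI
  have hsign : ∀ {τ : ℤ}, (τ = 1 ∨ τ = -1) → (τ : ℂ) ≠ 0 := by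
    rintro τ (rfl | rfl) <;> simp
  refine mul_ne_zero (mul_ne_zero ?_ ?_) ?_
  · exact_mod_cast hJ.ne_zero
  · refine Finset.prod_ne_zero_iff.2 fun t _ => mul_ne_zero ?_ (zpow_ne_zero _ ?_)
    · rw [rTilde, wp_one_add]
      exact zpow_ne_zero _ neg_I_ne_zero
    · exact hsign (T.massSign_eq hm t)
  · refine Finset.prod_ne_zero_iff.2 fun a _ => mul_ne_zero (zpow_ne_zero _ ?_) ?_
    · exact hsign (T.fiSign_eq hζ a)
    · rw [Complex.ofReal_ne_zero]
      refine mul_ne_zero (by norm_num) ?_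
      rw [CS]
      split_ifs
      · exact inv_ne_zero (Real.cosh_pos _).ne'
      · exact inv_ne_zero (Real.sinh_ne_zero.2 (mul_ne_zero Real.pi_ne_zero (hζ a)))

end AbelianGaugeTheory

end

/-! ### The boundary integral as a multiple of the Verma trace -/

noncomputable section

open MeasureTheory

theorem exists_pos_forall_le {d : ℕ} (g : Fin d → ℝ) (hg : ∀ t, 0 < g t) :
    ∃ δ : ℝ, 0 < δ ∧ ∀ t, δ ≤ g t := by
  rcases isEmpty_or_nonempty (Fin d) with h | h
  · exact ⟨1, one_pos, fun t => (h.false t).elim⟩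
  · obtain ⟨t, ht⟩ := Finite.exists_min g
    exact ⟨g t, hg t, ht⟩

namespace AbelianGaugeTheory

open WeylAlgebra

variable {n k d : ℕ} (T : AbelianGaugeTheory n k d) {I : Fin d ↪o Fin n} {J : Fin k ↪o Fin n}

theorem exists_margin (m : Fin n → ℝ) (hm : ∀ t, T.massCoord m I t ≠ 0) :
    ∃ ε₀ : ℝ, 0 < ε₀ ∧ ∀ ε : ℝ, ε < ε₀ → ∃ δ : ℝ, 0 < δ ∧
      ∀ x : Fin k → ℝ, (∀ a, |x a| ≤ ε) → ∀ t, δ ≤ (T.massSign m I t : ℝ)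
        * (T.massCoord m I t + ∑ a, (T.dualR J (I t) a : ℝ) * x a) := by
  set K : Fin d → ℝ := fun t => ∑ a, |(T.dualR J (I t) a : ℝ)| with hK
  have hKn : ∀ t, 0 ≤ K t := fun t => Finset.sum_nonneg fun a _ => abs_nonneg _
  have hz : ∀ t, 0 < |T.massCoord m I t| / 2 := fun t => half_pos (abs_pos.2 (hm t))
  -- On the contour the real part of $b_{I(t)}$ differs from $z_t$ by at most $K_t\varepsilon$; this
  -- choice keeps the deviation below $|z_t|/2$. The added $1$ avoids division by zero when $K_t=0$.
  obtain ⟨ε₀, hε₀, h1⟩ := exists_pos_forall_le (fun t => |T.massCoord m I t| / 2 / (K t + 1))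
    fun t => div_pos (hz t) (by linarith [hKn t])
  obtain ⟨δ, hδ, h2⟩ := exists_pos_forall_le _ hz
  refine ⟨ε₀, hε₀, fun ε hε => ⟨δ, hδ, fun x hx t => (h2 t).trans ?_⟩⟩
  have h3 : |∑ a, (T.dualR J (I t) a : ℝ) * x a| ≤ K t * ε := by
    rw [hK, Finset.sum_mul]
    refine (Finset.abs_sum_le_sum_abs _ _).trans (Finset.sum_le_sum fun a _ => ?_)
    rw [abs_mul]
    exact mul_le_mul_of_nonneg_left (hx a) (abs_nonneg _)
  have h4 : K t * ε ≤ |T.massCoord m I t| / 2 := by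
    have h5 : ε₀ * (K t + 1) ≤ |T.massCoord m I t| / 2 :=
      (le_div_iff₀ (by linarith [hKn t])).1 (h1 t)
    nlinarith [hKn t]
  have h5 : |(T.massSign m I t : ℝ)| = 1 := by
    rcases T.massSign_eq hm t with h | h <;> rw [h] <;> simp
  have h6 : |(T.massSign m I t : ℝ) * ∑ a, (T.dualR J (I t) a : ℝ) * x a|
      ≤ |T.massCoord m I t| / 2 := by
    rw [abs_mul, h5, one_mul]
    exact h3.trans h4
  rw [mul_add, T.massSign_mul_pos hm]
  linarith [(abs_le.1 h6).1]

/-- An integer unit is its own inverse, so the determinant of $Q_J^{-1}$ is that of $Q_J$. -/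
theorem det_jacobian (hJ : IsUnit (T.minorQ J).det) (e : Fin k → ℂ) :
    ((T.minorQ J)⁻¹.map (fun q : ℤ => (q : ℂ)) * Matrix.diagonal e).det
      = (T.minorQ J).det * ∏ a, e a := by
  have h1 : ((T.minorQ J)⁻¹.map (fun q : ℤ => (q : ℂ))).det = (((T.minorQ J)⁻¹.det : ℤ) : ℂ) :=
    ((Int.castRingHom ℂ).map_det _).symm
  have h2 : (T.minorQ J)⁻¹.det = (T.minorQ J).det := by
    have h3 : (T.minorQ J)⁻¹.det * (T.minorQ J).det = 1 := by
      rw [← Matrix.det_mul, Matrix.nonsing_inv_mul _ hJ, Matrix.det_one]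
    rcases Int.isUnit_iff.1 hJ with h | h <;> rw [h] at h3 ⊢ <;> omega
  rw [Matrix.det_mul, Matrix.det_diagonal, h1, h2]

theorem mem_traceDomain_boundaryPoint (hIJ : IsCompl (Set.range I) (Set.range J))
    (hI : IsUnit (T.minorP I).det) {m ζ : Fin n → ℝ} (hζ : ∀ a, T.fiCoord ζ J a ≠ 0) {ε δ : ℝ}
    (hε : 0 < ε) (hδ : 0 < δ)
    (hR : ∀ x : Fin k → ℝ, (∀ a, |x a| ≤ ε) → ∀ t, δ ≤ (T.massSign m I t : ℝ)
        * (T.massCoord m I t + ∑ a, (T.dualR J (I t) a : ℝ) * x a)) (s : Fin k → ℝ) :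
    T.boundaryPoint m ζ J ε s ∈ traceDomain n := by
  have hJ := T.isUnit_det_minorQ hIJ hI
  refine forall_complEquiv hIJ (fun t => ?_) fun a => ?_
  · apply cosh_pi_ne_zero_of_re_ne_zero
    rw [boundaryPoint, T.pointOf_left hIJ hI]
    intro h0
    have h1 := hR (fun a => (T.fiSign ζ J a : ℝ) * (stripPath ε (s a)).re) (fun a => by
      rcases T.fiSign_eq hζ a with h | h <;> rw [h] <;> simpa using abs_stripPath_re_le hε (s a)) t
    have h2 : (T.massCoord m I t + ∑ a, (T.dualR J (I t) a : ℂ)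
        * ((T.fiSign ζ J a : ℂ) * stripPath ε (s a)) : ℂ).re
        = T.massCoord m I t + ∑ a, (T.dualR J (I t) a : ℝ)
          * ((T.fiSign ζ J a : ℝ) * (stripPath ε (s a)).re) := by
      rw [Complex.add_re, Complex.ofReal_re, Complex.re_sum]
      congr 1
      refine Finset.sum_congr rfl fun a _ => ?_
      rw [← Complex.ofReal_intCast, ← Complex.ofReal_intCast, Complex.re_ofReal_mul,
        Complex.re_ofReal_mul]
    rw [h2] at h0
    rw [h0, mul_zero] at h1
    linarith
  · rw [boundaryPoint, T.pointOf_right hJ]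
    have h : Complex.cosh (Real.pi * stripPath ε (s a)) ≠ 0 := stripPath_mem_sechDomain hε (s a)
    rcases T.fiSign_eq hζ a with h' | h' <;> rw [h']
    · simpa using h
    · simpa [mul_neg] using h

/-- The components $m_{J(a)}$ enter the products with the weights so as to complete $m_{I(t)}$ to
$z_t$. The constant left over is the one split off from $\boldsymbol\zeta$ in
`weylTrace_boundaryPoint`. -/
theorem sum_mul_vermaWeight (hIJ : IsCompl (Set.range I) (Set.range J))
    (hI : IsUnit (T.minorP I).det) (m ζ : Fin n → ℝ) (c : Fin d → ℕ) :
    ∑ j, (m j : ℂ) * T.vermaWeight hIJ m ζ c j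
      = -(∑ t, (T.massSign m I t : ℂ) * T.massCoord m I t * ((c t : ℂ) + 1 / 2))
        - Complex.I * ∑ a, (T.fiCoord ζ J a : ℂ) * m (J a) := by
  rw [sum_complEquiv hIJ]
  simp only [T.vermaWeight_left, T.vermaWeight_right, T.massCoord_eq hIJ hI]
  have e1 : ∀ a, (m (J a) : ℂ) * -(Complex.I * T.fiCoord ζ J a
      - ∑ t, (T.massSign m I t : ℂ) * T.dualR J (I t) a * ((c t : ℂ) + 1 / 2))
      = -(Complex.I * (T.fiCoord ζ J a * m (J a)))
        + ∑ t, (T.massSign m I t : ℂ) * (T.dualR J (I t) a * m (J a)) * ((c t : ℂ) + 1 / 2) := by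
    intro a
    rw [neg_sub, mul_sub, Finset.mul_sum, sub_eq_neg_add]
    congr 1
    · ring
    · exact Finset.sum_congr rfl fun t _ => by ring
  rw [Finset.sum_congr rfl fun a _ => e1 a, Finset.sum_add_distrib, Finset.sum_comm,
    Finset.sum_neg_distrib, ← Finset.mul_sum, ← Finset.sum_neg_distrib]
  push_cast
  rw [add_left_comm, ← Finset.sum_add_distrib, sub_eq_add_neg, add_comm]
  congr 1
  refine Finset.sum_congr rfl fun t _ => ?_
  rw [← Finset.sum_mul, ← Finset.mul_sum]
  ring

/-- The value of the twisted trace on the boundary of the product of half-strips. -/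
theorem weylTrace_boundaryPoint (hIJ : IsCompl (Set.range I) (Set.range J))
    (hI : IsUnit (T.minorP I).det) {m ζ : Fin n → ℝ} (hζ : ∀ a, T.fiCoord ζ J a ≠ 0) {ε δ : ℝ}
    (hε : 0 < ε) (hδ : 0 < δ)
    (hR : ∀ x : Fin k → ℝ, (∀ a, |x a| ≤ ε) → ∀ t, δ ≤ (T.massSign m I t : ℝ)
        * (T.massCoord m I t + ∑ a, (T.dualR J (I t) a : ℝ) * x a))
    (w : WeylAlgebra n) (f : MvPolynomial (Fin n) ℂ)
    (hf : ∀ u : Fin n →₀ ℕ, MvPolynomial.coeff u (fock w (MvPolynomial.monomial u 1))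
      = MvPolynomial.eval (fun j => (u j : ℂ) + 1 / 2) f) (s : Fin k → ℝ) :
    weylTrace ζ w (T.boundaryPoint m ζ J ε s)
      = Complex.exp (2 * Real.pi * (fiChar ζ (fun j => (m j : ℂ))
          - Complex.I * ∑ a, (T.fiCoord ζ J a : ℂ) * m (J a)))
        * ∑ p ∈ f.support, f.coeff p
          * ((∏ t, sechDeriv (p (I t)) (T.massCoord m I t
              + ∑ a, T.dualR J (I t) a * (T.fiSign ζ J a * stripPath ε (s a))))
            * ∏ a, (sechDeriv (p (J a)) (T.fiSign ζ J a * stripPath ε (s a))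
              * Complex.exp (2 * Real.pi * (Complex.I * T.fiCoord ζ J a)
                * (T.fiSign ζ J a * stripPath ε (s a))))) := by
  have hJ := T.isUnit_det_minorQ hIJ hI
  rw [(isWeylTrace_of_polynomial ζ w f hf).weylTrace_eq
    (T.mem_traceDomain_boundaryPoint hIJ hI hζ hε hδ hR s)]
  set y : Fin k → ℂ := fun a => T.fiSign ζ J a * stripPath ε (s a) with hy
  have hb : T.boundaryPoint m ζ J ε s = T.pointOf m J y := rfl
  have e : Complex.exp (2 * Real.pi * fiChar ζ (T.pointOf m J y))
      = Complex.exp (2 * Real.pi * (fiChar ζ (fun j => (m j : ℂ))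
          - Complex.I * ∑ a, (T.fiCoord ζ J a : ℂ) * m (J a)))
        * ∏ a, Complex.exp (2 * Real.pi * (Complex.I * T.fiCoord ζ J a) * y a) := by
    rw [← Complex.exp_sum, ← Complex.exp_add, T.fiChar_pointOf]
    congr 1
    simp only [mul_sub, Finset.sum_sub_distrib, mul_add, Finset.mul_sum]
    have : ∀ a, 2 * Real.pi * (Complex.I * (T.fiCoord ζ J a * y a))
        = 2 * Real.pi * (Complex.I * T.fiCoord ζ J a) * y a := fun a => by ring
    simp only [this]
    ring
  rw [hb, e, mul_assoc, Finset.mul_sum (s := f.support)]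
  congr 1
  refine Finset.sum_congr rfl fun p _ => ?_
  rw [prod_complEquiv hIJ, Finset.prod_mul_distrib]
  simp only [T.pointOf_left hIJ hI, T.pointOf_right hJ]
  ring

/-- Each monomial of $f$ is expanded by `expand_boundary_integral`. The bases of the powers that
appear are exactly the entries of `vermaWeight`, so the sum over monomials is $f$ evaluated at the
weights of $v_c$; signs and hyperbolic factors are collected by `coefficient_identity`. -/
theorem hasSum_boundaryTrace (hIJ : IsCompl (Set.range I) (Set.range J))
    (hI : IsUnit (T.minorP I).det) {m ζ : Fin n → ℝ} (hm : ∀ t, T.massCoord m I t ≠ 0)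
    (hζ : ∀ a, T.fiCoord ζ J a ≠ 0) {ε δ : ℝ} (hε : 0 < ε) (hδ : 0 < δ)
    (hR : ∀ x : Fin k → ℝ, (∀ a, |x a| ≤ ε) → ∀ t, δ ≤ (T.massSign m I t : ℝ)
        * (T.massCoord m I t + ∑ a, (T.dualR J (I t) a : ℝ) * x a))
    (w : WeylAlgebra n) (f : MvPolynomial (Fin n) ℂ)
    (hf : ∀ u : Fin n →₀ ℕ, MvPolynomial.coeff u (fock w (MvPolynomial.monomial u 1))
      = MvPolynomial.eval (fun j => (u j : ℂ) + 1 / 2) f) :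
    Integrable (T.boundaryIntegrand m ζ J ε w) ∧
      HasSum (fun c : Fin d → ℕ => T.coefficient m ζ I J * ((-1) ^ (∑ t, T.r m I t * (c t : ℤ))
        * Complex.exp (2 * Real.pi * (∑ j, (m j : ℂ) * T.vermaWeight hIJ m ζ c j
          + fiChar ζ (fun j => (m j : ℂ))))
        * MvPolynomial.eval (T.vermaWeight hIJ m ζ c) f)) (T.boundaryTrace m ζ J ε w) := by
  have hJ := T.isUnit_det_minorQ hIJ hI
  set C : ℂ := Complex.exp (2 * Real.pi * (fiChar ζ (fun j => (m j : ℂ))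
    - Complex.I * ∑ a, (T.fiCoord ζ J a : ℂ) * m (J a))) with hC
  have key := fun p : Fin n →₀ ℕ => expand_boundary_integral (fun t a => T.dualR J (I t) a)
    (T.massCoord m I) (T.fiCoord ζ J) (T.massSign m I) (T.massSign_eq hm) (T.fiSign ζ J)
    (T.fiSign_eq hζ) (T.fiSign_mul_pos hζ) hε hδ hR (fun t => p (I t)) (fun a => p (J a))
  have hint : T.boundaryIntegrand m ζ J ε w = fun s => ∑ p ∈ f.support,
      ((T.minorQ J).det * C * f.coeff p)
        * ((∏ t, sechDeriv (p (I t)) (T.massCoord m I t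
            + ∑ a, T.dualR J (I t) a * (T.fiSign ζ J a * stripPath ε (s a))))
          * ∏ a, (sechDeriv (p (J a)) (T.fiSign ζ J a * stripPath ε (s a))
            * Complex.exp (2 * Real.pi * (Complex.I * T.fiCoord ζ J a)
              * (T.fiSign ζ J a * stripPath ε (s a)))
            * (T.fiSign ζ J a * stripPathDeriv ε (s a)))) := by
    funext s
    rw [boundaryIntegrand, T.det_jacobian hJ,
      T.weylTrace_boundaryPoint hIJ hI hζ hε hδ hR w f hf s, Finset.mul_sum, Finset.mul_sum]
    refine Finset.sum_congr rfl fun p _ => ?_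
    simp only [Finset.prod_mul_distrib]
    ring
  constructor
  · rw [hint]
    exact integrable_finsetSum _ fun p _ => (key p).1.const_mul _
  · rw [boundaryTrace, hint, integral_finsetSum _ fun p _ => (key p).1.const_mul _]
    simp only [integral_const_mul]
    refine (hasSum_sum fun p _ => (key p).2.mul_left _).of_eq (fun c => ?_) rfl
    have hexp : Complex.exp (2 * Real.pi * (∑ j, (m j : ℂ) * T.vermaWeight hIJ m ζ c j
          + fiChar ζ (fun j => (m j : ℂ))))
        = C * ∏ t, Complex.exp (-(2 * Real.pi * T.massSign m I t * T.massCoord m I t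
          * ((c t : ℂ) + 1 / 2))) := by
      rw [hC, ← Complex.exp_sum, ← Complex.exp_add, T.sum_mul_vermaWeight hIJ hI]
      congr 1
      rw [Finset.sum_neg_distrib]
      have : ∀ t, 2 * Real.pi * T.massSign m I t * T.massCoord m I t * ((c t : ℂ) + 1 / 2)
          = 2 * Real.pi * (T.massSign m I t * T.massCoord m I t * ((c t : ℂ) + 1 / 2)) :=
        fun t => by ring
      simp only [this, ← Finset.mul_sum]
      ring
    have hcoef := T.coefficient_identity hIJ hI hm hζ c
    rw [MvPolynomial.eval_eq', Finset.mul_sum, Finset.mul_sum, hexp]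
    refine Finset.sum_congr rfl fun p _ => ?_
    rw [prod_complEquiv hIJ]
    simp only [T.vermaWeight_left, T.vermaWeight_right]
    simp only [Finset.prod_mul_distrib] at hcoef ⊢
    linear_combination (-(C * f.coeff p)
      * (∏ t, (Complex.exp (-(2 * Real.pi * T.massSign m I t * T.massCoord m I t
          * ((c t : ℂ) + 1 / 2)))))
      * (∏ t, (-(T.massSign m I t : ℂ) * ((c t : ℂ) + 1 / 2)) ^ p (I t))
      * ∏ a, (-(Complex.I * T.fiCoord ζ J a - ∑ t, (T.massSign m I t : ℂ) * T.dualR J (I t) a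
          * ((c t : ℂ) + 1 / 2))) ^ p (J a)) * hcoef

/-- The two integrands differ by $\det(Q_J)\prod_a\sigma^!_J(a)$, which is its own inverse. -/
theorem inheritedTrace_eq (hIJ : IsCompl (Set.range I) (Set.range J))
    (hI : IsUnit (T.minorP I).det) (m : Fin n → ℝ) {ζ : Fin n → ℝ}
    (hζ : ∀ a, T.fiCoord ζ J a ≠ 0) (ε : ℝ) (w : WeylAlgebra n) :
    T.inheritedTrace m ζ J ε w
      = (T.minorQ J).det * (∏ a, (T.fiSign ζ J a : ℂ)) * T.boundaryTrace m ζ J ε w := by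
  have hJ := T.isUnit_det_minorQ hIJ hI
  have h1 : T.boundaryTrace m ζ J ε w
      = (T.minorQ J).det * (∏ a, (T.fiSign ζ J a : ℂ)) * T.inheritedTrace m ζ J ε w := by
    rw [boundaryTrace, inheritedTrace, ← integral_const_mul]
    congr 1
    funext s
    rw [boundaryIntegrand, T.det_jacobian hJ, Finset.prod_mul_distrib]
    ring
  have h2 : ((T.minorQ J).det : ℂ) * (T.minorQ J).det = 1 := by
    rcases Int.isUnit_iff.1 hJ with h | h <;> rw [h] <;> norm_num
  have h3 : (∏ a, (T.fiSign ζ J a : ℂ)) * ∏ a, (T.fiSign ζ J a : ℂ) = 1 := by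
    rw [← Finset.prod_mul_distrib]
    refine Finset.prod_eq_one fun a _ => ?_
    rcases T.fiSign_eq hζ a with h | h <;> rw [h] <;> norm_num
  rw [h1]
  linear_combination (-T.inheritedTrace m ζ J ε w) * h2
    - ((T.minorQ J).det * (T.minorQ J).det * T.inheritedTrace m ζ J ε w : ℂ) * h3

theorem IsVermaBasis.vermaDiag_eq {T : AbelianGaugeTheory n k d}
    (hIJ : IsCompl (Set.range I) (Set.range J))
    (hI : IsUnit (T.minorP I).det) {m ζ : Fin n → ℝ} {M : Type*} [AddCommGroup M] [Module ℂ M]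
    [Module (T.Higgs ζ) M] [IsScalarTower ℂ (T.Higgs ζ) M] {v : Module.Basis (Fin d → ℕ) ℂ M}
    (hv : T.IsVermaBasis m ζ I v) (w : T.Higgs ζ) (c : Fin d → ℕ) :
    T.vermaDiag m ζ I v w c = (-1) ^ (∑ t, T.r m I t * (c t : ℤ))
        * Complex.exp (2 * Real.pi * (∑ j, (m j : ℂ) * T.vermaWeight hIJ m ζ c j
          + fiChar ζ (fun j => (m j : ℂ)))) * v.repr (w • v c) c := by
  have h : T.toHiggs ζ ⟨shiftedMoment ζ (fun j => (m j : ℂ)), T.shiftedMoment_mem_invariants ζ _⟩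
      • v c = (∑ j, (m j : ℂ) * T.vermaWeight hIJ m ζ c j + fiChar ζ (fun j => (m j : ℂ)))
        • v c := by
    rw [T.toHiggs_shiftedMoment, add_smul, Finset.sum_smul, add_smul, Finset.sum_smul,
      algebraMap_smul]
    congr 1
    exact Finset.sum_congr rfl fun j _ => by
      rw [smul_assoc, hv.hHiggs_smul hIJ hI, smul_smul]
  rw [vermaDiag, h, map_smul, Finsupp.smul_apply, Module.Basis.repr_self, Finsupp.single_eq_same,
    smul_eq_mul, mul_one]

theorem trace_formula (hIJ : IsCompl (Set.range I) (Set.range J))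
    (hI : IsUnit (T.minorP I).det) {m ζ : Fin n → ℝ} (hm : ∀ t, T.massCoord m I t ≠ 0)
    (hζ : ∀ a, T.fiCoord ζ J a ≠ 0) {ε δ : ℝ} (hε : 0 < ε) (hδ : 0 < δ)
    (hR : ∀ x : Fin k → ℝ, (∀ a, |x a| ≤ ε) → ∀ t, δ ≤ (T.massSign m I t : ℝ)
        * (T.massCoord m I t + ∑ a, (T.dualR J (I t) a : ℝ) * x a))
    (w : T.invariants) {M : Type*} [AddCommGroup M] [Module ℂ M]
    [Module (T.Higgs ζ) M] [IsScalarTower ℂ (T.Higgs ζ) M] {v : Module.Basis (Fin d → ℕ) ℂ M}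
    (hv : T.IsVermaBasis m ζ I v) :
    Integrable (T.boundaryIntegrand m ζ J ε (w : WeylAlgebra n)) ∧
    Summable (T.vermaDiag m ζ I v (T.toHiggs ζ w)) ∧
    T.boundaryTrace m ζ J ε (w : WeylAlgebra n)
      = T.coefficient m ζ I J * T.vermaTrace m ζ I v (T.toHiggs ζ w) := by
  obtain ⟨f, hf, hf'⟩ := exists_polynomial_diag T.invariants T.h_mem_invariants w
    ((Algebra.lsmul ℂ ℂ M).comp (T.toHiggs ζ)) v (T.vermaWeight hIJ m ζ)
    fun c j => hv.hHiggs_smul hIJ hI c j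
  obtain ⟨hint, hsum⟩ := T.hasSum_boundaryTrace hIJ hI hm hζ hε hδ hR w f hf
  have hdiag : ∀ c, T.vermaDiag m ζ I v (T.toHiggs ζ w) c
      = (-1) ^ (∑ t, T.r m I t * (c t : ℤ))
        * Complex.exp (2 * Real.pi * (∑ j, (m j : ℂ) * T.vermaWeight hIJ m ζ c j
          + fiChar ζ (fun j => (m j : ℂ))))
        * MvPolynomial.eval (T.vermaWeight hIJ m ζ c) f := fun c => by
    rw [hv.vermaDiag_eq hIJ hI, ← hf' c]
    rfl
  simp only [← hdiag] at hsum
  have hs : Summable (T.vermaDiag m ζ I v (T.toHiggs ζ w)) :=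
    (summable_mul_left_iff (T.coefficient_ne_zero hIJ hI hm hζ)).1 hsum.summable
  exact ⟨hint, hs, by rw [vermaTrace, ← tsum_mul_left, hsum.tsum_eq]⟩

end AbelianGaugeTheory

end

noncomputable section

/-! ## Weight modules of the Weyl algebra -/

/-- A one-variable weight module of the Weyl algebra: raising and lowering coefficients on a
basis indexed by `ℤ`, with `h` acting on the basis vector of index `z` by `weight + z`, together
with a set of indices which spans a submodule generated by the basis vector of index `0`. -/
structure Ladder where
  /-- The coefficient of `x`. -/
  up : ℤ → ℂ
  /-- The coefficient of `∂`. -/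
  down : ℤ → ℂ
  /-- The eigenvalue of `h` at index `0`. -/
  weight : ℂ
  /-- The indices of the submodule. -/
  dom : Set ℤ
  up_mul_down : ∀ z : ℤ, up z * down (z + 1) = weight + z + 1 / 2
  zero_mem : 0 ∈ dom
  -- This condition and the next say that no step leads out of `dom`, so that it spans a submodule.
  up_eq_zero : ∀ z ∈ dom, z + 1 ∉ dom → up z = 0
  down_eq_zero : ∀ z ∈ dom, z - 1 ∉ dom → down z = 0
  -- Steps away from index $0$ have nonzero coefficients as long as they stay in `dom`, so that
  -- index $0$ generates.
  up_ne_zero : ∀ z, 0 ≤ z → z + 1 ∈ dom → z ∈ dom ∧ up z ≠ 0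
  down_ne_zero : ∀ z, z ≤ 0 → z - 1 ∈ dom → z ∈ dom ∧ down z ≠ 0

namespace Ladder

/-- The polynomial module, with lowest weight `1/2`. -/
def lowest : Ladder where
  up _ := 1
  down z := z
  weight := 1 / 2
  dom := {z | 0 ≤ z}
  up_mul_down z := by push_cast; ring
  zero_mem := le_refl (0 : ℤ)
  up_eq_zero z hz h := absurd (show (0 : ℤ) ≤ z + 1 from by have : (0 : ℤ) ≤ z := hz; omega) h
  down_eq_zero z hz h := by
    have h1 : (0 : ℤ) ≤ z := hz
    have h2 : ¬(0 : ℤ) ≤ z - 1 := h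
    rw [show z = 0 by omega, Int.cast_zero]
  up_ne_zero z hz _ := ⟨hz, one_ne_zero⟩
  down_ne_zero z hz h := by
    have h2 : (0 : ℤ) ≤ z - 1 := h
    omega

/-- The Fourier transform of the polynomial module, with highest weight `-1/2`. -/
def highest : Ladder where
  up z := z
  down _ := 1
  weight := -(1 / 2)
  dom := {z | z ≤ 0}
  up_mul_down z := by ring
  zero_mem := le_refl (0 : ℤ)
  up_eq_zero z hz h := by
    have h1 : z ≤ (0 : ℤ) := hz
    have h2 : ¬z + 1 ≤ (0 : ℤ) := h
    rw [show z = 0 by omega, Int.cast_zero]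
  down_eq_zero z hz h := absurd (show z - 1 ≤ (0 : ℤ) from by have : z ≤ (0 : ℤ) := hz; omega) h
  up_ne_zero z hz h := by
    have h2 : z + 1 ≤ (0 : ℤ) := h
    omega
  down_ne_zero z hz _ := ⟨hz, one_ne_zero⟩

/-- The simple module with weights `c + ℤ`, for `c` not real. -/
def dense (c : ℂ) (hc : c.im ≠ 0) : Ladder where
  up _ := 1
  down z := c + z - 1 / 2
  weight := c
  dom := Set.univ
  up_mul_down z := by push_cast; ring
  zero_mem := trivial
  up_eq_zero _ _ h := absurd trivial h
  down_eq_zero _ _ h := absurd trivial h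
  up_ne_zero _ _ _ := ⟨trivial, one_ne_zero⟩
  down_ne_zero z _ _ := by
    refine ⟨trivial, fun h => hc ?_⟩
    have := congrArg Complex.im h
    simpa using this

theorem up_mul_down_pred (ℓ : Ladder) (z : ℤ) :
    ℓ.down z * ℓ.up (z - 1) = ℓ.weight + z - 1 / 2 := by
  have := ℓ.up_mul_down (z - 1)
  rw [sub_add_cancel] at this
  rw [mul_comm, this]
  push_cast; ring

end Ladder

namespace WeylAlgebra

variable {n : ℕ} (ℓ : Fin n → Ladder)

/-- The action of `xⱼ` on the product of the one-variable weight modules. -/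
def ladderUp (j : Fin n) : Module.End ℂ ((Fin n → ℤ) →₀ ℂ) :=
  Finsupp.lsum ℂ fun u => (ℓ j).up (u j) • Finsupp.lsingle (u + Pi.single j 1)

/-- The action of `∂ⱼ` on the product of the one-variable weight modules. -/
def ladderDown (j : Fin n) : Module.End ℂ ((Fin n → ℤ) →₀ ℂ) :=
  Finsupp.lsum ℂ fun u => (ℓ j).down (u j) • Finsupp.lsingle (u - Pi.single j 1)

theorem ladderUp_single (j : Fin n) (u : Fin n → ℤ) (c : ℂ) :
    ladderUp ℓ j (Finsupp.single u c)
      = (ℓ j).up (u j) • Finsupp.single (u + Pi.single j 1) c := by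
  simp [ladderUp]

theorem ladderDown_single (j : Fin n) (u : Fin n → ℤ) (c : ℂ) :
    ladderDown ℓ j (Finsupp.single u c)
      = (ℓ j).down (u j) • Finsupp.single (u - Pi.single j 1) c := by
  simp [ladderDown]

/-- The product of one-variable weight modules. -/
def ladderRep : WeylAlgebra n →ₐ[ℂ] Module.End ℂ ((Fin n → ℤ) →₀ ℂ) :=
  lift (ladderUp ℓ) (ladderDown ℓ)
    (by
      intro i j
      refine Finsupp.lhom_ext fun u c => ?_
      by_cases hij : i = j
      · rw [hij]
      · simp only [Module.End.mul_apply, ladderUp_single, map_smul, smul_smul, Pi.add_apply,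
          Pi.single_eq_of_ne hij, Pi.single_eq_of_ne (Ne.symm hij), add_zero]
        rw [mul_comm, add_right_comm])
    (by
      intro i j
      refine Finsupp.lhom_ext fun u c => ?_
      by_cases hij : i = j
      · rw [hij]
      · simp only [Module.End.mul_apply, ladderDown_single, map_smul, smul_smul, Pi.sub_apply,
          Pi.single_eq_of_ne hij, Pi.single_eq_of_ne (Ne.symm hij), sub_zero]
        rw [mul_comm, sub_right_comm])
    (by
      intro i j
      refine Finsupp.lhom_ext fun u c => ?_
      by_cases hij : i = j
      · subst hij
        simp only [Module.End.mul_apply, LinearMap.add_apply, ladderUp_single, ladderDown_single,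
          map_smul, smul_smul, Pi.sub_apply, Pi.add_apply, Pi.single_eq_same, if_true,
          Module.End.one_apply, add_sub_cancel_right, sub_add_cancel, (ℓ i).up_mul_down,
          (ℓ i).up_mul_down_pred]
        nth_rw 3 [← one_smul ℂ (Finsupp.single u c)]
        rw [← add_smul]
        congr 1
        ring
      · simp only [Module.End.mul_apply, ladderUp_single, ladderDown_single, map_smul, smul_smul,
          Pi.sub_apply, Pi.add_apply, Pi.single_eq_of_ne hij, Pi.single_eq_of_ne (Ne.symm hij),
          if_neg hij, add_zero, sub_zero]
        rw [mul_comm, sub_add_eq_add_sub])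

theorem ladderRep_x (j : Fin n) (u : Fin n → ℤ) (c : ℂ) :
    ladderRep ℓ (x j) (Finsupp.single u c)
      = (ℓ j).up (u j) • Finsupp.single (u + Pi.single j 1) c := by
  rw [ladderRep, lift_x, ladderUp_single]

theorem ladderRep_del (j : Fin n) (u : Fin n → ℤ) (c : ℂ) :
    ladderRep ℓ (del j) (Finsupp.single u c)
      = (ℓ j).down (u j) • Finsupp.single (u - Pi.single j 1) c := by
  rw [ladderRep, lift_del, ladderDown_single]

theorem ladderRep_h (j : Fin n) (u : Fin n → ℤ) (c : ℂ) :
    ladderRep ℓ (h j) (Finsupp.single u c)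
      = ((ℓ j).weight + u j) • Finsupp.single u c := by
  rw [h, map_add, map_mul, AlgHom.commutes, LinearMap.add_apply, Module.End.mul_apply,
    ladderRep_del, map_smul, ladderRep_x, Pi.sub_apply, Pi.single_eq_same, sub_add_cancel,
    smul_smul, (ℓ j).up_mul_down_pred, Module.algebraMap_end_apply, ← add_smul, sub_add_cancel]

theorem generator_induction {p : WeylAlgebra n → Prop} (hx : ∀ j, p (x j)) (hd : ∀ j, p (del j))
    (hc : ∀ c, p (algebraMap ℂ _ c)) (ha : ∀ a b, p a → p b → p (a + b))
    (hm : ∀ a b, p a → p b → p (a * b)) (w : WeylAlgebra n) : p w := by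
  have hw : w ∈ Algebra.adjoin ℂ (Set.range (x (n := n)) ∪ Set.range (del (n := n))) := by
    rw [adjoin_generators]; trivial
  induction hw using Algebra.adjoin_induction with
  | mem w hw =>
    rcases hw with ⟨j, rfl⟩ | ⟨j, rfl⟩
    · exact hx j
    · exact hd j
  | algebraMap c => exact hc c
  | add a b _ _ h1 h2 => exact ha a b h1 h2
  | mul a b _ _ h1 h2 => exact hm a b h1 h2

theorem ladderRep_mem_supported (w : WeylAlgebra n) :
    ∀ y ∈ Finsupp.supported ℂ ℂ {u : Fin n → ℤ | ∀ j, u j ∈ (ℓ j).dom},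
      ladderRep ℓ w y ∈ Finsupp.supported ℂ ℂ {u : Fin n → ℤ | ∀ j, u j ∈ (ℓ j).dom} := by
  have key : ∀ (f : Module.End ℂ ((Fin n → ℤ) →₀ ℂ)),
      (∀ u : Fin n → ℤ, (∀ j, u j ∈ (ℓ j).dom) → f (Finsupp.single u 1)
        ∈ Finsupp.supported ℂ ℂ {u : Fin n → ℤ | ∀ j, u j ∈ (ℓ j).dom}) →
      ∀ y ∈ Finsupp.supported ℂ ℂ {u : Fin n → ℤ | ∀ j, u j ∈ (ℓ j).dom},
        f y ∈ Finsupp.supported ℂ ℂ {u : Fin n → ℤ | ∀ j, u j ∈ (ℓ j).dom} := by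
    intro f hf y hy
    rw [Finsupp.supported_eq_span_single] at hy
    induction hy using Submodule.span_induction with
    | mem y hy => obtain ⟨u, hu, rfl⟩ := hy; exact hf u hu
    | zero => rw [map_zero]; exact zero_mem _
    | add y z _ _ h1 h2 => rw [map_add]; exact add_mem h1 h2
    | smul c y _ h1 => rw [map_smul]; exact Submodule.smul_mem _ _ h1
  induction w using generator_induction with
  | hx j =>
    refine key _ fun u hu => ?_
    rw [ladderRep_x]
    by_cases h : u j + 1 ∈ (ℓ j).dom
    · refine Submodule.smul_mem _ _ (Finsupp.single_mem_supported _ _ fun i => ?_)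
      by_cases hij : i = j
      · subst hij; simpa using h
      · simpa [hij] using hu i
    · rw [(ℓ j).up_eq_zero _ (hu j) h, zero_smul]; exact zero_mem _
  | hd j =>
    refine key _ fun u hu => ?_
    rw [ladderRep_del]
    by_cases h : u j - 1 ∈ (ℓ j).dom
    · refine Submodule.smul_mem _ _ (Finsupp.single_mem_supported _ _ fun i => ?_)
      by_cases hij : i = j
      · subst hij; simpa using h
      · simpa [hij] using hu i
    · rw [(ℓ j).down_eq_zero _ (hu j) h, zero_smul]; exact zero_mem _
  | hc c => intro y hy; rw [AlgHom.commutes, Module.algebraMap_end_apply]; exact Submodule.smul_mem _ _ hy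
  | ha a b ha hb => intro y hy; rw [map_add]; exact add_mem (ha y hy) (hb y hy)
  | hm a b ha hb => intro y hy; rw [map_mul]; exact ha _ (hb y hy)

/-- The character of the diagonal torus of weight `u`. -/
def torusChar (s : Fin n → Circle) (u : Fin n → ℤ) : ℂ := ∏ j, (s j : ℂ) ^ u j

theorem torusChar_add (s : Fin n → Circle) (u v : Fin n → ℤ) :
    torusChar s (u + v) = torusChar s u * torusChar s v := by
  rw [torusChar, torusChar, torusChar, ← Finset.prod_mul_distrib]
  exact Finset.prod_congr rfl fun j _ => zpow_add₀ (Circle.coe_ne_zero _) _ _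

theorem torusChar_single (s : Fin n → Circle) (j : Fin n) (z : ℤ) :
    torusChar s (Pi.single j z) = (s j : ℂ) ^ z := by
  rw [torusChar, Finset.prod_eq_single j (fun i _ hi => by rw [Pi.single_eq_of_ne hi, zpow_zero])
    (fun h => absurd (Finset.mem_univ j) h), Pi.single_eq_same]

/-- The action of the diagonal torus on the product of one-variable weight modules. -/
def ladderTorus (s : Fin n → Circle) : Module.End ℂ ((Fin n → ℤ) →₀ ℂ) :=
  Finsupp.lsum ℂ fun u => torusChar s u • Finsupp.lsingle u

theorem ladderTorus_single (s : Fin n → Circle) (u : Fin n → ℤ) (c : ℂ) :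
    ladderTorus s (Finsupp.single u c) = torusChar s u • Finsupp.single u c := by
  simp [ladderTorus]

theorem ladderTorus_apply (s : Fin n → Circle) (y : (Fin n → ℤ) →₀ ℂ) (u : Fin n → ℤ) :
    ladderTorus s y u = torusChar s u * y u := by
  induction y using Finsupp.induction_linear with
  | zero => simp
  | add y z hy hz => rw [map_add, Finsupp.add_apply, hy, hz, Finsupp.add_apply, mul_add]
  | single v c =>
    rw [ladderTorus_single, Finsupp.smul_apply, smul_eq_mul]
    by_cases h : v = u
    · rw [h]
    · rw [Finsupp.single_eq_of_ne (Ne.symm h), mul_zero, mul_zero]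

/-- Equivariance for the diagonal torus: it makes an invariant element preserve the gauge charge of
the indices. -/
theorem ladderTorus_ladderRep (s : Fin n → Circle) (w : WeylAlgebra n) :
    ∀ y, ladderTorus s (ladderRep ℓ w y) = ladderRep ℓ (torusAct s w) (ladderTorus s y) := by
  have key : ∀ f g : Module.End ℂ ((Fin n → ℤ) →₀ ℂ),
      (∀ u c, ladderTorus s (f (Finsupp.single u c)) = g (ladderTorus s (Finsupp.single u c))) →
      ∀ y, ladderTorus s (f y) = g (ladderTorus s y) := by
    intro f g hfg y
    exact LinearMap.congr_fun (f := ladderTorus s * f) (g := g * ladderTorus s)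
      (Finsupp.lhom_ext fun u c => hfg u c) y
  induction w using generator_induction with
  | hx j =>
    refine key _ _ fun u c => ?_
    have e : torusAct s (x j) = (s j : ℂ) • x j := lift_x _ _ _ _ _ j
    rw [e, map_smul, LinearMap.smul_apply, ladderTorus_single, map_smul, ladderRep_x, map_smul,
      ladderTorus_single, torusChar_add, torusChar_single, zpow_one]
    simp only [smul_smul]
    congr 1
    ring
  | hd j =>
    refine key _ _ fun u c => ?_
    have e : torusAct s (del j) = (s j : ℂ)⁻¹ • del j := lift_del _ _ _ _ _ j
    rw [e, map_smul, LinearMap.smul_apply, ladderTorus_single, map_smul, ladderRep_del, map_smul,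
      ladderTorus_single, sub_eq_add_neg, ← Pi.single_neg, torusChar_add, torusChar_single,
      zpow_neg_one]
    simp only [smul_smul]
    congr 1
    ring
  | hc c => intro y; simp only [AlgHom.commutes, Module.algebraMap_end_apply, map_smul]
  | ha a b ha hb => intro y; simp only [map_add, LinearMap.add_apply, ha, hb]
  | hm a b ha hb => intro y; simp only [map_mul, Module.End.mul_apply, ha, hb]

theorem exists_ladderRep_shift (j : Fin n) (z : ℤ) (hz : z ∈ (ℓ j).dom) (u : Fin n → ℤ)
    (hu : u j = 0) : ∃ c : ℂ, c ≠ 0 ∧ ladderRep ℓ (shift j z) (Finsupp.single u 1)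
      = c • Finsupp.single (u + Pi.single j z) 1 := by
  have hx : ∀ p : ℕ, (p : ℤ) ∈ (ℓ j).dom → ∃ c : ℂ, c ≠ 0 ∧
      ladderRep ℓ (x j ^ p) (Finsupp.single u 1)
        = c • Finsupp.single (u + Pi.single j (p : ℤ)) 1 := by
    intro p
    induction p with
    | zero => exact fun _ => ⟨1, one_ne_zero, by simp⟩
    | succ p ih =>
      intro hp
      obtain ⟨h1, h2⟩ := (ℓ j).up_ne_zero p (Int.natCast_nonneg p) (by exact_mod_cast hp)
      obtain ⟨c, hc, e⟩ := ih h1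
      refine ⟨c * (ℓ j).up p, mul_ne_zero hc h2, ?_⟩
      rw [pow_succ', map_mul, Module.End.mul_apply, e, map_smul, ladderRep_x, Pi.add_apply, hu,
        Pi.single_eq_same, zero_add, smul_smul, add_assoc, ← Pi.single_add]
      push_cast
      rfl
  have hd : ∀ p : ℕ, -(p : ℤ) ∈ (ℓ j).dom → ∃ c : ℂ, c ≠ 0 ∧
      ladderRep ℓ (del j ^ p) (Finsupp.single u 1)
        = c • Finsupp.single (u + Pi.single j (-(p : ℤ))) 1 := by
    intro p
    induction p with
    | zero => exact fun _ => ⟨1, one_ne_zero, by simp⟩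
    | succ p ih =>
      intro hp
      have hp' : -((p : ℤ)) - 1 ∈ (ℓ j).dom := by
        convert hp using 1
        push_cast; ring
      obtain ⟨h1, h2⟩ := (ℓ j).down_ne_zero (-(p : ℤ)) (by omega) hp'
      obtain ⟨c, hc, e⟩ := ih h1
      refine ⟨c * (ℓ j).down (-(p : ℤ)), mul_ne_zero hc h2, ?_⟩
      rw [pow_succ', map_mul, Module.End.mul_apply, e, map_smul, ladderRep_del, Pi.add_apply, hu,
        Pi.single_eq_same, zero_add, smul_smul, add_sub_assoc, ← Pi.single_sub]
      congr 4
      push_cast; ring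
  rcases z with p | p
  · exact hx p hz
  · exact hd (p + 1) hz

theorem torusAct_shift (s : Fin n → Circle) (j : Fin n) (z : ℤ) :
    torusAct s (shift j z) = (s j : ℂ) ^ z • shift j z := by
  have hx : torusAct s (x j) = (s j : ℂ) • x j := lift_x _ _ _ _ _ j
  have hd : torusAct s (del j) = (s j : ℂ)⁻¹ • del j := lift_del _ _ _ _ _ j
  rcases z with p | p
  · change torusAct s (x j ^ p) = _ • x j ^ p
    rw [map_pow, hx, smul_pow, Int.ofNat_eq_natCast, zpow_natCast]
  · change torusAct s (del j ^ (p + 1)) = _ • del j ^ (p + 1)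
    rw [map_pow, hd, smul_pow, zpow_negSucc, inv_pow]

/-- The basis vector of index `0` generates, by homogeneous elements. -/
theorem exists_ladderRep_eq (u : Fin n → ℤ) (hu : ∀ j, u j ∈ (ℓ j).dom) :
    ∃ w : WeylAlgebra n, (∀ s, torusAct s w = torusChar s u • w) ∧
      ladderRep ℓ w (Finsupp.single 0 1) = Finsupp.single u 1 := by
  have key : ∀ F : Finset (Fin n), ∃ w : WeylAlgebra n,
      (∀ s, torusAct s w = torusChar s (∑ j ∈ F, Pi.single j (u j)) • w) ∧
      ∃ c : ℂ, c ≠ 0 ∧ ladderRep ℓ w (Finsupp.single 0 1)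
        = c • Finsupp.single (∑ j ∈ F, Pi.single j (u j)) 1 := by
    intro F
    induction F using Finset.induction_on with
    | empty =>
      refine ⟨1, fun s => ?_, 1, one_ne_zero, by simp⟩
      rw [map_one, Finset.sum_empty, torusChar]
      simp
    | insert j F hj ih =>
      obtain ⟨w, hw, c, hc, e⟩ := ih
      obtain ⟨c', hc', e'⟩ := exists_ladderRep_shift ℓ j (u j) (hu j)
        (∑ i ∈ F, Pi.single i (u i)) (by
          rw [Finset.sum_apply]
          exact Finset.sum_eq_zero fun i hi =>
            Pi.single_eq_of_ne (fun h => hj (by rw [h]; exact hi)) _)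
      refine ⟨shift j (u j) * w, fun s => ?_, c * c', mul_ne_zero hc hc', ?_⟩
      · rw [map_mul, hw, torusAct_shift, Finset.sum_insert hj, torusChar_add, torusChar_single,
          smul_mul_smul_comm]
      · rw [map_mul, Module.End.mul_apply, e, map_smul, e', smul_smul, Finset.sum_insert hj,
          add_comm]
  obtain ⟨w, hw, c, hc, e⟩ := key Finset.univ
  rw [Finset.univ_sum_single] at e
  simp only [Finset.univ_sum_single] at hw
  refine ⟨c⁻¹ • w, fun s => ?_, ?_⟩
  · rw [map_smul, hw, smul_comm]
  · rw [map_smul, LinearMap.smul_apply, e, smul_smul, inv_mul_cancel₀ hc, one_smul]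

end WeylAlgebra

end

noncomputable section

/-! ## Existence of Verma modules -/

namespace AbelianGaugeTheory

open WeylAlgebra

variable {n k d : ℕ} (T : AbelianGaugeTheory n k d) {I : Fin d ↪o Fin n} {J : Fin k ↪o Fin n}

theorem torusChar_gaugeIncl (t : Fin k → Circle) (u : Fin n → ℤ) :
    torusChar (T.gaugeIncl t) u = ∏ a, (t a : ℂ) ^ (T.Qᵀ *ᵥ u) a := by
  have h1 : ∀ j, ((T.gaugeIncl t j : Circle) : ℂ) ^ u j = ∏ a, (t a : ℂ) ^ (T.Q j a * u j) := by
    intro j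
    have h2 : ((T.gaugeIncl t j : Circle) : ℂ) = ∏ a, (t a : ℂ) ^ T.Q j a :=
      (map_prod Circle.coeHom _ _).trans (Finset.prod_congr rfl fun a _ => Circle.coe_zpow _ _)
    rw [h2, ← Finset.prod_zpow]
    exact Finset.prod_congr rfl fun a _ => (zpow_mul _ _ _).symm
  rw [torusChar, Finset.prod_congr rfl fun j _ => h1 j, Finset.prod_comm]
  refine Finset.prod_congr rfl fun a _ => ?_
  have h3 : ∀ F : Finset (Fin n), ∏ j ∈ F, (t a : ℂ) ^ (T.Q j a * u j)
      = (t a : ℂ) ^ ∑ j ∈ F, T.Q j a * u j := by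
    intro F
    induction F using Finset.induction_on with
    | empty => simp
    | insert j F hj ih =>
      rw [Finset.prod_insert hj, ih, Finset.sum_insert hj, zpow_add₀ (Circle.coe_ne_zero _)]
  exact h3 _

theorem torusChar_gaugeIncl_eq_one (t : Fin k → Circle) {u : Fin n → ℤ} (hu : T.Qᵀ *ᵥ u = 0) :
    torusChar (T.gaugeIncl t) u = 1 := by
  rw [torusChar_gaugeIncl, hu]
  simp

theorem mulVec_eq_zero_of_torusChar {u : Fin n → ℤ}
    (hu : ∀ t, torusChar (T.gaugeIncl t) u = 1) : T.Qᵀ *ᵥ u = 0 := by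
  funext a
  by_contra h
  set p : ℤ := (T.Qᵀ *ᵥ u) a with hp
  -- If the $a$-th charge $p$ were nonzero, the element $e^{i\pi/p}$ of the $a$-th circle would act
  -- by $-1$.
  have h1 := hu (Pi.mulSingle a (Circle.exp (Real.pi / p)))
  rw [torusChar_gaugeIncl, Finset.prod_eq_single a (fun b _ hb => by
    rw [Pi.mulSingle_eq_of_ne hb]; simp) (fun h => absurd (Finset.mem_univ a) h),
    Pi.mulSingle_eq_same, ← hp, Circle.coe_exp, ← Complex.exp_int_mul] at h1
  have hp0 : (p : ℂ) ≠ 0 := by exact_mod_cast h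
  have h2 : (p : ℂ) * (((Real.pi / p : ℝ) : ℂ) * Complex.I) = Real.pi * Complex.I := by
    push_cast
    field_simp
  rw [h2, Complex.exp_pi_mul_I] at h1
  norm_num at h1

theorem mem_invariants_iff {w : WeylAlgebra n} :
    w ∈ T.invariants ↔ ∀ t, torusAct (T.gaugeIncl t) w = w := by
  simp [invariants, Algebra.mem_iInf, AlgHom.mem_equalizer]

variable (ℓ : Fin n → Ladder)

/-- The indices of the submodule of the product of one-variable weight modules on which the
invariants of the gauge group act. -/
def ladderSupport : Set (Fin n → ℤ) := {u | T.Qᵀ *ᵥ u = 0 ∧ ∀ j, u j ∈ (ℓ j).dom}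

theorem zero_mem_ladderSupport : 0 ∈ T.ladderSupport ℓ :=
  ⟨Matrix.mulVec_zero _, fun j => (ℓ j).zero_mem⟩

/-- The image is fixed by the gauge torus, since both $w$ and the basis vector are. Hence every
index in its support has trivial gauge character, that is, lies in $\ker Q^T$. -/
theorem ladderRep_single_mem {w : WeylAlgebra n} (hw : w ∈ T.invariants) {u : Fin n → ℤ}
    (hu : u ∈ T.ladderSupport ℓ) :
    ladderRep ℓ w (Finsupp.single u 1) ∈ Finsupp.supported ℂ ℂ (T.ladderSupport ℓ) := by
  have h1 := ladderRep_mem_supported ℓ w _ (Finsupp.single_mem_supported ℂ (1 : ℂ) hu.2)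
  refine (Finsupp.mem_supported ℂ _).2 fun v hv => ⟨?_, (Finsupp.mem_supported ℂ _).1 h1 hv⟩
  refine T.mulVec_eq_zero_of_torusChar fun t => ?_
  have h2 := ladderTorus_ladderRep ℓ (T.gaugeIncl t) w (Finsupp.single u 1)
  rw [ladderTorus_single, T.torusChar_gaugeIncl_eq_one t hu.1, one_smul,
    T.mem_invariants_iff.1 hw t] at h2
  have h3 := DFunLike.congr_fun h2 v
  rw [ladderTorus_apply] at h3
  exact mul_right_cancel₀ (Finsupp.mem_support_iff.1 hv) (h3.trans (one_mul _).symm)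

theorem ladderRep_mem {w : WeylAlgebra n} (hw : w ∈ T.invariants) :
    ∀ y ∈ Finsupp.supported ℂ ℂ (T.ladderSupport ℓ),
      ladderRep ℓ w y ∈ Finsupp.supported ℂ ℂ (T.ladderSupport ℓ) := by
  intro y hy
  rw [Finsupp.supported_eq_span_single] at hy
  induction hy using Submodule.span_induction with
  | mem y hy => obtain ⟨u, hu, rfl⟩ := hy; exact T.ladderRep_single_mem ℓ hw hu
  | zero => rw [map_zero]; exact zero_mem _
  | add y z _ _ h1 h2 => rw [map_add]; exact add_mem h1 h2
  | smul c y _ h1 => rw [map_smul]; exact Submodule.smul_mem _ _ h1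

/-- The action of the invariants of the gauge group. -/
def invariantsRep :
    T.invariants →ₐ[ℂ] Module.End ℂ (Finsupp.supported ℂ ℂ (T.ladderSupport ℓ)) where
  toFun w := (ladderRep ℓ (w : WeylAlgebra n)).restrict (T.ladderRep_mem ℓ w.2)
  map_one' := LinearMap.ext fun y => Subtype.ext <| by
    change ladderRep ℓ 1 (y : (Fin n → ℤ) →₀ ℂ) = y
    rw [map_one]; rfl
  map_mul' a b := LinearMap.ext fun y => Subtype.ext <| by
    change ladderRep ℓ ((a : WeylAlgebra n) * b) (y : (Fin n → ℤ) →₀ ℂ)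
      = ladderRep ℓ a (ladderRep ℓ b y)
    rw [map_mul]; rfl
  map_zero' := LinearMap.ext fun y => Subtype.ext <| by
    change ladderRep ℓ 0 (y : (Fin n → ℤ) →₀ ℂ) = 0
    rw [map_zero]; rfl
  map_add' a b := LinearMap.ext fun y => Subtype.ext <| by
    change ladderRep ℓ ((a : WeylAlgebra n) + b) (y : (Fin n → ℤ) →₀ ℂ)
      = ladderRep ℓ a y + ladderRep ℓ b y
    rw [map_add]; rfl
  commutes' c := LinearMap.ext fun y => Subtype.ext <| by
    change ladderRep ℓ (algebraMap ℂ _ c) (y : (Fin n → ℤ) →₀ ℂ) = c • (y : (Fin n → ℤ) →₀ ℂ)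
    rw [AlgHom.commutes]; rfl

theorem invariantsRep_apply (w : T.invariants)
    (y : Finsupp.supported ℂ ℂ (T.ladderSupport ℓ)) :
    (T.invariantsRep ℓ w y : (Fin n → ℤ) →₀ ℂ) = ladderRep ℓ (w : WeylAlgebra n) y := rfl

theorem ladderRep_shiftedMoment (ζ : Fin n → ℝ) (b : Fin n → ℂ) (u : Fin n → ℤ) :
    ladderRep ℓ (shiftedMoment ζ b) (Finsupp.single u 1)
      = (∑ j, b j * ((ℓ j).weight + u j) + fiChar ζ b) • Finsupp.single u (1 : ℂ) := by
  rw [shiftedMoment, moment, map_add, map_sum, AlgHom.commutes, LinearMap.add_apply,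
    LinearMap.sum_apply, Module.algebraMap_end_apply, add_smul, Finset.sum_smul]
  congr 1
  refine Finset.sum_congr rfl fun j _ => ?_
  rw [map_smul, LinearMap.smul_apply, ladderRep_h, smul_smul]

variable {ℓ} in
-- For a left ideal it is enough that the generators kill the vector. The hypothesis `hℓ` is the
-- moment map relation at index $0$, and moving to an index $u\in\ker Q^T$ changes nothing.
theorem ladderRep_momentIdeal {ζ : Fin n → ℝ}
    (hℓ : ∀ b, ∑ j, (T.Q j b : ℂ) * (ℓ j).weight = -(Complex.I * ∑ j, (ζ j : ℂ) * T.Q j b))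
    {w : WeylAlgebra n} (hw : w ∈ T.momentIdeal ζ) :
    ∀ u ∈ T.ladderSupport ℓ, ladderRep ℓ w (Finsupp.single u 1) = 0 := by
  intro u hu
  induction hw using Submodule.span_induction with
  | mem w hw =>
    obtain ⟨X, rfl⟩ := hw
    have h1 : ∀ f : Fin n → ℂ, ∑ j, (T.Q.map (fun q : ℤ => (q : ℂ)) *ᵥ X) j * f j
        = ∑ b, X b * ∑ j, (T.Q j b : ℂ) * f j := by
      intro f
      simp only [Matrix.mulVec, dotProduct, Matrix.map_apply, Finset.sum_mul, Finset.mul_sum]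
      rw [Finset.sum_comm]
      exact Finset.sum_congr rfl fun b _ => Finset.sum_congr rfl fun j _ => by ring
    have h2 : ∀ b, ∑ j, (T.Q j b : ℂ) * u j = 0 := by
      intro b
      have := congrFun hu.1 b
      simp only [Matrix.mulVec, dotProduct, Matrix.transpose_apply, Pi.zero_apply] at this
      exact_mod_cast this
    have h3 : fiChar ζ (T.Q.map (fun q : ℤ => (q : ℂ)) *ᵥ X)
        = ∑ b, X b * (Complex.I * ∑ j, (ζ j : ℂ) * T.Q j b) := by
      have := h1 fun j => (ζ j : ℂ)
      simp only [mul_comm _ ((ζ _ : ℂ))] at this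
      rw [fiChar, this, Finset.mul_sum]
      exact Finset.sum_congr rfl fun b _ => by ring
    change ladderRep ℓ (shiftedMoment ζ (T.Q.map (fun q : ℤ => (q : ℂ)) *ᵥ X)) _ = 0
    rw [ladderRep_shiftedMoment, h1, h3, ← Finset.sum_add_distrib]
    simp only [mul_add, Finset.sum_add_distrib, h2, hℓ]
    simp
  | zero => rw [map_zero]; rfl
  | add a b _ _ ha hb => rw [map_add, LinearMap.add_apply, ha, hb, add_zero]
  | smul a b _ hb => rw [smul_eq_mul, map_mul, Module.End.mul_apply, hb, map_zero]

variable {ℓ} in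
theorem invariantsRep_eq_of_higgsRel {ζ : Fin n → ℝ}
    (hℓ : ∀ b, ∑ j, (T.Q j b : ℂ) * (ℓ j).weight = -(Complex.I * ∑ j, (ζ j : ℂ) * T.Q j b))
    {a b : T.invariants} (hab : T.higgsRel ζ a b) :
    T.invariantsRep ℓ a = T.invariantsRep ℓ b := by
  have h1 : ∀ y ∈ Finsupp.supported ℂ ℂ (T.ladderSupport ℓ),
      ladderRep ℓ ((a : WeylAlgebra n) - (b : WeylAlgebra n)) y = 0 := by
    intro y hy
    rw [Finsupp.supported_eq_span_single] at hy
    induction hy using Submodule.span_induction with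
    | mem y hy => obtain ⟨u, hu, rfl⟩ := hy; exact T.ladderRep_momentIdeal hℓ hab u hu
    | zero => rw [map_zero]
    | add y z _ _ h1 h2 => rw [map_add, h1, h2, add_zero]
    | smul c y _ h1 => rw [map_smul, h1, smul_zero]
  refine LinearMap.ext fun y => Subtype.ext ?_
  have h2 := h1 y y.2
  have h3 : ladderRep ℓ ((a : WeylAlgebra n) - (b : WeylAlgebra n) + b) = ladderRep ℓ a :=
    congrArg (ladderRep ℓ) (sub_add_cancel _ _)
  rw [map_add] at h3
  have h4 := LinearMap.congr_fun h3 y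
  rw [LinearMap.add_apply, h2, zero_add] at h4
  exact h4.symm

/-- The action of the quantum Higgs branch. -/
def higgsRep {ζ : Fin n → ℝ}
    (hℓ : ∀ b, ∑ j, (T.Q j b : ℂ) * (ℓ j).weight = -(Complex.I * ∑ j, (ζ j : ℂ) * T.Q j b)) :
    T.Higgs ζ →ₐ[ℂ] Module.End ℂ (Finsupp.supported ℂ ℂ (T.ladderSupport ℓ)) :=
  RingQuot.liftAlgHom ℂ ⟨T.invariantsRep ℓ, fun _ _ hab => T.invariantsRep_eq_of_higgsRel hℓ hab⟩

theorem higgsRep_toHiggs {ζ : Fin n → ℝ}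
    (hℓ : ∀ b, ∑ j, (T.Q j b : ℂ) * (ℓ j).weight = -(Complex.I * ∑ j, (ζ j : ℂ) * T.Q j b))
    (w : T.invariants) : T.higgsRep ℓ hℓ (T.toHiggs ζ w) = T.invariantsRep ℓ w :=
  RingQuot.liftAlgHom_mkAlgHom_apply _ _ _ _

/-- The one-variable weight modules whose product contains the Verma module. -/
theorem exists_ladder (hIJ : IsCompl (Set.range I) (Set.range J)) {m ζ : Fin n → ℝ}
    (hm : ∀ t, T.massCoord m I t ≠ 0) (hζ : ∀ a, T.fiCoord ζ J a ≠ 0) :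
    ∃ ℓ : Fin n → Ladder, (∀ j, (ℓ j).weight = T.vermaWeight hIJ m ζ 0 j) ∧
      (∀ t z, z ∈ (ℓ (I t)).dom ↔ 0 ≤ -T.massSign m I t * z) ∧
      ∀ a z, z ∈ (ℓ (J a)).dom := by
  have h : ∀ j, ∃ l : Ladder, l.weight = T.vermaWeight hIJ m ζ 0 j ∧
      (∀ t z, j = I t → (z ∈ l.dom ↔ 0 ≤ -T.massSign m I t * z)) ∧
      ∀ a z, j = J a → z ∈ l.dom := by
    have hne : ∀ t a, I t ≠ J a := fun t a h =>
      Set.disjoint_left.1 hIJ.disjoint ⟨t, rfl⟩ ⟨a, h.symm⟩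
    refine forall_complEquiv hIJ (fun t => ?_) fun a => ?_
    · rcases T.massSign_eq hm t with hs | hs
      · refine ⟨Ladder.highest, ?_, fun t' z h => ?_, fun a z h => absurd h (hne t a)⟩
        · rw [T.vermaWeight_left, hs]
          simp [Ladder.highest]
        · rw [← I.injective h, hs]
          change z ≤ 0 ↔ _
          omega
      · refine ⟨Ladder.lowest, ?_, fun t' z h => ?_, fun a z h => absurd h (hne t a)⟩
        · rw [T.vermaWeight_left, hs]
          simp [Ladder.lowest]
        · rw [← I.injective h, hs]
          change 0 ≤ z ↔ _
          omega
    · refine ⟨Ladder.dense (T.vermaWeight hIJ m ζ 0 (J a)) ?_, rfl,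
        fun t z h => absurd h.symm (hne t a), fun a' z h => trivial⟩
      -- The sum over $t$ is real, so the imaginary part of the weight is $-z^!_a\ne0$.
      rw [T.vermaWeight_right]
      have h1 : ∑ t, (T.massSign m I t : ℂ) * T.dualR J (I t) a
            * (((0 : Fin d → ℕ) t : ℂ) + 1 / 2)
          = ((∑ t, (T.massSign m I t : ℝ) * T.dualR J (I t) a * (1 / 2) : ℝ) : ℂ) := by
        push_cast
        simp
      rw [h1, Complex.neg_im, Complex.sub_im, Complex.ofReal_im, sub_zero, Complex.I_mul_im,
        Complex.ofReal_re]
      exact neg_ne_zero.2 (hζ a)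
  choose ℓ h1 h2 h3 using h
  exact ⟨ℓ, h1, fun t z => h2 _ t z rfl, fun a z => h3 _ a z rfl⟩

/-- For the columns of $R^!_J$ the relation holds because the weights on $J$ were defined by solving
it; the columns of $Q=R^!_JQ_J$ are combinations of these. -/
theorem sum_Q_mul_vermaWeight (hIJ : IsCompl (Set.range I) (Set.range J))
    (hI : IsUnit (T.minorP I).det) (m ζ : Fin n → ℝ) (b : Fin k) :
    ∑ j, (T.Q j b : ℂ) * T.vermaWeight hIJ m ζ 0 j
      = -(Complex.I * ∑ j, (ζ j : ℂ) * T.Q j b) := by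
  have hJ := T.isUnit_det_minorQ hIJ hI
  have h1 : ∀ a, ∑ j, (T.dualR J j a : ℂ) * T.vermaWeight hIJ m ζ 0 j
      = -(Complex.I * ∑ j, (ζ j : ℂ) * T.dualR J j a) := by
    intro a
    rw [sum_complEquiv hIJ]
    simp only [T.dualR_apply_self hJ]
    rw [Finset.sum_eq_single (f := fun a' => (((if a' = a then 1 else 0 : ℤ) : ℂ)) * _) a
      (fun b _ hb => by simp [hb]) (fun h => absurd (Finset.mem_univ a) h)]
    simp only [T.vermaWeight_left, T.vermaWeight_right, T.fiCoord_eq]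
    rw [neg_sub, if_pos trivial, Int.cast_one, one_mul, ← add_sub_assoc, ← Finset.sum_add_distrib]
    push_cast
    rw [Finset.sum_eq_zero fun t _ => by ring, zero_sub]
    congr 2
    exact Finset.sum_congr rfl fun j _ => mul_comm _ _
  have h2 : ∀ j, (T.Q j b : ℂ) = ∑ a, (T.dualR J j a : ℂ) * T.minorQ J a b := by
    intro j
    have : T.dualR J * T.minorQ J = T.Q := by
      rw [dualR, Matrix.mul_assoc, Matrix.nonsing_inv_mul _ hJ, Matrix.mul_one]
    have := congrFun (congrFun this j) b
    rw [Matrix.mul_apply] at this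
    rw [← this]
    push_cast
    rfl
  simp only [h2, Finset.sum_mul, Finset.mul_sum]
  rw [Finset.sum_comm, Finset.sum_comm (f := fun j a => Complex.I * _), ← Finset.sum_neg_distrib]
  refine Finset.sum_congr rfl fun a _ => ?_
  have h3 := congrArg (fun y => (T.minorQ J a b : ℂ) * y) (h1 a)
  simp only [mul_neg, Finset.mul_sum] at h3
  rw [Finset.sum_congr rfl fun j _ => show (T.dualR J j a : ℂ) * T.minorQ J a b
    * T.vermaWeight hIJ m ζ 0 j = T.minorQ J a b * (T.dualR J j a * T.vermaWeight hIJ m ζ 0 j) by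
      ring, h3]
  congr 1
  exact Finset.sum_congr rfl fun j _ => by ring

/-- The basis vectors of the Verma module are indexed by the non-negative flavor charges. -/
theorem exists_equiv_ladderSupport (hIJ : IsCompl (Set.range I) (Set.range J))
    (hI : IsUnit (T.minorP I).det) {m : Fin n → ℝ} (hm : ∀ t, T.massCoord m I t ≠ 0)
    (h1 : ∀ t z, z ∈ (ℓ (I t)).dom ↔ 0 ≤ -T.massSign m I t * z)
    (h2 : ∀ a z, z ∈ (ℓ (J a)).dom) :
    ∃ e : (Fin d → ℕ) ≃ T.ladderSupport ℓ,
      ∀ c t, (e c : Fin n → ℤ) (I t) = -T.massSign m I t * c t := by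
  have hs : ∀ t, T.massSign m I t * T.massSign m I t = 1 := fun t => by
    rcases T.massSign_eq hm t with h | h <;> rw [h] <;> norm_num
  have hRI : ∀ (p : Fin d → ℤ) t, (T.R I *ᵥ p) (I t) = p t := by
    intro p t
    simp [Matrix.mulVec, dotProduct, T.R_apply_self hI]
  have hRQ : ∀ p : Fin d → ℤ, T.Qᵀ *ᵥ (T.R I *ᵥ p) = 0 := by
    intro p
    rw [R, ← Matrix.mulVec_mulVec]
    exact (T.exact _).2 ⟨_, rfl⟩
  have hinj : ∀ u v : Fin n → ℤ, T.Qᵀ *ᵥ u = 0 → T.Qᵀ *ᵥ v = 0 → (∀ t, u (I t) = v (I t)) →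
      u = v := by
    intro u v hu hv huv
    obtain ⟨p, rfl⟩ := (T.exact u).1 hu
    obtain ⟨q, rfl⟩ := (T.exact v).1 hv
    congr 1
    refine Matrix.mulVec_injective_of_isUnit ((Matrix.isUnit_iff_isUnit_det _).2 hI) ?_
    exact funext huv
  -- The unique vector in $\operatorname{im}P$ with coordinates $-\sigma_tc_t$ on $I$. As
  -- $\sigma_t^2=1$, the same multiplication by $-\sigma_t$ recovers $c_t$.
  refine ⟨⟨fun c => ⟨T.R I *ᵥ fun t => -T.massSign m I t * c t, hRQ _, ?_⟩,
    fun u t => (-T.massSign m I t * (u : Fin n → ℤ) (I t)).toNat, fun c => ?_, fun u => ?_⟩,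
    fun c t => hRI _ t⟩
  · refine forall_complEquiv hIJ (fun t => ?_) fun a => h2 a _
    rw [h1, hRI, ← mul_assoc, neg_mul_neg, hs, one_mul]
    exact Int.natCast_nonneg _
  · funext t
    dsimp only
    rw [hRI, ← mul_assoc, neg_mul_neg, hs, one_mul, Int.toNat_natCast]
  · refine Subtype.ext (hinj _ _ (hRQ _) u.2.1 fun t => ?_)
    refine (hRI _ t).trans ?_
    rw [Int.toNat_of_nonneg ((h1 t _).1 (u.2.2 _)), ← mul_assoc, neg_mul_neg, hs, one_mul]

theorem exists_isVermaBasis (hIJ : IsCompl (Set.range I) (Set.range J))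
    (hI : IsUnit (T.minorP I).det) {m ζ : Fin n → ℝ}
    (hm : ∀ t, T.massCoord m I t ≠ 0) (hζ : ∀ a, T.fiCoord ζ J a ≠ 0) :
    ∃ (M : Type) (_ : AddCommGroup M) (_ : Module ℂ M) (_ : Module (T.Higgs ζ) M)
      (_ : IsScalarTower ℂ (T.Higgs ζ) M) (v : Module.Basis (Fin d → ℕ) ℂ M),
      T.IsVermaBasis m ζ I v := by
  obtain ⟨ℓ, hw, h1, h2⟩ := T.exists_ladder hIJ hm hζ
  obtain ⟨e, he⟩ := T.exists_equiv_ladderSupport ℓ hIJ hI hm h1 h2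
  have hℓ : ∀ b, ∑ j, (T.Q j b : ℂ) * (ℓ j).weight
      = -(Complex.I * ∑ j, (ζ j : ℂ) * T.Q j b) := by
    simp only [hw]
    exact T.sum_Q_mul_vermaWeight hIJ hI m ζ
  let : Module (T.Higgs ζ) (Finsupp.supported ℂ ℂ (T.ladderSupport ℓ)) :=
    Module.compHom _ (T.higgsRep ℓ hℓ).toRingHom
  have hsmul : ∀ (a : T.Higgs ζ) (y : Finsupp.supported ℂ ℂ (T.ladderSupport ℓ)),
    a • y = T.higgsRep ℓ hℓ a y := fun _ _ => rfl
  have htower : IsScalarTower ℂ (T.Higgs ζ) (Finsupp.supported ℂ ℂ (T.ladderSupport ℓ)) :=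
    ⟨fun c a y => by rw [hsmul, hsmul, map_smul, LinearMap.smul_apply]⟩
  let v : Module.Basis (Fin d → ℕ) ℂ (Finsupp.supported ℂ ℂ (T.ladderSupport ℓ)) :=
    (Module.Basis.ofRepr (Finsupp.supportedEquivFinsupp (T.ladderSupport ℓ))).reindex e.symm
  have hv : ∀ c, (v c : (Fin n → ℤ) →₀ ℂ) = Finsupp.single (e c : Fin n → ℤ) 1 := by
    intro c
    have h3 : v c = (Finsupp.supportedEquivFinsupp (T.ladderSupport ℓ)).symm
        (Finsupp.single (e c) 1) := by
      rw [Module.Basis.reindex_apply, Equiv.symm_symm, Module.Basis.coe_ofRepr]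
    rw [h3, Finsupp.supportedEquivFinsupp_symm_single]
  have he0 : (e 0 : Fin n → ℤ) = 0 := by
    have h3 : e 0 = ⟨0, T.zero_mem_ladderSupport ℓ⟩ := by
      rw [← Equiv.eq_symm_apply]
      funext t
      have h4 := he (e.symm ⟨0, T.zero_mem_ladderSupport ℓ⟩) t
      rw [Equiv.apply_symm_apply] at h4
      change 0 = _ at h4
      change 0 = (e.symm ⟨0, T.zero_mem_ladderSupport ℓ⟩ : Fin d → ℕ) t
      rcases T.massSign_eq hm t with h | h <;> rw [h] at h4 <;> omega
    rw [h3]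
  refine ⟨_, inferInstance, inferInstance, this, htower, v, fun c t => ?_, ?_⟩
  · refine Subtype.ext ?_
    rw [hsmul, hHiggs, T.higgsRep_toHiggs, T.invariantsRep_apply, Submodule.coe_smul, hv,
      ladderRep_h, hw, he, T.vermaWeight_left]
    congr 1
    push_cast
    simp
    ring
  · have h3 : ∀ c, v c ∈ Submodule.span (T.Higgs ζ) {v 0} := by
      intro c
      -- The element that carries index $0$ to the index of $v_c$ is homogeneous of a weight in
      -- $\ker Q^T$, hence gauge invariant; it gives an element of the quantum Higgs branch that
      -- maps $v_0$ to $v_c$.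
      obtain ⟨w, hwt, hwe⟩ := exists_ladderRep_eq ℓ (e c) (e c).2.2
      have hwi : w ∈ T.invariants := T.mem_invariants_iff.2 fun t => by
        rw [hwt, T.torusChar_gaugeIncl_eq_one t (e c).2.1, one_smul]
      refine Submodule.mem_span_singleton.2 ⟨T.toHiggs ζ ⟨w, hwi⟩, Subtype.ext ?_⟩
      rw [hsmul, T.higgsRep_toHiggs, T.invariantsRep_apply, hv, hv, he0]
      exact hwe
    rw [eq_top_iff]
    intro y _
    rw [← v.linearCombination_repr y, Finsupp.linearCombination_apply]
    refine Submodule.sum_mem _ fun c _ => ?_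
    change v.repr y c • v c ∈ _
    rw [← algebraMap_smul (T.Higgs ζ)]
    exact Submodule.smul_mem _ _ (h3 c)

end AbelianGaugeTheory

/-! ### The main theorem -/

theorem mainTheorem5 {n k d : ℕ} (T : AbelianGaugeTheory n k d) (m ζ : Fin n → ℝ)
    (I : Fin d ↪o Fin n) (J : Fin k ↪o Fin n) (hIJ : IsCompl (Set.range I) (Set.range J))
    (hI : IsUnit (T.minorP I).det)
    (hm : ∀ t, T.massCoord m I t ≠ 0) (hζ : ∀ a, T.fiCoord ζ J a ≠ 0) :
    (∃ (M : Type) (_ : AddCommGroup M) (_ : Module ℂ M) (_ : Module (T.Higgs ζ) M)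
        (_ : IsScalarTower ℂ (T.Higgs ζ) M) (v : Module.Basis (Fin d → ℕ) ℂ M),
        T.IsVermaBasis m ζ I v) ∧
      ∃ ε₀ : ℝ, 0 < ε₀ ∧ ∀ ε : ℝ, 0 < ε → ε < ε₀ → ∀ w : T.invariants,
        MeasureTheory.Integrable (T.boundaryIntegrand m ζ J ε (w : WeylAlgebra n)) ∧
        ∀ (M : Type*) [AddCommGroup M] [Module ℂ M] [Module (T.Higgs ζ) M]
          [IsScalarTower ℂ (T.Higgs ζ) M] (v : Module.Basis (Fin d → ℕ) ℂ M),
          T.IsVermaBasis m ζ I v →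
          Summable (T.vermaDiag m ζ I v (T.toHiggs ζ w)) ∧
          T.boundaryTrace m ζ J ε (w : WeylAlgebra n)
            = T.coefficient m ζ I J * T.vermaTrace m ζ I v (T.toHiggs ζ w) ∧
          T.inheritedTrace m ζ J ε (w : WeylAlgebra n)
            = (T.minorQ J).det * (∏ a, (T.fiSign ζ J a : ℂ)) * T.coefficient m ζ I J
              * T.vermaTrace m ζ I v (T.toHiggs ζ w) := by
  have hex := T.exists_isVermaBasis hIJ hI hm hζ
  obtain ⟨ε₀, hε₀, h⟩ := T.exists_margin (J := J) m hm
  refine ⟨hex, ε₀, hε₀, fun ε hε hlt w => ?_⟩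
  obtain ⟨δ, hδ, hR⟩ := h ε hlt
  constructor
  -- Integrability does not involve a module; the Verma module just constructed is used to obtain it
  -- from `trace_formula`.
  · obtain ⟨M, _, _, _, _, v, hv⟩ := hex
    exact (T.trace_formula hIJ hI hm hζ hε hδ hR w hv).1
  · intro M _ _ _ _ v hv
    obtain ⟨-, hs, he⟩ := T.trace_formula hIJ hI hm hζ hε hδ hR w hv
    refine ⟨hs, he, ?_⟩
    rw [T.inheritedTrace_eq hIJ hI m hζ, he, mul_assoc (_ * _)]

end
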